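/- Let $F$ be a number field with ring of integers $O_F$, discriminant $\Delta$, regulator $R$, class number $h$ and $w$ roots of unity, and put $\alpha = Rh$. An Arakelov vector bundle $V$ over $F$ is a finite-dimensional $F$-vector space $V$ with an $O_F$-lattice $\Gamma(V)\subset V$ (finitely generated and spanning $V$) and, for every embedding $\sigma\colon F\to\mathbb{C}$, a positive definite Hermitian metric $\langle\,,\rangle_\sigma$ on $V\otimes_\sigma\mathbb{C}$, such that $\overline{\langle x\otimes 1,y\otimes 1\rangle_\sigma}=\langle x\otimes 1,y\otimes 1\rangle_{\bar\sigma}$ for all $x,y$. Duals $V^\vee$, determinants and subbundles (with $\Gamma(W)=\Gamma(V)\cap W$ for a subspace $W\subset V$) carry the induced lattices and metrics. For an infinite place $v$ let $n_v\in\{1,2\}$ be the local degree and $\|x\|_v^2=\langle x\otimes1,x\otimes1\rangle_{\sigma_v}$ for an embedding $\sigma_v$ inducing $v$. For a bundle $L$ of rank $1$ and any $0\ne x\in L$ put $N(L)=\prod_{v\mid\infty}\|x\|_v^{-n_v}\prod_{v\nmid\infty}N(v)^{\operatorname{ord}_v(x)}$, where $N(v)$ is the cardinality of the residue field at the finite place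 $v$ and $\operatorname{ord}_v(x)$ is the largest $m$ such that $x\in\mathfrak{p}_v^m\Gamma(L)$ locally at $v$; this is independent of $x$. In general $N(V)=N(\det V)$. For a line $P\subset V$ let $H(P)=N(P^\vee)$, where $P$ carries the subbundle structure, and let $Z(\mathbb{P}(V),s)=\sum_{P\in\mathbb{P}(V)(F)}H(P)^{-s}$, the sum being over all lines $P$ in $V$. Let $\mathrm{Div}(F)=\prod_{v\mid\infty}\mathbb{R}\times\bigoplus_{v\nmid\infty}\mathbb{Z}$ carry the product of Lebesgue and counting measure. For $D=(x_v)_v\in\mathrm{Div}(F)$ put $N(D)=\exp\bigl(\sum_{v\mid\infty}x_v+\sum_{v\nmid\infty}x_v\log N(v)\bigr)$, and let $e(D)=\prod_{v\mid\infty}\exp(-n_v\pi e^{-2x_v/n_v})$ if $x_v\ge 0$ for all finite $v$, and $e(D)=0$ otherwise. Put $$\xi(s)=\int_{\mathrm{Div}(F)}N(D)^{-s}e(D)\,dD\qquad(\operatorname{Re}s>1),$$ which is the Dedekind zeta function of $F$ multiplied by the gamma factor $2^{-r_1}\bigl(\pi^{-s/2}\Gamma(s/2)\bigr)^{r_1}\bigl((2\pi)^{-s}\Gamma(s)\bigr)^{r_2}$,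 where $r_1$ and $r_2$ are the numbers of real and complex places of $F$. The function $\xi$ extends meromorphically to $\mathbb{C}$, and the extension is again denoted $\xi$. Theorem. Let $V$ be an Arakelov vector bundle over $F$ of rank $r\ge 1$. (i) The series $Z(\mathbb{P}(V),s)$ converges absolutely to a holomorphic function on $\{\operatorname{Re}s>r\}$, and this function extends to a meromorphic function on $\mathbb{C}$, again denoted $Z(\mathbb{P}(V),s)$; likewise for $V^\vee$. (ii) In $\{\operatorname{Re}s>1\}$ the function $Z(\mathbb{P}(V),s)$ has no pole other than possibly $s=r$. If $r\ge 2$, it has a simple pole at $s=r$, with $$\operatorname{Res}_{s=r}Z(\mathbb{P}(V),s)=\frac{\alpha\,N(V)}{w\,|\Delta|^{r/2}\,\xi(r)}.$$ (iii) As meromorphic functions of $s\in\mathbb{C}$, $$N(V)^{-1/2}|\Delta|^{s/2}\xi(s)Z(\mathbb{P}(V),s)=N(V^\vee)^{-1/2}|\Delta|^{(r-s)/2}\xi(r-s)Z(\mathbb{P}(V^\vee),r-s).$$ -/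

import Mathlib

open scoped TensorProduct NumberField
open Module
open scoped LinearAlgebra.Projectivization

noncomputable section

namespace Arakelov

section Hermitian

variable {A : Type*} [RCLike A] {M N : Type*} [AddCommGroup M] [Module A M]
  [AddCommGroup N] [Module A N]

/-- The Hermitian metric induced along an injective linear map. -/
abbrev pullbackCore (c : InnerProductSpace.Core A N) (f : M →ₗ[A] N)
    (hf : Function.Injective f) : InnerProductSpace.Core A M where
  inner x y := c.inner (f x) (f y)
  conj_inner_symm x y := c.conj_inner_symm (f x) (f y)
  re_inner_nonneg x := c.re_inner_nonneg (f x)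
  add_left x y z := by rw [map_add]; exact c.add_left _ _ _
  smul_left x y a := by rw [map_smul]; exact c.smul_left _ _ _
  definite x hx := hf ((c.definite _ hx).trans (map_zero f).symm)

/-- The standard Hermitian metric `∑ i, conj (x i) * y i` on `A ^ ι`. -/
abbrev standardCore (ι : Type*) [Fintype ι] : InnerProductSpace.Core A (ι → A) where
  inner x y := ∑ i, starRingEnd A (x i) * y i
  conj_inner_symm x y := by simp [mul_comm]
  re_inner_nonneg x := by
    rw [map_sum]
    exact Finset.sum_nonneg fun i _ => by rw [RCLike.conj_mul]; norm_cast; positivity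
  add_left x y z := by simp [add_mul, Finset.sum_add_distrib]
  smul_left x y a := by simp [Finset.mul_sum, mul_assoc]
  definite x hx := by
    have h : ∑ i, ‖x i‖ ^ 2 = 0 := by
      have : (∑ i, starRingEnd A (x i) * x i) = ((∑ i, ‖x i‖ ^ 2 : ℝ) : A) := by
        push_cast
        exact Finset.sum_congr rfl fun i _ => RCLike.conj_mul _
      rw [this] at hx
      exact_mod_cast hx
    rw [Finset.sum_eq_zero_iff_of_nonneg (fun i _ => by positivity)] at h
    funext i
    simpa using h i (Finset.mem_univ i)

theorem exists_orthonormal [FiniteDimensional A M] (c : InnerProductSpace.Core A M) {n : ℕ}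
    (hn : finrank A M = n) :
    ∃ e : Basis (Fin n) A M, ∀ i j, c.inner (e i) (e j) = if i = j then 1 else 0 := by
  subst hn
  let := c.toNormedAddCommGroup
  let := InnerProductSpace.ofCore c.toCore
  refine ⟨(stdOrthonormalBasis A M).toBasis, fun i j => ?_⟩
  have := orthonormal_iff_ite.1 (stdOrthonormalBasis A M).orthonormal i j
  simpa using this

/-- An orthonormal basis of a Hermitian space of dimension `n`. -/
def orthoBasis [FiniteDimensional A M] (c : InnerProductSpace.Core A M) {n : ℕ}
    (hn : finrank A M = n) : Basis (Fin n) A M :=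
  (exists_orthonormal c hn).choose

theorem orthoBasis_inner [FiniteDimensional A M] (c : InnerProductSpace.Core A M) {n : ℕ}
    (hn : finrank A M = n) (i j : Fin n) :
    c.inner (orthoBasis c hn i) (orthoBasis c hn j) = if i = j then 1 else 0 :=
  (exists_orthonormal c hn).choose_spec i j

/-- In orthonormal coordinates the metric is the standard one. -/
theorem inner_eq_sum [FiniteDimensional A M] (c : InnerProductSpace.Core A M) {n : ℕ}
    (hn : finrank A M = n) (x y : M) :
    c.inner x y = ∑ i, starRingEnd A ((orthoBasis c hn).repr x i) * (orthoBasis c hn).repr y i := by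
  let := c.toNormedAddCommGroup
  let := InnerProductSpace.ofCore c.toCore
  have h : ∀ i j, inner A (orthoBasis c hn i) (orthoBasis c hn j) = if i = j then (1 : A) else 0 :=
    orthoBasis_inner c hn
  change inner A x y = _
  conv_lhs => rw [← (orthoBasis c hn).sum_repr x, ← (orthoBasis c hn).sum_repr y]
  simp only [sum_inner, inner_sum, inner_smul_left, inner_smul_right, h]
  simp [mul_comm]

end Hermitian

section BaseChange

variable {F A V : Type*} [Field F] [RCLike A] [Algebra F A] [AddCommGroup V] [Module F V]
  [FiniteDimensional F V]

theorem finrank_baseChange' : finrank A (A ⊗[F] V) = finrank F V := by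
  exact Module.finrank_baseChange

/-- The pairing `(c ⊗ f, d ⊗ v) ↦ c * d * f v`. -/
def dualPairing (F A V : Type*) [Field F] [RCLike A] [Algebra F A] [AddCommGroup V] [Module F V] :
    A ⊗[F] Dual F V →ₗ[A] Dual A (A ⊗[F] V) :=
  LinearMap.liftBaseChange A (Module.Dual.baseChange A)

theorem dualPairing_tmul (c d : A) (f : Dual F V) (v : V) :
    dualPairing F A V (c ⊗ₜ f) (d ⊗ₜ v) = c * (d * algebraMap F A (f v)) := by
  simp [dualPairing, Algebra.smul_def, mul_comm]

theorem dualPairing_injective : Function.Injective (dualPairing F A V) := by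
  have : dualPairing F A V =
      (TensorProduct.isBaseChange F V A).toDualBaseChange.toLinearMap := by
    ext f v
    have := (TensorProduct.isBaseChange F V A).toDualBaseChange_tmul 1 f v
    simp at this
    simp [dualPairing_tmul, this]
  rw [this]
  exact LinearEquiv.injective _


/-- The metric on `A ⊗ V^∨` dual to `c`. -/
abbrev dualCore (c : InnerProductSpace.Core A (A ⊗[F] V)) :
    InnerProductSpace.Core A (A ⊗[F] Dual F V) :=
  pullbackCore (standardCore (Fin (finrank F V)))
    (LinearMap.pi fun i => (LinearMap.applyₗ (orthoBasis c finrank_baseChange i)) ∘ₗ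
      dualPairing F A V)
    (by
      intro f g h
      apply dualPairing_injective
      refine (orthoBasis c finrank_baseChange).ext fun i => ?_
      exact congrFun h i)

theorem dualCore_inner (c : InnerProductSpace.Core A (A ⊗[F] V)) (f g : A ⊗[F] Dual F V) :
    (dualCore c).inner f g = ∑ i,
      starRingEnd A (dualPairing F A V f (orthoBasis c finrank_baseChange i)) *
        dualPairing F A V g (orthoBasis c finrank_baseChange i) := rfl

/-- The dual metric is characterized through the Riesz representation. -/
theorem dualCore_inner_riesz (c : InnerProductSpace.Core A (A ⊗[F] V)) (f g : A ⊗[F] Dual F V)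
    (y z : A ⊗[F] V) (hf : ∀ x, dualPairing F A V f x = c.inner y x)
    (hg : ∀ x, dualPairing F A V g x = c.inner z x) :
    (dualCore c).inner f g = c.inner z y := by
  rw [dualCore_inner, inner_eq_sum c finrank_baseChange]
  refine Finset.sum_congr rfl fun i _ => ?_
  rw [hf, hg, inner_eq_sum c finrank_baseChange, inner_eq_sum c finrank_baseChange]
  simp [Finsupp.single_apply, mul_comm]

/-- The Gram matrix of a family of vectors of `V`. -/
def gram (c : InnerProductSpace.Core A (A ⊗[F] V)) {n : ℕ} (x y : Fin n → V) :
    Matrix (Fin n) (Fin n) A :=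
  Matrix.of fun i j => c.inner (1 ⊗ₜ x i) (1 ⊗ₜ y j)

theorem gram_eq (c : InnerProductSpace.Core A (A ⊗[F] V)) (x y : Fin (finrank F V) → V) :
    gram c x y =
      ((orthoBasis c finrank_baseChange).toMatrix fun i => (1 : A) ⊗ₜ[F] x i).conjTranspose *
      ((orthoBasis c finrank_baseChange).toMatrix fun i => (1 : A) ⊗ₜ[F] y i) := by
  ext i j
  simp only [gram, Matrix.of_apply, Matrix.mul_apply, Matrix.conjTranspose_apply,
    Basis.toMatrix_apply]
  exact inner_eq_sum c finrank_baseChange _ _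

theorem dualCore_inner_gram (c : InnerProductSpace.Core A (A ⊗[F] V))
    (b : Basis (Fin (finrank F V)) F V) (f g : Dual F V) :
    (dualCore c).inner (1 ⊗ₜ f) (1 ⊗ₜ g) =
      (fun i => algebraMap F A (g (b i))) ⬝ᵥ
        ((gram c b b)⁻¹.mulVec (star fun i => algebraMap F A (f (b i)))) := by
  set e := orthoBasis c finrank_baseChange with he
  set P := e.toMatrix fun i => (1 : A) ⊗ₜ[F] b i with hP
  have hPu : IsUnit P.det := by
    have : P = e.toMatrix (Algebra.TensorProduct.basis A b) := by
      rw [hP]; congr 1; ext i; simp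
    rw [this, ← Basis.det_apply]
    exact e.isUnit_det _
  have key : ∀ h : Dual F V, (fun i => algebraMap F A (h (b i))) =
      Matrix.vecMul (fun i => dualPairing F A V (1 ⊗ₜ h) (e i)) P := by
    intro h
    funext j
    have h1 := congrArg (dualPairing F A V (1 ⊗ₜ h)) (e.sum_repr ((1 : A) ⊗ₜ[F] b j))
    rw [dualPairing_tmul, one_mul, one_mul] at h1
    rw [← h1, map_sum]
    simp only [map_smul, smul_eq_mul, Matrix.vecMul, dotProduct, hP, Basis.toMatrix_apply]
    exact Finset.sum_congr rfl fun i _ => mul_comm _ _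
  have hG : gram c b b = P.conjTranspose * P := gram_eq c b b
  have hPc : IsUnit P.conjTranspose.det := by rw [Matrix.det_conjTranspose]; exact hPu.star
  rw [dualCore_inner, ← he, key f, key g, hG, Matrix.mul_inv_rev, Matrix.star_vecMul,
    Matrix.mulVec_mulVec, Matrix.mul_assoc, Matrix.nonsing_inv_mul _ hPc, Matrix.mul_one,
    Matrix.dotProduct_mulVec, Matrix.vecMul_vecMul, Matrix.mul_nonsing_inv _ hPu, Matrix.vecMul_one]
  simp only [dotProduct, Pi.star_apply]
  exact Finset.sum_congr rfl fun i _ => mul_comm _ _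

/-- The functional `c ⊗ (x₁ ∧ ⋯ ∧ xᵣ) ↦ c * det (x₁, …, xᵣ)`, where the determinant is taken with
respect to an `A`-basis of `A ⊗ V`. -/
def detFunctional (e : Basis (Fin (finrank F V)) A (A ⊗[F] V)) :
    A ⊗[F] (⋀[F]^(finrank F V) V) →ₗ[A] A :=
  LinearMap.liftBaseChange A <| exteriorPower.alternatingMapLinearEquiv
    { toFun := fun x => e.det fun i => (1 : A) ⊗ₜ[F] x i
      map_update_add' := by
        intro _ x i a b
        have h : ∀ v, (fun j => (1 : A) ⊗ₜ[F] Function.update x i v j) =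
            Function.update (fun j => (1 : A) ⊗ₜ[F] x j) i (1 ⊗ₜ v) := by
          intro v; funext j; by_cases hj : j = i
          · subst hj; simp
          · simp [hj]
        simp only [h, TensorProduct.tmul_add, AlternatingMap.map_update_add]
      map_update_smul' := by
        intro _ x i a b
        have h : ∀ v, (fun j => (1 : A) ⊗ₜ[F] Function.update x i v j) =
            Function.update (fun j => (1 : A) ⊗ₜ[F] x j) i (1 ⊗ₜ v) := by
          intro v; funext j; by_cases hj : j = i
          · subst hj; simp
          · simp [hj]
        rw [h, h, TensorProduct.tmul_smul, ← algebraMap_smul A a ((1 : A) ⊗ₜ[F] b),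
          AlternatingMap.map_update_smul, algebraMap_smul]
      map_eq_zero_of_eq' := by
        intro x i j hij hne
        exact e.det.map_eq_zero_of_eq _ (by rw [hij]) hne }

theorem detFunctional_tmul (e : Basis (Fin (finrank F V)) A (A ⊗[F] V)) (c : A)
    (x : Fin (finrank F V) → V) :
    detFunctional e (c ⊗ₜ exteriorPower.ιMulti F _ x) = c * e.det fun i => (1 : A) ⊗ₜ[F] x i := by
  simp [detFunctional]

theorem finrank_top : finrank F (⋀[F]^(finrank F V) V) = 1 := by
  rw [exteriorPower.finrank_eq, Nat.choose_self]

theorem detFunctional_injective (e : Basis (Fin (finrank F V)) A (A ⊗[F] V)) :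
    Function.Injective (detFunctional e) := by
  have hs : Function.Surjective (detFunctional e) := by
    apply LinearMap.surjective
    intro h
    have h1 := detFunctional_tmul e 1 (finBasis F V)
    rw [h, LinearMap.zero_apply, one_mul] at h1
    have h2 : (fun i => (1 : A) ⊗ₜ[F] (finBasis F V) i) =
        Algebra.TensorProduct.basis A (finBasis F V) := by ext i; simp
    rw [h2] at h1
    exact (e.isUnit_det (Algebra.TensorProduct.basis A (finBasis F V))).ne_zero h1.symm
  refine (LinearMap.injective_iff_surjective_of_finrank_eq_finrank ?_).2 hs
  rw [finrank_baseChange, finrank_top, finrank_self]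

/-- The metric on `A ⊗ det V` induced by `c`. -/
abbrev detCore (c : InnerProductSpace.Core A (A ⊗[F] V)) :
    InnerProductSpace.Core A (A ⊗[F] (⋀[F]^(finrank F V) V)) :=
  pullbackCore (standardCore Unit)
    (LinearMap.pi fun _ => detFunctional (orthoBasis c finrank_baseChange))
    (fun _ _ h => detFunctional_injective _ (congrFun h ()))

/-- The metric on the determinant is the Gram determinant. -/
theorem detCore_inner (c : InnerProductSpace.Core A (A ⊗[F] V)) (x y : Fin (finrank F V) → V) :
    (detCore c).inner (1 ⊗ₜ exteriorPower.ιMulti F _ x) (1 ⊗ₜ exteriorPower.ιMulti F _ y) =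
      (gram c x y).det := by
  rw [gram_eq, Matrix.det_mul, Matrix.det_conjTranspose]
  change ∑ _i : Unit, starRingEnd A (detFunctional (orthoBasis c finrank_baseChange)
      (1 ⊗ₜ exteriorPower.ιMulti F _ x)) *
    detFunctional (orthoBasis c finrank_baseChange) (1 ⊗ₜ exteriorPower.ιMulti F _ y) = _
  simp [detFunctional_tmul, Basis.det_apply]

theorem inner_smul_smul {W : Type*} [AddCommGroup W] [Module F W]
    (c : InnerProductSpace.Core A (A ⊗[F] W)) (a b : F) (x y : W) :
    c.inner (1 ⊗ₜ (a • x)) (1 ⊗ₜ (b • y)) =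
      starRingEnd A (algebraMap F A a) * algebraMap F A b * c.inner (1 ⊗ₜ x) (1 ⊗ₜ y) := by
  rw [TensorProduct.tmul_smul, TensorProduct.tmul_smul, ← algebraMap_smul A a,
    ← algebraMap_smul A b, c.smul_left, ← c.conj_inner_symm _ (_ • _), c.smul_left, map_mul,
    c.conj_inner_symm]
  simp [mul_assoc]

/-- The metric on `A ⊗ W` induced by `c` for a subspace `W` of `V`. -/
abbrev restrictCore (c : InnerProductSpace.Core A (A ⊗[F] V)) (W : Submodule F V) :
    InnerProductSpace.Core A (A ⊗[F] W) :=
  pullbackCore c (W.subtype.baseChange A)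
    (Module.Flat.lTensor_preserves_injective_linearMap (M := A) W.subtype W.injective_subtype)

end BaseChange


section Lattice

variable {F V : Type*} [Field F] [NumberField F] [AddCommGroup V] [Module F V]
  [Module (𝓞 F) V] [IsScalarTower (𝓞 F) F V]

theorem exists_smul_mem (Γ : Submodule (𝓞 F) V) [hΓ : Submodule.IsLattice F Γ] (x : V) :
    ∃ d : 𝓞 F, d ≠ 0 ∧ d • x ∈ Γ := by
  have hx : x ∈ Submodule.span F (Γ : Set V) := by rw [hΓ.span_eq_top]; trivial
  induction hx using Submodule.span_induction with
  | mem x h => exact ⟨1, one_ne_zero, by simpa using h⟩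
  | zero => exact ⟨1, one_ne_zero, by simp⟩
  | add x y _ _ hx hy =>
    obtain ⟨d, hd, h⟩ := hx
    obtain ⟨d', hd', h'⟩ := hy
    refine ⟨d * d', mul_ne_zero hd hd', ?_⟩
    rw [smul_add]
    refine add_mem ?_ ?_
    · rw [mul_comm, mul_smul]; exact Γ.smul_mem _ h
    · rw [mul_smul]; exact Γ.smul_mem _ h'
  | smul a x _ hx =>
    obtain ⟨d, hd, h⟩ := hx
    obtain ⟨n, m, hm, rfl⟩ := IsFractionRing.div_surjective (A := 𝓞 F) a
    have hm0 : m ≠ 0 := nonZeroDivisors.ne_zero hm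
    have hm1 : algebraMap (𝓞 F) F m ≠ 0 := by simpa using hm0
    refine ⟨m * d, mul_ne_zero hm0 hd, ?_⟩
    have : (m * d) • (algebraMap (𝓞 F) F n / algebraMap (𝓞 F) F m) • x = n • d • x := by
      rw [← algebraMap_smul F (m * d), ← algebraMap_smul F n, ← algebraMap_smul F d, smul_smul,
        smul_smul, map_mul]
      congr 1
      field_simp
    rw [this]
    exact Γ.smul_mem _ h

theorem span_eq_top_of_smul_mem (Γ : Submodule (𝓞 F) V)
    (h : ∀ x, ∃ d : 𝓞 F, d ≠ 0 ∧ d • x ∈ Γ) : Submodule.span F (Γ : Set V) = ⊤ := by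
  rw [eq_top_iff]
  rintro x -
  obtain ⟨d, hd, hx⟩ := h x
  have hd1 : algebraMap (𝓞 F) F d ≠ 0 := by simpa using hd
  have : x = (algebraMap (𝓞 F) F d)⁻¹ • d • x := by
    rw [← algebraMap_smul F d, smul_smul, inv_mul_cancel₀ hd1, one_smul]
  rw [this]
  exact Submodule.smul_mem _ _ (Submodule.subset_span hx)

/-- The lattice `Γ ∩ W` of a subspace `W`. -/
def restrictLattice (Γ : Submodule (𝓞 F) V) (W : Submodule F V) : Submodule (𝓞 F) W :=
  Γ.comap (W.subtype.restrictScalars (𝓞 F))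

theorem restrictLattice_isLattice (Γ : Submodule (𝓞 F) V) [Submodule.IsLattice F Γ]
    (W : Submodule F V) : Submodule.IsLattice F (restrictLattice Γ W) where
  fg := by
    let f : restrictLattice Γ W →ₗ[𝓞 F] Γ :=
      (W.subtype.restrictScalars (𝓞 F)).restrict fun _ h => h
    have hf : Function.Injective f := fun x y h => by
      have := congrArg Subtype.val h
      exact Subtype.ext (Subtype.ext this)
    have := Module.Finite.of_injective f hf
    exact Module.Finite.iff_fg.1 this
  span_eq_top := span_eq_top_of_smul_mem _ fun x => exists_smul_mem Γ (x : V)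

/-- The dual lattice `{f | f(Γ) ⊆ 𝓞 F}`. -/
def dualLattice (Γ : Submodule (𝓞 F) V) : Submodule (𝓞 F) (Dual F V) where
  carrier := {f | ∀ x ∈ Γ, IsIntegral ℤ (f x)}
  add_mem' hf hg x hx := (hf x hx).add (hg x hx)
  zero_mem' x _ := isIntegral_zero
  smul_mem' a f hf x hx := by
    rw [LinearMap.smul_apply, Algebra.smul_def]
    exact (NumberField.RingOfIntegers.isIntegral_coe a).mul (hf x hx)

theorem dualLattice_isLattice (Γ : Submodule (𝓞 F) V) [hΓ : Submodule.IsLattice F Γ] :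
    Submodule.IsLattice F (dualLattice Γ) where
  fg := by
    obtain ⟨s, hs⟩ := hΓ.fg
    have hsΓ : ∀ x ∈ s, x ∈ Γ := fun x hx => hs ▸ Submodule.subset_span hx
    let f : dualLattice Γ →ₗ[𝓞 F] (s → 𝓞 F) :=
      { toFun := fun g x => ⟨g.1 x.1, g.2 x.1 (hsΓ x.1 x.2)⟩
        map_add' := fun g h => by ext x; rfl
        map_smul' := fun a g => by
          ext x
          change (a • g.1 x.1 : F) = a • g.1 x.1
          rfl }
    have hf : Function.Injective f := fun g h hgh => by
      have h1 : ∀ x ∈ s, g.1 x = h.1 x := fun x hx =>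
        congrArg (algebraMap (𝓞 F) F) (congrFun hgh ⟨x, hx⟩)
      have h2 : Submodule.span F (s : Set V) = ⊤ := by
        rw [← hΓ.span_eq_top, ← hs, Submodule.span_span_of_tower]
      exact Subtype.ext (LinearMap.ext_on h2 h1)
    have := Module.Finite.of_injective f hf
    exact Module.Finite.iff_fg.1 this
  span_eq_top := by
    obtain ⟨s, hs⟩ := hΓ.fg
    refine span_eq_top_of_smul_mem _ fun f => ?_
    classical
    obtain ⟨d, hd⟩ := IsLocalization.exist_integer_multiples_of_finset
      (nonZeroDivisors (𝓞 F)) (s.image f)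
    refine ⟨d, nonZeroDivisors.coe_ne_zero d, fun x hx => ?_⟩
    rw [← hs] at hx
    induction hx using Submodule.span_induction with
    | mem x h =>
      obtain ⟨a, ha⟩ := hd (f x) (Finset.mem_image_of_mem f h)
      rw [LinearMap.smul_apply, ← ha]
      exact NumberField.RingOfIntegers.isIntegral_coe a
    | zero => rw [map_zero]; exact isIntegral_zero
    | add x y _ _ hx hy => rw [map_add]; exact hx.add hy
    | smul a x _ hx =>
      rw [LinearMap.map_smul_of_tower, Algebra.smul_def]
      exact (NumberField.RingOfIntegers.isIntegral_coe a).mul hx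

variable [FiniteDimensional F V]

/-- The lattice of `det V`: the image of `⋀ʳ Γ` in `⋀ʳ V`. -/
def detLattice (Γ : Submodule (𝓞 F) V) : Submodule (𝓞 F) (⋀[F]^(finrank F V) V) :=
  Submodule.span (𝓞 F) (exteriorPower.ιMulti F (finrank F V) '' {x | ∀ i, x i ∈ Γ})

theorem detLattice_isLattice (Γ : Submodule (𝓞 F) V) [hΓ : Submodule.IsLattice F Γ] :
    Submodule.IsLattice F (detLattice Γ) where
  fg := by
    let f : Γ [⋀^Fin (finrank F V)]→ₗ[𝓞 F] (⋀[F]^(finrank F V) V) :=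
      { ((exteriorPower.ιMulti F (finrank F V)).toMultilinearMap.restrictScalars
          (𝓞 F)).compLinearMap (fun _ => Γ.subtype) with
        map_eq_zero_of_eq' := fun x i j h hij =>
          (exteriorPower.ιMulti F (finrank F V)).map_eq_zero_of_eq (fun i => (x i : V))
            (congrArg Subtype.val h) hij }
    let g := exteriorPower.alternatingMapLinearEquiv f
    have hg : LinearMap.range g = detLattice Γ := by
      rw [← Submodule.map_top, ← exteriorPower.ιMulti_span, Submodule.map_span, detLattice]
      congr 1
      ext w
      constructor
      · rintro ⟨_, ⟨x, rfl⟩, rfl⟩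
        exact ⟨fun i => x i, fun i => (x i).2,
          (exteriorPower.alternatingMapLinearEquiv_apply_ιMulti f x).symm⟩
      · rintro ⟨x, hx, rfl⟩
        exact ⟨_, ⟨fun i => ⟨x i, hx i⟩, rfl⟩,
          exteriorPower.alternatingMapLinearEquiv_apply_ιMulti f _⟩
    rw [← hg, ← Submodule.map_top]
    exact Submodule.FG.map g Module.Finite.fg_top
  span_eq_top := by
    rw [detLattice, Submodule.span_span_of_tower]
    have := exteriorPower.ιMulti_span_of_span F (finrank F V) V hΓ.span_eq_top
    rw [← this]
    congr 1
    ext w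
    simp [Set.range_subset_iff]

end Lattice


section Bundle

/-- A Hermitian metric on `V ⊗_σ ℂ`, where `ℂ` is regarded as an `F`-algebra through `σ`. -/
abbrev HermitianMetric {F : Type*} [Field F] (σ : F →+* ℂ) (V : Type*) [AddCommGroup V]
    [Module F V] : Type _ :=
  letI := σ.toAlgebra
  InnerProductSpace.Core ℂ (ℂ ⊗[F] V)

/-- The value `⟨x ⊗ 1, y ⊗ 1⟩_σ` for `x, y ∈ V`. -/
def HermitianMetric.pairing {F : Type*} [Field F] {σ : F →+* ℂ} {V : Type*} [AddCommGroup V]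
    [Module F V] (c : HermitianMetric σ V) (x y : V) : ℂ :=
  letI := σ.toAlgebra
  c.inner ((1 : ℂ) ⊗ₜ[F] x) ((1 : ℂ) ⊗ₜ[F] y)

section

variable {F V : Type*} [Field F] [AddCommGroup V] [Module F V] [FiniteDimensional F V]

theorem pairing_dual {σ : F →+* ℂ} (c : HermitianMetric σ V) (b : Basis (Fin (finrank F V)) F V)
    (f g : Dual F V) :
    HermitianMetric.pairing (σ := σ) (letI := σ.toAlgebra; dualCore c) f g =
      (fun i => σ (g (b i))) ⬝ᵥ ((Matrix.of fun i j => c.pairing (b i) (b j))⁻¹.mulVec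
        (star fun i => σ (f (b i)))) :=
  letI := σ.toAlgebra
  dualCore_inner_gram c b f g

theorem pairing_det {σ : F →+* ℂ} (c : HermitianMetric σ V) (x : Fin (finrank F V) → V)
    (a b : F) :
    HermitianMetric.pairing (σ := σ) (letI := σ.toAlgebra; detCore c)
      (a • exteriorPower.ιMulti F _ x) (b • exteriorPower.ιMulti F _ x) =
      starRingEnd ℂ (σ a) * σ b * (Matrix.of fun i j => c.pairing (x i) (x j)).det :=
  letI := σ.toAlgebra
  (inner_smul_smul (detCore c) a b _ _).trans
    (congrArg (starRingEnd ℂ (σ a) * σ b * ·) (detCore_inner c x x))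

theorem exists_eq_smul_wedge (w : ⋀[F]^(finrank F V) V) :
    ∃ a : F, w = a • exteriorPower.ιMulti F _ (finBasis F V) := by
  have h0 : exteriorPower.ιMulti F (finrank F V) (finBasis F V) ≠ 0 := by
    intro h
    have h1 := exteriorPower.alternatingMapLinearEquiv_apply_ιMulti (finBasis F V).det (finBasis F V)
    rw [h, map_zero, Basis.det_self] at h1
    exact zero_ne_one h1
  obtain ⟨a, ha⟩ := (finrank_eq_one_iff_of_nonzero' _ h0).1 finrank_top w
  exact ⟨a, ha.symm⟩

end

end Bundle

end Arakelov

open Arakelov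

/-- An Arakelov vector bundle over the number field `F` with underlying vector space `V`: an
`𝓞 F`-lattice in `V` and a Hermitian metric on `V ⊗_σ ℂ` for every embedding `σ : F → ℂ`, such
that the metrics are of real type. -/
structure ArakelovBundle (F V : Type*) [Field F] [NumberField F] [AddCommGroup V] [Module F V]
    [Module (𝓞 F) V] [IsScalarTower (𝓞 F) F V] where
  lattice : Submodule (𝓞 F) V
  isLattice : Submodule.IsLattice F lattice
  metric (σ : F →+* ℂ) : HermitianMetric σ V
  real_type (σ : F →+* ℂ) (x y : V) :
    starRingEnd ℂ ((metric σ).pairing x y) =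
      (metric (NumberField.ComplexEmbedding.conjugate σ)).pairing x y

/-- The group of Arakelov divisors, written as pairs (infinite part, finite part). -/
abbrev ArakelovDivisor (F : Type*) [Field F] [NumberField F] : Type _ :=
  (NumberField.InfinitePlace F → ℝ) × (IsDedekindDomain.HeightOneSpectrum (𝓞 F) →₀ ℤ)

namespace ArakelovDivisor

variable {F : Type*} [Field F] [NumberField F]

/-- The degree `∑_{v ∣ ∞} x_v + ∑_{v finite} x_v log N(v)`. -/
def degree (D : ArakelovDivisor F) : ℝ :=
  ∑ v, D.1 v + D.2.sum fun v m => (m : ℝ) * Real.log (Ideal.absNorm v.asIdeal)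

/-- The norm `N(D) = exp (deg D)`. -/
def norm (D : ArakelovDivisor F) : ℝ := Real.exp (degree D)

open Classical in
/-- The effectivity `e(D)`. -/
def effectivity (D : ArakelovDivisor F) : ℝ :=
  if 0 ≤ D.2 then
    ∏ v : NumberField.InfinitePlace F,
      Real.exp (-(v.mult * Real.pi * Real.exp (-(2 / v.mult) * D.1 v)))
  else 0

/-- The Haar measure on the group of Arakelov divisors: Lebesgue measure on the infinite part times
counting measure on the (discrete) finite part. -/
def haar (F : Type*) [Field F] [NumberField F] :
    @MeasureTheory.Measure (ArakelovDivisor F) (@Prod.instMeasurableSpace _ _ _ ⊤) :=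
  letI : MeasurableSpace (IsDedekindDomain.HeightOneSpectrum (𝓞 F) →₀ ℤ) := ⊤
  MeasureTheory.Measure.prod MeasureTheory.volume MeasureTheory.Measure.count

end ArakelovDivisor

/-- The completed Dedekind zeta function `ξ(s) = ∫ N(D)^(-s) e(D) dD` over the group of Arakelov
divisors (for `1 < re s`). -/
def completedDedekindXi (F : Type*) [Field F] [NumberField F] (s : ℂ) : ℂ :=
  letI : MeasurableSpace (IsDedekindDomain.HeightOneSpectrum (𝓞 F) →₀ ℤ) := ⊤
  ∫ D : ArakelovDivisor F, ((D.norm : ℂ) ^ (-s)) * (D.effectivity : ℂ) ∂(ArakelovDivisor.haar F)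

namespace ArakelovBundle

variable {F V : Type*} [Field F] [NumberField F] [AddCommGroup V] [Module F V]
  [Module (𝓞 F) V] [IsScalarTower (𝓞 F) F V]

/-- The norm `‖x‖_v` of a rational section at an infinite place. -/
def infNorm (E : ArakelovBundle F V) (v : NumberField.InfinitePlace F) (x : V) : ℝ :=
  Real.sqrt ((E.metric v.embedding).pairing x x).re

/-- The fractional ideal `{a ∈ F | a • x ∈ Γ(V)}` of a nonzero rational section `x`. -/
def sectionIdeal (E : ArakelovBundle F V) (x : V) (hx : x ≠ 0) :
    FractionalIdeal (nonZeroDivisors (𝓞 F)) F :=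
  ⟨E.lattice.comap ((LinearMap.toSpanSingleton F V x).restrictScalars (𝓞 F)), by
    apply FractionalIdeal.isFractional_of_fg
    let f := ((LinearMap.toSpanSingleton F V x).restrictScalars (𝓞 F)).restrict
      (p := E.lattice.comap ((LinearMap.toSpanSingleton F V x).restrictScalars (𝓞 F)))
      (q := E.lattice) fun _ h => h
    have hf : Function.Injective f := fun a b h =>
      Subtype.ext (smul_left_injective F hx (congrArg Subtype.val h))
    have := E.isLattice
    have := Module.Finite.of_injective f hf
    exact Module.Finite.iff_fg.1 this⟩

/-- The order of a nonzero rational section `x` at a finite place `v`: the largest `m` such that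
`x ∈ 𝔭_v ^ m Γ(V)` locally at `v`. As `{a | a • x ∈ Γ(V)}` is locally `𝔭_v ^ (-m)`, this is
minus the exponent of `v` in that fractional ideal. -/
def ord (E : ArakelovBundle F V) (x : V) (hx : x ≠ 0)
    (v : IsDedekindDomain.HeightOneSpectrum (𝓞 F)) : ℤ :=
  -FractionalIdeal.count F v (E.sectionIdeal x hx)

theorem finite_support_ord (E : ArakelovBundle F V) (x : V) (hx : x ≠ 0) :
    (Function.support (E.ord x hx)).Finite := by
  have h := FractionalIdeal.finite_factors (E.sectionIdeal x hx)
  rw [Filter.eventually_cofinite] at h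
  exact h.subset fun v hv => by simpa [ord] using hv

/-- The divisor of zeros and poles of a nonzero rational section. -/
def div (E : ArakelovBundle F V) (x : V) (hx : x ≠ 0) : ArakelovDivisor F :=
  (fun v => -(v.mult * Real.log (E.infNorm v x)),
    Finsupp.ofSupportFinite (E.ord x hx) (E.finite_support_ord x hx))

open Classical in
/-- The norm `N(L) = exp (deg (div x))` of an Arakelov line bundle `L`, where `x` is any nonzero
rational section; by the product formula the choice does not matter. -/
def lineNorm (L : ArakelovBundle F V) : ℝ :=
  if h : ∃ x : V, x ≠ 0 then (L.div h.choose h.choose_spec).norm else 1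

/-- The Arakelov subbundle with underlying vector space `W ⊆ V`. -/
def restrict (E : ArakelovBundle F V) (W : Submodule F V) : ArakelovBundle F W where
  lattice := restrictLattice E.lattice W
  isLattice := by
    have := E.isLattice
    exact restrictLattice_isLattice E.lattice W
  metric σ :=
    letI := σ.toAlgebra
    restrictCore (E.metric σ) W
  real_type σ x y := E.real_type σ x y

variable [FiniteDimensional F V]

/-- The dual Arakelov bundle. -/
def dual (E : ArakelovBundle F V) : ArakelovBundle F (Dual F V) where
  lattice := dualLattice E.lattice
  isLattice := by
    have := E.isLattice
    exact dualLattice_isLattice E.lattice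
  metric σ :=
    letI := σ.toAlgebra
    dualCore (E.metric σ)
  real_type σ f g := by
    rw [pairing_dual _ (finBasis F V), pairing_dual _ (finBasis F V)]
    have hG : (Matrix.of fun i j => (E.metric (NumberField.ComplexEmbedding.conjugate σ)).pairing
        (finBasis F V i) (finBasis F V j)) = (Matrix.of fun i j =>
          (E.metric σ).pairing (finBasis F V i) (finBasis F V j)).map (starRingEnd ℂ) := by
      ext i j
      exact (E.real_type σ _ _).symm
    have hinv : ∀ M : Matrix (Fin (finrank F V)) (Fin (finrank F V)) ℂ,
        (M.map (starRingEnd ℂ))⁻¹ = M⁻¹.map (starRingEnd ℂ) := fun M => by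
      have h := congrArg Matrix.transpose (Matrix.conjTranspose_nonsing_inv M)
      rw [Matrix.transpose_nonsing_inv] at h
      exact h.symm
    rw [hG, hinv]
    simp [dotProduct, Matrix.mulVec, NumberField.ComplexEmbedding.conjugate]

/-- The determinant line bundle. -/
def det (E : ArakelovBundle F V) : ArakelovBundle F (⋀[F]^(finrank F V) V) where
  lattice := detLattice E.lattice
  isLattice := by
    have := E.isLattice
    exact detLattice_isLattice E.lattice
  metric σ :=
    letI := σ.toAlgebra
    detCore (E.metric σ)
  real_type σ x y := by
    obtain ⟨a, rfl⟩ := exists_eq_smul_wedge x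
    obtain ⟨b, rfl⟩ := exists_eq_smul_wedge y
    rw [pairing_det, pairing_det, map_mul, RingHom.map_det]
    congr 1
    · simp
    · congr 1
      ext i j
      exact E.real_type σ _ _

/-- The norm `N(V) = N(det V)` of an Arakelov vector bundle. -/
def norm (E : ArakelovBundle F V) : ℝ := E.det.lineNorm

/-- The height `H(P) = N(P^* O(1))` of a line `P` in `V`, where `P^* O(1)` is dual to the
line subbundle `P^* O(-1)` of `V` defined by `P`. -/
def height (E : ArakelovBundle F V) (P : ℙ F V) : ℝ :=
  (E.restrict P.submodule).dual.lineNorm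

/-- The height zeta function `∑_P H(P)^(-s)` of `ℙ(V)` as a series. -/
def heightZeta (E : ArakelovBundle F V) (s : ℂ) : ℂ :=
  ∑' P : ℙ F V, (E.height P : ℂ) ^ (-s)

end ArakelovBundle

/-- `g` is a meromorphic function on `ℂ` (normalized to take the value `0` at its poles and its
continuous value elsewhere) which agrees with `f` on the half-plane `c < re s`. -/
def IsMeromorphicContinuation (f : ℂ → ℂ) (c : ℝ) (g : ℂ → ℂ) : Prop :=
  MeromorphicNFOn g Set.univ ∧ Set.EqOn g f {s : ℂ | c < s.re}

end

/-! The proof is Riemann's theta function method on the group of Arakelov divisor classes. A divisor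
`D = (t, c)` twists `V` into a bundle `V(D)` with theta series `θ(V(D)) = ∑ exp (-π ∑_v n_v e^(-2
t_v / n_v) ‖x‖_v²)`, the sum running over the `x` with `c x ⊆ Γ(V)`. Poisson summation, with the
trace form identifying the dual lattice, gives a Riemann-Roch formula (`theta_eq_theta_dual`):
`θ(V(D)) = N(V) |Δ|^(-r/2) N(D)^r θ(V^∨(K - D))`, where `K` is the divisor of the different.

Theta is invariant under principal divisors, so it can be integrated over the classes of degree `T`,
which form `h` copies of a torus of volume `R`. The result `thetaTotal` tends to `Rh` faster than
any power of `e^T` as `T → -∞`, because only the zero vector survives. In the variable `X =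
|Δ|^(1/2) e^(-T)` Riemann-Roch reads `f(1/X) = N(V) X^r g(X)`, with `g` belonging to `V^∨`. The
general theory of Mellin transforms of such pairs (`thetaPair`) then yields a function `Λ` with at
most simple poles, at `0` and `r`, with residue `N(V) R h` at `r`, and with `Λ(r - s) = N(V)
Λ^∨(s)`.

The link with heights is an unfolding (`lintegral_thetaTotal`). Nonzero vectors are grouped by the
line `P` they span. For a fixed line, the sum over `Fˣ`, the sum over ideal classes and the integral
over a fundamental domain for the units combine into `w` times an integral over all Arakelov
divisors, and translating by the divisor of a vector of `P` shifts the degree by `log H(P)`.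
Integrating against `e^(-sT)` gives `Λ(s) = w |Δ|^(s/2) ξ(s) Z(ℙ(V), s)` for `Re s > r`
(`hasSum_height_mul_xi`). The unfolding takes place in `[0, ∞]`, so convergence is a consequence of
the convergence of the Mellin transform.

In rank one there is a single line, and the same identity continues `ξ` and shows that its integral
converges for `1 < Re s`. There `ξ` has no zeros (`completedDedekindXi_ne_zero`), by a sieve
argument for the Dirichlet series (`tsum_ne_zero_of_multiplicative`) and the nonvanishing of Gamma.
Dividing by `w |Δ|^(s/2) ξ(s)` gives all the assertions. -/

noncomputable section

set_option linter.unusedSectionVars false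

namespace Arakelov

/-! ### Poisson summation for integer vectors -/

section Poisson

open MeasureTheory Complex UnitAddTorus

variable {ι : Type*} [Fintype ι]

/-- The integer vector `z` as a real vector. -/
def intVec (z : ι → ℤ) : ι → ℝ := fun i => z i

theorem isOpenQuotientMap_torus :
    IsOpenQuotientMap (fun (x : ι → ℝ) (i : ι) => (x i : UnitAddCircle)) :=
  IsOpenQuotientMap.piMap fun _ => QuotientAddGroup.isOpenQuotientMap_mk

theorem iUnion_cube_eq_univ :
    ⋃ z : ι → ℤ, {x : ι → ℝ | ∀ i, x i ∈ Set.Ioc (z i : ℝ) (z i + 1)} = Set.univ := by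
  refine Set.eq_univ_of_forall fun x => Set.mem_iUnion.2 ⟨fun i => ⌈x i⌉ - 1, fun i => ?_⟩
  have h1 := Int.ceil_lt_add_one (x i)
  have h2 := Int.le_ceil (x i)
  push_cast
  constructor <;> linarith

theorem pairwise_disjoint_cube : Pairwise (Function.onFun Disjoint
    fun z : ι → ℤ => {x : ι → ℝ | ∀ i, x i ∈ Set.Ioc (z i : ℝ) (z i + 1)}) := by
  intro z z' h
  refine Set.disjoint_left.2 fun x hx hx' => h (funext fun i => ?_)
  obtain ⟨h1, h2⟩ := hx i
  obtain ⟨h3, h4⟩ := hx' i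
  have h5 : z i < z' i + 1 := by exact_mod_cast h1.trans_le h4
  have h6 : z' i < z i + 1 := by exact_mod_cast h3.trans_le h2
  omega

theorem measurableSet_cube (z : ι → ℤ) :
    MeasurableSet {x : ι → ℝ | ∀ i, x i ∈ Set.Ioc (z i : ℝ) (z i + 1)} := by
  simp only [Set.ofPred_forall]
  exact MeasurableSet.iInter fun i => measurable_pi_apply i measurableSet_Ioc

/-- Unfolding an integral over `ℝ ^ ι` along the integer lattice. -/
theorem hasSum_setIntegral_cube {E : Type*} [NormedAddCommGroup E] [NormedSpace ℝ E]
    {f : (ι → ℝ) → E} (hf : Integrable f) :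
    HasSum (fun z : ι → ℤ => ∫ x in {x : ι → ℝ | ∀ i, x i ∈ Set.Ioc (0 : ℝ) (0 + 1)},
      f (x + intVec z)) (∫ x, f x) := by
  have h := hasSum_integral_iUnion (f := f) measurableSet_cube pairwise_disjoint_cube
    hf.integrableOn
  rw [iUnion_cube_eq_univ, setIntegral_univ] at h
  refine h.congr_fun fun z => ?_
  rw [← (measurePreserving_add_right volume (intVec z)).setIntegral_preimage_emb
    (MeasurableEquiv.addRight (intVec z)).measurableEmbedding f
    {x : ι → ℝ | ∀ i, x i ∈ Set.Ioc (z i : ℝ) (z i + 1)}]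
  congr 2
  ext x
  simp [intVec, add_comm (z _ : ℝ)]

theorem summable_integral_norm_cube {f : (ι → ℝ) → ℂ} (hf : Integrable f) :
    Summable fun z : ι → ℤ => ∫ x in {x : ι → ℝ | ∀ i, x i ∈ Set.Ioc (0 : ℝ) (0 + 1)},
      ‖f (x + intVec z)‖ :=
  (hasSum_setIntegral_cube hf.norm).summable

theorem mFourier_neg_coe (n : ι → ℤ) (x : ι → ℝ) :
    mFourier (-n) (fun i => (x i : UnitAddCircle)) =
      cexp (-2 * Real.pi * I * ∑ i, n i * x i) := by
  simp only [mFourier, ContinuousMap.coe_mk, fourier_coe_apply, ← Complex.exp_sum]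
  congr 1
  push_cast
  rw [Finset.mul_sum]
  refine Finset.sum_congr rfl fun i _ => ?_
  push_cast [Pi.neg_apply]
  ring

/-- Periodicity absorbs `e` into each translate of `g`, after which the cubes tile the whole space.
With `e` a character this computes the Fourier coefficients of the periodization. -/
theorem integral_mul_periodization {e g : (ι → ℝ) → ℂ} (hg : Integrable g) (he : Continuous e)
    (he1 : ∀ x, ‖e x‖ ≤ 1) (hper : ∀ (x : ι → ℝ) (z : ι → ℤ), e (x + intVec z) = e x) :
    ∫ x in {x : ι → ℝ | ∀ i, x i ∈ Set.Ioc (0 : ℝ) (0 + 1)},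
      e x * ∑' z : ι → ℤ, g (x + intVec z) = ∫ x : ι → ℝ, e x * g x := by
  obtain ⟨k, hk⟩ : ∃ k : (ι → ℝ) → ℂ, k = fun x => e x * g x := ⟨_, rfl⟩
  have hint : Integrable k := hk ▸ hg.bdd_mul (c := 1) he.aestronglyMeasurable (Filter.Eventually.of_forall he1)
  have h1 := hasSum_setIntegral_cube hint
  have h2 := hasSum_integral_of_summable_integral_norm
    (μ := volume.restrict {x : ι → ℝ | ∀ i, x i ∈ Set.Ioc (0 : ℝ) (0 + 1)})
    (F := fun (z : ι → ℤ) x => k (x + intVec z))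
    (fun z => (hint.comp_add_right (intVec z)).integrableOn) (summable_integral_norm_cube hint)
  refine Eq.trans (integral_congr_ae (Filter.Eventually.of_forall fun x => ?_)) ((h2.unique h1).trans (by rw [hk]))
  simp only [hk, hper]
  exact tsum_mul_left.symm

theorem exp_sum_add_intVec (n : ι → ℤ) (x : ι → ℝ) (z : ι → ℤ) :
    cexp (-2 * Real.pi * I * ∑ i, n i * (x + intVec z) i) =
      cexp (-2 * Real.pi * I * ∑ i, n i * x i) := by
  rw [Complex.exp_eq_exp_iff_exists_int]
  refine ⟨-∑ i, n i * z i, ?_⟩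
  simp only [intVec, Pi.add_apply]
  push_cast
  simp only [mul_add, Finset.sum_add_distrib]
  ring

theorem norm_exp_sum_le (n : ι → ℤ) (x : ι → ℝ) :
    ‖cexp (-2 * Real.pi * I * ∑ i, n i * x i)‖ ≤ 1 := by
  rw [Complex.norm_exp]
  simp

/-- Poisson summation for the lattice `ℤ ^ ι`. -/
theorem tsum_eq_tsum_integral (g : C(ι → ℝ, ℂ)) (hg : Integrable g)
    (hs : ∀ K : TopologicalSpace.Compacts (ι → ℝ), Summable fun z : ι → ℤ =>
      ‖(g.comp (ContinuousMap.addRight (intVec z))).restrict K‖)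
    (hf : Summable fun n : ι → ℤ => ∫ x : ι → ℝ, cexp (-2 * Real.pi * I * ∑ i, n i * x i) * g x) :
    ∑' z : ι → ℤ, g (intVec z) =
      ∑' n : ι → ℤ, ∫ x : ι → ℝ, cexp (-2 * Real.pi * I * ∑ i, n i * x i) * g x := by
  have hsum := ContinuousMap.summable_of_locally_summable_norm hs
  set G : C(ι → ℝ, ℂ) := ∑' z : ι → ℤ, g.comp (ContinuousMap.addRight (intVec z)) with hG
  have hGx : ∀ x, G x = ∑' z : ι → ℤ, g (x + intVec z) := fun x => by
    rw [hG, ← ContinuousMap.tsum_apply hsum]; rfl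
  let q : C(ι → ℝ, UnitAddTorus ι) :=
    ⟨fun x i => (x i : UnitAddCircle), isOpenQuotientMap_torus.continuous⟩
  -- The periodization is invariant under integer translations, so it descends to a continuous
  -- function on the torus. Its Fourier series evaluated at `0` is the right-hand side.
  have hfac : Function.FactorsThrough G q := by
    intro x y hxy
    have h : ∀ i, ∃ m : ℤ, y i = x i + m := fun i => by
      obtain ⟨m, hm⟩ := QuotientAddGroup.eq.1 (congrFun hxy i)
      refine ⟨m, ?_⟩
      simp only [zsmul_eq_mul, mul_one] at hm
      linarith
    choose m hm using h
    have hy : y = x + intVec m := funext hm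
    rw [hGx, hGx, hy, ← (Equiv.addLeft m).tsum_eq]
    refine tsum_congr fun z => ?_
    congr 1
    ext i
    simp [intVec, add_assoc]
  let f : C(UnitAddTorus ι, ℂ) := isOpenQuotientMap_torus.isQuotientMap.lift (f := q) G hfac
  have hfq : ∀ x : ι → ℝ, f (fun i => (x i : UnitAddCircle)) = G x := fun x =>
    congrArg (fun h : C(ι → ℝ, ℂ) => h x)
      (isOpenQuotientMap_torus.isQuotientMap.lift_comp (f := q) G hfac)
  have hcoeff : ∀ n : ι → ℤ, mFourierCoeff f n =
      ∫ x : ι → ℝ, cexp (-2 * Real.pi * I * ∑ i, n i * x i) * g x := fun n => by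
    rw [← integral_mul_periodization hg (by fun_prop) (norm_exp_sum_le n) (exp_sum_add_intVec n),
      mFourierCoeff_eq_integral _ _ 0]
    simp only [Pi.zero_apply, hfq, mFourier_neg_coe, hGx, smul_eq_mul]
  have h1 := hasSum_mFourier_series_apply_of_summable (f := f) ((funext hcoeff : mFourierCoeff f = _) ▸ hf)
    (fun i => ((0 : ℝ) : UnitAddCircle))
  have h2 := hfq 0
  simp only [Pi.zero_apply] at h2
  rw [h2, hGx] at h1
  simp only [zero_add] at h1
  rw [← h1.tsum_eq]
  refine tsum_congr fun n => ?_
  rw [hcoeff, mFourier]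
  simp

end Poisson

/-! ### Theta series of positive definite quadratic forms -/

section Gaussian

open MeasureTheory Complex Matrix

variable {ι : Type*} [Fintype ι] [DecidableEq ι]

theorem sum_sq_mulVec_le (N : Matrix ι ι ℝ) (y : ι → ℝ) :
    ∑ i, (N *ᵥ y) i ^ 2 ≤ (∑ i, ∑ j, N i j ^ 2) * ∑ j, y j ^ 2 := by
  rw [Finset.sum_mul]
  exact Finset.sum_le_sum fun i _ => Finset.sum_mul_sq_le_sq_mul_sq _ _ _

theorem exists_eq_transpose_mul_self {A : Matrix ι ι ℝ} (hA : A.PosDef) :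
    ∃ B : Matrix ι ι ℝ, A = Bᵀ * B ∧ B.det ≠ 0 := by
  open scoped MatrixOrder in
  obtain ⟨B, hB⟩ := CStarAlgebra.nonneg_iff_eq_star_mul_self.mp hA.posSemidef.nonneg
  refine ⟨B, hB, fun h => ?_⟩
  have := (A.isUnit_iff_isUnit_det).1 hA.isUnit
  rw [hB, det_mul, h, mul_zero] at this
  exact not_isUnit_zero this

theorem dotProduct_transpose_mul_self (B : Matrix ι ι ℝ) (x : ι → ℝ) :
    x ⬝ᵥ (Bᵀ * B) *ᵥ x = ∑ i, (B *ᵥ x) i ^ 2 := by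
  rw [← mulVec_mulVec, dotProduct_mulVec, vecMul_transpose, dotProduct]
  exact Finset.sum_congr rfl fun i _ => (sq _).symm

/-- With `A = Bᵀ * B` one has `|x|² = |B⁻¹ (B x)|² ≤ C |B x|²`, where `C` is the sum of the squared
entries of `B⁻¹`. The added `1` keeps the constant invertible when `C = 0`. -/
theorem exists_lower_bound {A : Matrix ι ι ℝ} (hA : A.PosDef) :
    ∃ δ > 0, ∀ x : ι → ℝ, δ * ∑ i, x i ^ 2 ≤ x ⬝ᵥ A *ᵥ x := by
  obtain ⟨B, rfl, hB⟩ := exists_eq_transpose_mul_self hA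
  have hC : 0 ≤ ∑ i, ∑ j, B⁻¹ i j ^ 2 := by positivity
  refine ⟨(∑ i, ∑ j, B⁻¹ i j ^ 2 + 1)⁻¹, by positivity, fun x => ?_⟩
  rw [dotProduct_transpose_mul_self, inv_mul_le_iff₀ (by positivity)]
  have h := sum_sq_mulVec_le B⁻¹ (B *ᵥ x)
  rw [mulVec_mulVec, nonsing_inv_mul _ (isUnit_iff_ne_zero.2 hB), one_mulVec] at h
  have h2 : 0 ≤ ∑ i, (B *ᵥ x) i ^ 2 := by positivity
  linarith

theorem integrable_exp_neg_sum_sq {δ : ℝ} (hδ : 0 < δ) :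
    Integrable fun x : ι → ℝ => Real.exp (-δ * ∑ i, x i ^ 2) := by
  have h := (GaussianFourier.integrable_cexp_neg_mul_sum_add (ι := ι) (b := (δ : ℂ))
    (by simpa using hδ) 0).re
  refine h.congr (Filter.Eventually.of_forall fun x => ?_)
  simp only [Pi.zero_apply, zero_mul, Finset.sum_const_zero, add_zero]
  rw [show (-(δ : ℂ) * ∑ i, (x i : ℂ) ^ 2) = ((-δ * ∑ i, x i ^ 2 : ℝ) : ℂ) by push_cast; rfl]
  exact Complex.exp_ofReal_re _

/-- Comparison with an integral: on the unit cube at `z` one has `|x|² ≤ 2 card ι + 2 |z|²`, so the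
Gaussian with half the exponent dominates the term at `z` up to the factor `exp (δ * card ι)`, and
the cubes tile the space. -/
theorem summable_exp_neg_sum_sq {δ : ℝ} (hδ : 0 < δ) :
    Summable fun z : ι → ℤ => Real.exp (-δ * ∑ i, intVec z i ^ 2) := by
  have h := ((hasSum_setIntegral_cube (integrable_exp_neg_sum_sq (ι := ι) (half_pos hδ))).summable
    ).mul_left (Real.exp (δ * Fintype.card ι))
  refine h.of_nonneg_of_le (fun z => (Real.exp_pos _).le) fun z => ?_
  rw [← inv_mul_le_iff₀ (Real.exp_pos _), ← Real.exp_neg, ← Real.exp_add]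
  set s : Set (ι → ℝ) := {x | ∀ i, x i ∈ Set.Ioc (0 : ℝ) (0 + 1)} with hs
  have hs' : s = Set.univ.pi fun _ => Set.Ioc (0 : ℝ) (0 + 1) := by ext x; simp [hs]
  have hms : MeasurableSet s := hs' ▸ MeasurableSet.univ_pi fun _ => measurableSet_Ioc
  have hvol : volume s = 1 := by
    rw [hs', volume_pi_pi]; simp
  have hreal : (volume : Measure (ι → ℝ)).real s = 1 := by simp [Measure.real, hvol]
  have h1 : ∫ _ in s, Real.exp (-(δ * Fintype.card ι) + -δ * ∑ i, intVec z i ^ 2) =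
      Real.exp (-(δ * Fintype.card ι) + -δ * ∑ i, intVec z i ^ 2) := by
    rw [setIntegral_const, hreal, one_smul]
  rw [← h1]
  refine setIntegral_mono_on (integrableOn_const (by simp [hvol]))
    ((integrable_exp_neg_sum_sq (half_pos hδ)).comp_add_right (intVec z)).integrableOn hms
    fun x hx => ?_
  rw [Real.exp_le_exp]
  have h2 : ∑ i, (x + intVec z) i ^ 2 ≤ ∑ i : ι, (2 + 2 * intVec z i ^ 2) := by
    refine Finset.sum_le_sum fun i _ => ?_
    obtain ⟨h3, h4⟩ := hx i
    simp only [Pi.add_apply]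
    nlinarith [sq_nonneg (x i - intVec z i)]
  simp only [Finset.sum_add_distrib, ← Finset.mul_sum, Finset.sum_const, Finset.card_univ,
    nsmul_eq_mul] at h2
  nlinarith

theorem summable_exp_neg_quadratic {A : Matrix ι ι ℝ} (hA : A.PosDef) :
    Summable fun z : ι → ℤ => Real.exp (-Real.pi * (intVec z ⬝ᵥ A *ᵥ intVec z)) := by
  obtain ⟨δ, hδ, h⟩ := exists_lower_bound hA
  refine (summable_exp_neg_sum_sq (ι := ι) (mul_pos Real.pi_pos hδ)).of_nonneg_of_le
    (fun z => (Real.exp_pos _).le) fun z => Real.exp_le_exp.2 ?_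
  have := mul_le_mul_of_nonneg_left (h (intVec z)) Real.pi_pos.le
  linarith

/-- The Fourier transform of the Gaussian of a positive definite quadratic form. -/
theorem integral_exp_quadratic {B : Matrix ι ι ℝ} (hB : B.det ≠ 0) (n : ι → ℤ) :
    ∫ x : ι → ℝ, cexp (-2 * Real.pi * I * ∑ i, n i * x i) *
      (Real.exp (-Real.pi * (x ⬝ᵥ (Bᵀ * B) *ᵥ x)) : ℝ) =
    ((|B.det|⁻¹ * Real.exp (-Real.pi * (intVec n ⬝ᵥ (Bᵀ * B)⁻¹ *ᵥ intVec n)) : ℝ) : ℂ) := by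
  -- The frequency after the substitution `y = B x`: `⟨n, x⟩ = ⟨m, B x⟩`. The Jacobian supplies
  -- `|det B|⁻¹`.
  set m : ι → ℝ := (B⁻¹)ᵀ *ᵥ intVec n with hm
  have hu : IsUnit B.det := isUnit_iff_ne_zero.2 hB
  have hkey : ∀ x : ι → ℝ, ∑ i, (n i : ℝ) * x i = ∑ i, m i * (B *ᵥ x) i := fun x => by
    change intVec n ⬝ᵥ x = m ⬝ᵥ (B *ᵥ x)
    rw [hm, mulVec_transpose, dotProduct_mulVec, vecMul_vecMul, nonsing_inv_mul _ hu, vecMul_one]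
  have hF : ∀ x : ι → ℝ, cexp (-2 * Real.pi * I * ∑ i, n i * x i) *
      (Real.exp (-Real.pi * (x ⬝ᵥ (Bᵀ * B) *ᵥ x)) : ℝ) =
      (fun y : ι → ℝ => cexp (-(Real.pi : ℂ) * ∑ i, (y i : ℂ) ^ 2 +
        ∑ i, (-2 * Real.pi * I * m i) * y i)) (toLin' B x) := fun x => by
    rw [dotProduct_transpose_mul_self, hkey, Complex.ofReal_exp, ← Complex.exp_add]
    simp only [toLin'_apply]
    congr 1
    push_cast
    simp only [Finset.mul_sum]
    rw [add_comm]
    congr 1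
    exact Finset.sum_congr rfl fun i _ => by ring
  refine (integral_congr_ae (Filter.Eventually.of_forall hF)).trans ?_
  have hmap := Real.map_matrix_volume_pi_eq_smul_volume_pi hB
  have hemb : MeasurableEmbedding (toLin' B) := by
    have hinj : Function.Injective (toLin' B) := by
      rw [Matrix.toLin'_apply', Matrix.coe_mulVecLin]
      exact mulVec_injective_iff_isUnit.2 ((isUnit_iff_isUnit_det B).2 hu)
    exact ((toLin' B).isClosedEmbedding_of_injective (LinearMap.ker_eq_bot.2 hinj)).measurableEmbedding
  refine (hemb.integral_map (μ := volume) (fun y : ι → ℝ => cexp (-(Real.pi : ℂ) *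
    ∑ i, (y i : ℂ) ^ 2 + ∑ i, (-2 * Real.pi * I * m i) * y i))).symm.trans ?_
  rw [hmap, integral_smul_measure,
    GaussianFourier.integral_cexp_neg_mul_sum_add (by simpa using Real.pi_pos)]
  rw [ENNReal.toReal_ofReal (abs_nonneg _), div_self (by exact_mod_cast Real.pi_ne_zero), one_cpow,
    one_mul, abs_inv, Complex.real_smul]
  push_cast
  congr 1
  congr 1
  have h3 : intVec n ⬝ᵥ (Bᵀ * B)⁻¹ *ᵥ intVec n = ∑ i, m i ^ 2 := by
    rw [Matrix.mul_inv_rev, ← mulVec_mulVec, dotProduct_mulVec, ← transpose_nonsing_inv,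
      ← mulVec_transpose, ← hm, dotProduct]
    exact Finset.sum_congr rfl fun i _ => (sq _).symm
  rw [h3]
  push_cast
  rw [Finset.mul_sum, Finset.sum_div]
  refine Finset.sum_congr rfl fun i _ => ?_
  have : (Real.pi : ℂ) ≠ 0 := by exact_mod_cast Real.pi_ne_zero
  field_simp
  rw [Complex.I_sq]
  ring

/-- Poisson summation for the theta series of a positive definite quadratic form. -/
theorem tsum_exp_neg_quadratic {A : Matrix ι ι ℝ} (hA : A.PosDef) :
    ∑' z : ι → ℤ, Real.exp (-Real.pi * (intVec z ⬝ᵥ A *ᵥ intVec z)) =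
      (√A.det)⁻¹ * ∑' z : ι → ℤ, Real.exp (-Real.pi * (intVec z ⬝ᵥ A⁻¹ *ᵥ intVec z)) := by
  obtain ⟨δ, hδ, hlow⟩ := exists_lower_bound hA
  have hsum' := summable_exp_neg_quadratic hA.inv
  obtain ⟨B, rfl, hB⟩ := exists_eq_transpose_mul_self hA
  have hdet : √(Bᵀ * B).det = |B.det| := by rw [det_mul, det_transpose, Real.sqrt_mul_self_eq_abs]
  let g : C(ι → ℝ, ℂ) := ⟨fun x => (Real.exp (-Real.pi * (x ⬝ᵥ (Bᵀ * B) *ᵥ x)) : ℝ), by fun_prop⟩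
  have hg0 : ∀ x, g x = (Real.exp (-Real.pi * (x ⬝ᵥ (Bᵀ * B) *ᵥ x)) : ℝ) := fun _ => rfl
  have hgn : ∀ x, ‖g x‖ ≤ Real.exp (-(Real.pi * δ) * ∑ i, x i ^ 2) := fun x => by
    rw [hg0, Complex.norm_real, Real.norm_of_nonneg (Real.exp_pos _).le, Real.exp_le_exp]
    have := mul_le_mul_of_nonneg_left (hlow x) Real.pi_pos.le
    linarith
  have hδ' := mul_pos Real.pi_pos hδ
  have hgi : Integrable g := (integrable_exp_neg_sum_sq hδ').mono'
    g.continuous.aestronglyMeasurable (Filter.Eventually.of_forall hgn)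
  have h := tsum_eq_tsum_integral g hgi ?_ ?_
  · rw [hdet, ← tsum_mul_left]
    have h1 : ∀ n : ι → ℤ, ∫ x : ι → ℝ, cexp (-2 * Real.pi * I * ∑ i, n i * x i) * g x =
      ((|B.det|⁻¹ * Real.exp (-Real.pi * (intVec n ⬝ᵥ (Bᵀ * B)⁻¹ *ᵥ intVec n)) : ℝ) : ℂ) :=
      fun n => integral_exp_quadratic hB n
    rw [tsum_congr h1, tsum_congr fun z => hg0 _, ← Complex.ofReal_tsum, ← Complex.ofReal_tsum] at h
    exact_mod_cast h
  · intro K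
    obtain ⟨R, hR⟩ := K.isCompact.exists_bound_of_continuousOn
      (f := fun x : ι → ℝ => ∑ i, x i ^ 2) (by fun_prop)
    refine ((summable_exp_neg_sum_sq (ι := ι) (half_pos hδ')).mul_left
      (Real.exp (Real.pi * δ * R))).of_nonneg_of_le (fun _ => norm_nonneg _) fun z => ?_
    rw [ContinuousMap.norm_le _ (by positivity)]
    rintro ⟨x, hx⟩
    refine (hgn (x + intVec z)).trans ?_
    rw [← Real.exp_add, Real.exp_le_exp]
    have h1 := (le_abs_self _).trans (hR x hx)
    -- Since `z²/2 ≤ (x + z)² + x²`, on a compact set the translate by `z` is bounded by a constant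
    -- times a Gaussian in `z` with half the exponent.
    have h2 : ∑ i, intVec z i ^ 2 / 2 ≤ ∑ i, ((x + intVec z) i ^ 2 + x i ^ 2) :=
      Finset.sum_le_sum fun i _ => by
        simp only [Pi.add_apply]
        nlinarith [sq_nonneg (2 * x i + intVec z i)]
    rw [← Finset.sum_div, Finset.sum_add_distrib] at h2
    have h3 := mul_le_mul_of_nonneg_left (h2.trans (add_le_add_right h1 _)) hδ'.le
    linarith
  · refine Summable.congr (f := fun n : ι → ℤ => ((|B.det|⁻¹ * Real.exp (-Real.pi *
      (intVec n ⬝ᵥ (Bᵀ * B)⁻¹ *ᵥ intVec n)) : ℝ) : ℂ)) ?_ fun n =>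
        (integral_exp_quadratic hB n).symm
    exact (Complex.summable_ofReal.2 (hsum'.mul_left _))

end Gaussian

/-! ### Fractional ideals as finite divisors -/

section Ideals

open IsDedekindDomain NumberField

variable {F : Type*} [Field F] [NumberField F]

/-- The group of nonzero fractional ideals of `F`. -/
abbrev IdealGroup (F : Type*) [Field F] [NumberField F] : Type _ :=
  (FractionalIdeal (nonZeroDivisors (𝓞 F)) F)ˣ

/-- The absolute norm of a fractional ideal, as a real number. -/
def idealNorm : IdealGroup F →* ℝ :=
  ((algebraMap ℚ ℝ).toMonoidHom.comp FractionalIdeal.absNorm.toMonoidHom).comp (Units.coeHom _)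

theorem idealNorm_apply (c : IdealGroup F) :
    idealNorm c = (FractionalIdeal.absNorm (c : FractionalIdeal (nonZeroDivisors (𝓞 F)) F) : ℚ) :=
  rfl

theorem idealNorm_pos (c : IdealGroup F) : 0 < idealNorm c := by
  rw [idealNorm_apply]
  have h := FractionalIdeal.absNorm_nonneg (c : FractionalIdeal (nonZeroDivisors (𝓞 F)) F)
  have h' : FractionalIdeal.absNorm (c : FractionalIdeal (nonZeroDivisors (𝓞 F)) F) ≠ 0 :=
    fun h => c.ne_zero (FractionalIdeal.absNorm_eq_zero_iff.1 h)
  exact_mod_cast h.lt_of_ne' h'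

theorem idealNorm_inv (c : IdealGroup F) : idealNorm c⁻¹ = (idealNorm c)⁻¹ :=
  eq_inv_of_mul_eq_one_left (by rw [← map_mul, inv_mul_cancel, map_one])

theorem mem_mul_principal {c : IdealGroup F} {a : Fˣ} {x : F} :
    x ∈ (c * toPrincipalIdeal (𝓞 F) F a : IdealGroup F).1 ↔ (a : F)⁻¹ * x ∈ c.1 := by
  rw [Units.val_mul, coe_toPrincipalIdeal, mul_comm, FractionalIdeal.mem_singleton_mul]
  constructor
  · rintro ⟨y, hy, rfl⟩
    rwa [inv_mul_cancel_left₀ a.ne_zero]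
  · intro h
    exact ⟨_, h, by rw [mul_inv_cancel_left₀ a.ne_zero]⟩

theorem idealNorm_principal (a : Fˣ) :
    idealNorm (toPrincipalIdeal (𝓞 F) F a) = ∏ v : InfinitePlace F, v (a : F) ^ v.mult := by
  rw [InfinitePlace.prod_eq_abs_norm, idealNorm_apply, coe_toPrincipalIdeal,
    FractionalIdeal.absNorm_span_singleton]

/-- The exponents in the prime factorization of a fractional ideal. -/
def idealCount (c : FractionalIdeal (nonZeroDivisors (𝓞 F)) F) : HeightOneSpectrum (𝓞 F) →₀ ℤ :=
  Finsupp.ofSupportFinite (fun v => FractionalIdeal.count F v c)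
    (Filter.eventually_cofinite.1 (FractionalIdeal.finite_factors c))

theorem idealCount_apply (c : FractionalIdeal (nonZeroDivisors (𝓞 F)) F)
    (v : HeightOneSpectrum (𝓞 F)) : idealCount c v = FractionalIdeal.count F v c := rfl

theorem prod_idealCount (c : IdealGroup F) :
    (idealCount c.1).prod (fun v m =>
      (v.asIdeal : FractionalIdeal (nonZeroDivisors (𝓞 F)) F) ^ m) = c := by
  conv_rhs => rw [← FractionalIdeal.finprod_heightOneSpectrum_factorization' F c.ne_zero]
  rw [Finsupp.prod, finprod_eq_finsetProd_of_mulSupport_subset]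
  · rfl
  · intro v hv
    rw [Finset.mem_coe, Finsupp.mem_support_iff]
    intro h
    rw [idealCount_apply] at h
    rw [Function.mem_mulSupport, h, zpow_zero] at hv
    exact hv rfl

/-- Fractional ideals correspond to families of exponents. -/
def idealEquiv : IdealGroup F ≃ (HeightOneSpectrum (𝓞 F) →₀ ℤ) where
  toFun c := idealCount c.1
  invFun D := Units.mk0 (D.prod fun v m =>
      (v.asIdeal : FractionalIdeal (nonZeroDivisors (𝓞 F)) F) ^ m)
    (Finset.prod_ne_zero_iff.2 fun v _ =>
      zpow_ne_zero _ (FractionalIdeal.coeIdeal_ne_zero.mpr v.ne_bot))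
  left_inv c := Units.ext (prod_idealCount c)
  right_inv D := by
    ext v
    exact FractionalIdeal.count_finsuppProd F v D

/-- Translates effectivity of a finite divisor into integrality of the ideal, the form in which the
unfolding meets it. -/
theorem idealEquiv_nonneg {c : IdealGroup F} : 0 ≤ idealEquiv c ↔ c.1 ≤ 1 := by
  constructor
  · intro h
    rw [← prod_idealCount c, Finsupp.prod]
    refine Finset.prod_induction _ (· ≤ 1) (fun a b ha hb => mul_le_one' ha hb) le_rfl fun v _ => ?_
    obtain ⟨n, hn⟩ := Int.eq_ofNat_of_zero_le (h v)
    change (_ : FractionalIdeal (nonZeroDivisors (𝓞 F)) F) ^ (idealEquiv c v) ≤ 1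
    rw [hn, zpow_natCast]
    exact pow_le_one' FractionalIdeal.coeIdeal_le_one n
  · intro h v
    have := FractionalIdeal.count_mono F v c.ne_zero h
    rwa [FractionalIdeal.count_one] at this

theorem sum_idealEquiv_mul_log (c : IdealGroup F) :
    (idealEquiv c).sum (fun v m => (m : ℝ) * Real.log (Ideal.absNorm v.asIdeal)) =
      Real.log (idealNorm c) := by
  have h0 : ∀ v : HeightOneSpectrum (𝓞 F), (Ideal.absNorm v.asIdeal : ℝ) ≠ 0 := fun v => by
    have : Ideal.absNorm v.asIdeal ≠ 0 := fun h => v.ne_bot (Ideal.absNorm_eq_zero_iff.1 h)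
    exact_mod_cast this
  rw [idealNorm_apply, ← prod_idealCount c, Finsupp.prod, map_prod, Rat.cast_prod, Real.log_prod]
  · refine Finset.sum_congr rfl fun v _ => ?_
    rw [map_zpow₀, FractionalIdeal.coeIdeal_absNorm, Rat.cast_zpow, Real.log_zpow]
    rfl
  · intro v _
    rw [map_zpow₀, FractionalIdeal.coeIdeal_absNorm, Rat.cast_zpow]
    exact zpow_ne_zero _ (by exact_mod_cast h0 v)

end Ideals

/-! ### Hermitian metrics on rational vectors -/

section Pairing

variable {F V : Type*} [Field F] [AddCommGroup V] [Module F V]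

theorem pairing_smul_smul {σ : F →+* ℂ} (c : HermitianMetric σ V) (a b : F) (x y : V) :
    c.pairing (a • x) (b • y) = starRingEnd ℂ (σ a) * σ b * c.pairing x y :=
  letI := σ.toAlgebra
  inner_smul_smul c a b x y

theorem pairing_self {σ : F →+* ℂ} (c : HermitianMetric σ V) (x : V) :
    c.pairing x x = ((c.pairing x x).re : ℂ) :=
  letI := σ.toAlgebra
  (Complex.conj_eq_iff_re.1 (c.conj_inner_symm _ _)).symm

theorem pairing_self_nonneg {σ : F →+* ℂ} (c : HermitianMetric σ V) (x : V) :
    0 ≤ (c.pairing x x).re :=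
  letI := σ.toAlgebra
  c.re_inner_nonneg _

/-- Definiteness on `ℂ ⊗ V` applies because `x ↦ 1 ⊗ x` is injective, by faithful flatness. -/
theorem pairing_self_pos {σ : F →+* ℂ} (c : HermitianMetric σ V) {x : V} (hx : x ≠ 0) :
    0 < (c.pairing x x).re := by
  refine (pairing_self_nonneg c x).lt_of_ne' fun h => hx ?_
  let := σ.toAlgebra
  have h0 : (1 : ℂ) ⊗ₜ[F] x = 0 := c.definite _ <| by
    change c.pairing x x = 0
    rw [pairing_self, h, Complex.ofReal_zero]
  have hf : Function.Injective (TensorProduct.mk F ℂ V 1) :=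
    Module.FaithfullyFlat.tensorProduct_mk_injective (A := F) (B := ℂ) V
  exact hf (h0.trans (TensorProduct.tmul_zero _ _).symm)

end Pairing

/-! ### Heights of sections and norms of line bundles -/

section Norms

open IsDedekindDomain NumberField

variable {F V : Type*} [Field F] [NumberField F] [AddCommGroup V] [Module F V]
  [Module (𝓞 F) V] [IsScalarTower (𝓞 F) F V] (E : ArakelovBundle F V)

theorem infNorm_smul (v : InfinitePlace F) (a : F) (x : V) :
    E.infNorm v (a • x) = v a * E.infNorm v x := by
  rw [ArakelovBundle.infNorm, ArakelovBundle.infNorm, pairing_smul_smul, Complex.conj_mul',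
    ← Complex.ofReal_pow, Complex.re_ofReal_mul, Real.sqrt_mul (sq_nonneg _),
    Real.sqrt_sq (norm_nonneg _), ← InfinitePlace.norm_embedding_eq]

theorem infNorm_sq (v : InfinitePlace F) (x : V) :
    E.infNorm v x ^ 2 = ((E.metric v.embedding).pairing x x).re :=
  Real.sq_sqrt (pairing_self_nonneg _ x)

theorem infNorm_pos (v : InfinitePlace F) {x : V} (hx : x ≠ 0) : 0 < E.infNorm v x :=
  Real.sqrt_pos.2 (pairing_self_pos _ hx)

theorem mem_sectionIdeal {x : V} (hx : x ≠ 0) {a : F} :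
    a ∈ E.sectionIdeal x hx ↔ a • x ∈ E.lattice := Iff.rfl

theorem sectionIdeal_ne_zero {x : V} (hx : x ≠ 0) : E.sectionIdeal x hx ≠ 0 := by
  have := E.isLattice
  obtain ⟨d, hd, hdx⟩ := exists_smul_mem E.lattice x
  intro h
  have h1 : algebraMap (𝓞 F) F d ∈ E.sectionIdeal x hx := by
    rw [mem_sectionIdeal, algebraMap_smul]; exact hdx
  rw [h, FractionalIdeal.mem_zero_iff] at h1
  exact hd (by simpa using h1)

/-- The fractional ideal of a nonzero section, as an element of the group of fractional ideals. -/
def sectionUnit {x : V} (hx : x ≠ 0) : IdealGroup F :=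
  Units.mk0 _ (sectionIdeal_ne_zero E hx)

theorem mem_sectionUnit {x : V} (hx : x ≠ 0) {a : F} :
    a ∈ (sectionUnit E hx).1 ↔ a • x ∈ E.lattice := Iff.rfl

theorem sectionUnit_smul {x : V} (hx : x ≠ 0) (a : Fˣ) (hax : (a : F) • x ≠ 0) :
    sectionUnit E hax * toPrincipalIdeal (𝓞 F) F a = sectionUnit E hx := by
  refine Units.ext (FractionalIdeal.ext fun b => ?_)
  rw [mem_mul_principal, mem_sectionUnit, mem_sectionUnit, smul_smul, mul_right_comm,
    inv_mul_cancel₀ a.ne_zero, one_mul]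

/-- The height `∏ ‖x‖_v ^ n_v * N(x)` of the line spanned by a nonzero vector. -/
def sectionHeight {x : V} (hx : x ≠ 0) : ℝ :=
  (∏ v : InfinitePlace F, E.infNorm v x ^ v.mult) * idealNorm (sectionUnit E hx)

theorem sectionHeight_pos {x : V} (hx : x ≠ 0) : 0 < sectionHeight E hx :=
  mul_pos (Finset.prod_pos fun v _ => pow_pos (infNorm_pos E v hx) _) (idealNorm_pos _)

/-- The product formula: the archimedean factor gains `∏ |a|_v ^ n_v`, which is the norm of the
ideal `(a)`, and the ideal of the section is divided by `(a)`. -/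
theorem sectionHeight_smul {x : V} (hx : x ≠ 0) (a : Fˣ) (hax : (a : F) • x ≠ 0) :
    sectionHeight E hax = sectionHeight E hx := by
  rw [sectionHeight, sectionHeight, ← sectionUnit_smul E hx a hax, map_mul, idealNorm_principal]
  simp only [infNorm_smul, mul_pow, Finset.prod_mul_distrib]
  ring

theorem degree_eq (t : InfinitePlace F → ℝ) (c : IdealGroup F) :
    ArakelovDivisor.degree ((t, idealEquiv c) : ArakelovDivisor F) =
      ∑ v, t v + Real.log (idealNorm c) := by
  rw [ArakelovDivisor.degree, sum_idealEquiv_mul_log]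

theorem norm_div {x : V} (hx : x ≠ 0) : (E.div x hx).norm = (sectionHeight E hx)⁻¹ := by
  have h : E.div x hx = (fun v => -(v.mult * Real.log (E.infNorm v x)),
      idealEquiv (sectionUnit E hx)⁻¹) := by
    refine Prod.ext rfl (Finsupp.ext fun v => ?_)
    exact (FractionalIdeal.count_inv F v _).symm
  rw [h, ArakelovDivisor.norm, degree_eq, idealNorm_inv, Real.log_inv, Finset.sum_neg_distrib,
    ← neg_add, Real.exp_neg, sectionHeight, Real.exp_add, Real.exp_log (idealNorm_pos _),
    Real.exp_sum]
  congr 2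
  refine Finset.prod_congr rfl fun v _ => ?_
  rw [mul_comm, Real.exp_mul, Real.exp_log (infNorm_pos E v hx), Real.rpow_natCast]

theorem lineNorm_eq (h : finrank F V = 1) {x : V} (hx : x ≠ 0) :
    E.lineNorm = (sectionHeight E hx)⁻¹ := by
  have h' : ∃ x : V, x ≠ 0 := ⟨x, hx⟩
  rw [ArakelovBundle.lineNorm, dif_pos h', norm_div]
  obtain ⟨a, ha⟩ := (finrank_eq_one_iff_of_nonzero' x hx).1 h h'.choose
  have ha0 : a ≠ 0 := by
    rintro rfl
    exact h'.choose_spec (by rw [← ha, zero_smul])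
  have h1 := sectionHeight_smul E hx (Units.mk0 a ha0) (by rw [Units.val_mk0, ha]; exact h'.choose_spec)
  rw [← h1]
  congr 2
  exact ha.symm

end Norms

/-! ### Pseudo-bases of lattices, determinants and duality -/

section PseudoBasis

open IsDedekindDomain NumberField
open scoped ComplexOrder

variable {F : Type*} [Field F] [NumberField F]

section Lattice

variable {V : Type*} [AddCommGroup V] [Module F V] [Module (𝓞 F) V] [IsScalarTower (𝓞 F) F V]

/-- A basis of `V` which exhibits the lattice as a direct sum of fractional ideals. -/
def IsPseudoBasis {ι : Type*} (Γ : Submodule (𝓞 F) V) (b : Basis ι F V) (𝔞 : ι → IdealGroup F) :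
    Prop :=
  ∀ x, x ∈ Γ ↔ ∀ i, b.repr x i ∈ (𝔞 i).1

/-- The image of a lattice under a functional. -/
def latticeImage (Γ : Submodule (𝓞 F) V) [hΓ : Submodule.IsLattice F Γ] (f : Dual F V) :
    FractionalIdeal (nonZeroDivisors (𝓞 F)) F :=
  ⟨Γ.map (f.restrictScalars (𝓞 F)), FractionalIdeal.isFractional_of_fg (hΓ.fg.map _)⟩

/-- The image `J = f(Γ)` is invertible, so `1 = ∑ f(γ) j` with `γ ∈ Γ` and `j ∈ J⁻¹`; then `y = ∑ j
γ` works since `a j` is integral for `a ∈ J`. Thus `a ↦ a y` splits the surjection `Γ → J`. -/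
theorem exists_splitting (Γ : Submodule (𝓞 F) V) [Submodule.IsLattice F Γ] (f : Dual F V)
    (h0 : latticeImage Γ f ≠ 0) :
    ∃ y : V, f y = 1 ∧ ∀ a ∈ latticeImage Γ f, a • y ∈ Γ := by
  have h1 : (1 : F) ∈ latticeImage Γ f * (latticeImage Γ f)⁻¹ := by
    rw [mul_inv_cancel₀ h0]; exact FractionalIdeal.one_mem_one _
  refine FractionalIdeal.mul_induction_on h1
    (C := fun z => ∃ y : V, f y = z ∧ ∀ a ∈ latticeImage Γ f, a • y ∈ Γ) ?_ ?_
  · rintro _ ⟨γ, hγ, rfl⟩ j hj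
    refine ⟨j • γ, by rw [map_smul, smul_eq_mul, mul_comm]; rfl, fun a ha => ?_⟩
    rw [FractionalIdeal.mem_inv_iff h0] at hj
    obtain ⟨d, hd⟩ := FractionalIdeal.mem_one_iff _ |>.1 (hj a ha)
    rw [smul_smul, mul_comm, ← hd, algebraMap_smul]
    exact Γ.smul_mem d hγ
  · rintro _ _ ⟨y, rfl, hy⟩ ⟨z, rfl, hz⟩
    refine ⟨y + z, map_add _ _ _, fun a ha => ?_⟩
    rw [smul_add]
    exact Γ.add_mem (hy a ha) (hz a ha)

end Lattice

/-- Every lattice is a direct sum of fractional ideals. -/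
theorem exists_isPseudoBasis (n : ℕ) : ∀ {V : Type*} [AddCommGroup V] [Module F V]
    [FiniteDimensional F V] [Module (𝓞 F) V] [IsScalarTower (𝓞 F) F V] (Γ : Submodule (𝓞 F) V)
    [Submodule.IsLattice F Γ], finrank F V = n →
    ∃ (b : Basis (Fin n) F V) (𝔞 : Fin n → IdealGroup F), IsPseudoBasis Γ b 𝔞 := by
  induction n with
  | zero =>
    intro V _ _ _ _ _ Γ _ hn
    have := finrank_zero_iff.1 hn
    exact ⟨finBasisOfFinrankEq F V hn, fun _ => 1, fun x =>
      ⟨fun _ i => i.elim0, fun _ => by rw [Subsingleton.elim x 0]; exact Γ.zero_mem⟩⟩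
  | succ n ih =>
    intro V _ _ _ _ _ Γ hΓ hn
    set f : Dual F V := (finBasisOfFinrankEq F V hn).coord 0 with hf
    have hf0 : f ≠ 0 := fun h => by
      have := congrArg (fun g : Dual F V => g (finBasisOfFinrankEq F V hn 0)) h
      simp [hf] at this
    have h0 : latticeImage Γ f ≠ 0 := fun h => hf0 <| by
      refine LinearMap.ext_on hΓ.span_eq_top fun x hx => ?_
      have : f x ∈ latticeImage Γ f := ⟨x, hx, rfl⟩
      rw [h, FractionalIdeal.mem_zero_iff] at this
      rw [this, LinearMap.zero_apply]
    obtain ⟨y, hy1, hy⟩ := exists_splitting Γ f h0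
    have hW : finrank F (LinearMap.ker f) = n := by
      have h1 := LinearMap.finrank_range_add_finrank_ker f
      rw [LinearMap.range_eq_top.2 (LinearMap.surjective hf0), _root_.finrank_top, finrank_self, hn] at h1
      omega
    have := restrictLattice_isLattice Γ (LinearMap.ker f)
    obtain ⟨bW, 𝔞W, hbW⟩ := ih (restrictLattice Γ (LinearMap.ker f)) hW
    -- Because `a • y ∈ Γ` for `a ∈ f(Γ)`, the projection `x ↦ x - f x • y` preserves `Γ`, so `Γ` is
    -- the direct sum of `f(Γ) y` and `Γ ∩ ker f`; the latter is covered by induction.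
    let b : Basis (Fin (n + 1)) F V := Basis.mkFinCons y bW
      (fun c x hx h => by
        have := congrArg f h
        rw [map_add, map_smul, hy1, LinearMap.mem_ker.1 hx, map_zero] at this
        simpa using this)
      (fun z => ⟨-f z, by rw [LinearMap.mem_ker, map_add, map_smul, hy1]; simp⟩)
    have hb : ⇑b = Fin.cons y (fun i => (bW i : V)) := Basis.coe_mkFinCons _ _ _ _
    have hsum : ∀ x, x = b.repr x 0 • y + ∑ i : Fin n, b.repr x i.succ • (bW i : V) := fun x => by
      conv_lhs => rw [← b.sum_repr x, Fin.sum_univ_succ]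
      simp [hb]
    have hrepr0 : ∀ x, b.repr x 0 = f x := fun x => by
      have h := congrArg f (hsum x)
      rw [map_add, map_smul, hy1, map_sum] at h
      simpa using h.symm
    have hsub : ∀ x, x - f x • y = ((∑ i : Fin n, b.repr x i.succ • bW i : LinearMap.ker f) : V) :=
      fun x => by
        have := hsum x
        rw [hrepr0] at this
        rw [sub_eq_iff_eq_add', Submodule.coe_sum]
        exact this
    refine ⟨b, Fin.cons (Units.mk0 _ h0) 𝔞W, fun x => ?_⟩
    have hW' := hbW (∑ i : Fin n, b.repr x i.succ • bW i)
    have hmem : (∑ i : Fin n, b.repr x i.succ • bW i) ∈ restrictLattice Γ (LinearMap.ker f) ↔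
        x - f x • y ∈ Γ := by
      rw [hsub]; rfl
    simp only [bW.repr_sum_self, hmem] at hW'
    rw [Fin.forall_fin_succ, hrepr0]
    simp only [Fin.cons_zero, Fin.cons_succ, Units.val_mk0, ← hW']
    constructor
    · intro hx
      have h1 : f x ∈ latticeImage Γ f := ⟨x, hx, rfl⟩
      exact ⟨h1, Γ.sub_mem hx (hy _ h1)⟩
    · rintro ⟨h1, h2⟩
      have := Γ.add_mem h2 (hy _ h1)
      rwa [sub_add_cancel] at this

section Bundle

variable {V : Type*} [AddCommGroup V] [Module F V] [Module (𝓞 F) V] [IsScalarTower (𝓞 F) F V]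
variable {ι : Type*} [Fintype ι] [DecidableEq ι]

/-- The Gram matrix of a basis at an embedding. -/
def gramAt (E : ArakelovBundle F V) (b : ι → V) (σ : F →+* ℂ) : Matrix ι ι ℂ :=
  Matrix.of fun i j => (E.metric σ).pairing (b i) (b j)

/-- The inverse of the norm of a bundle, computed in a pseudo-basis. -/
def pseudoVolume (E : ArakelovBundle F V) (b : ι → V) (𝔞 : ι → IdealGroup F) : ℝ :=
  (∏ v : InfinitePlace F, √((gramAt E b v.embedding).det.re) ^ v.mult) * idealNorm (∏ i, 𝔞 i)

theorem pseudoVolume_reindex {κ : Type*} [Fintype κ] [DecidableEq κ] (E : ArakelovBundle F V)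
    (b : ι → V) (𝔞 : ι → IdealGroup F) (e : κ ≃ ι) :
    pseudoVolume E (b ∘ e) (𝔞 ∘ e) = pseudoVolume E b 𝔞 := by
  have h : ∀ σ, gramAt E (b ∘ e) σ = (gramAt E b σ).submatrix e e := fun σ => rfl
  simp only [pseudoVolume, h, Matrix.det_submatrix_equiv_self, Function.comp_apply, e.prod_comp]

theorem prod_mem_prod {s : Finset ι} {𝔞 : ι → IdealGroup F} {a : ι → F}
    (h : ∀ i ∈ s, a i ∈ (𝔞 i).1) : ∏ i ∈ s, a i ∈ (∏ i ∈ s, 𝔞 i : IdealGroup F).1 := by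
  induction s using Finset.induction_on with
  | empty => simp
  | insert j s hj ih =>
    rw [Finset.prod_insert hj, Finset.prod_insert hj, Units.val_mul]
    exact FractionalIdeal.mul_mem_mul (h j (Finset.mem_insert_self _ _))
      (ih fun i hi => h i (Finset.mem_insert_of_mem hi))

/-- A product of fractional ideals is additively generated by products of elements. The predicate is
quantified inside so that the inductive hypothesis can be applied to `C (a * ·)`. Stability under `𝓞
F` serves the empty product, which is all of `𝓞 F` and not only the multiples of `1`. -/
theorem prod_ideal_induction {𝔞 : ι → IdealGroup F} (s : Finset ι) : ∀ {C : F → Prop},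
    (∀ x y, C x → C y → C (x + y)) → (∀ a : ι → F, (∀ i ∈ s, a i ∈ (𝔞 i).1) → C (∏ i ∈ s, a i)) →
    (∀ (d : 𝓞 F) x, C x → C (d * x)) →
    ∀ z ∈ (∏ i ∈ s, 𝔞 i : IdealGroup F).1, C z := by
  induction s using Finset.induction_on with
  | empty =>
    intro C _ h1 h2 z hz
    rw [Finset.prod_empty, Units.val_one, FractionalIdeal.mem_one_iff] at hz
    obtain ⟨d, rfl⟩ := hz
    simpa using h2 d _ (h1 (fun _ => 0) (by simp))
  | insert j s hj ih =>
    intro C h0 h1 h2 z hz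
    rw [Finset.prod_insert hj, Units.val_mul] at hz
    refine FractionalIdeal.mul_induction_on hz (fun a ha c hc => ?_) h0
    refine ih (C := fun y => C (a * y)) (fun x y hx hy => ?_) (fun a' ha' => ?_) (fun d x hx => ?_)
      c hc
    · rw [mul_add]; exact h0 _ _ hx hy
    · have := h1 (Function.update a' j a) fun i hi => by
        by_cases hij : i = j
        · rw [hij, Function.update_self]
          exact ha
        · rw [Function.update_of_ne hij]
          exact ha' i (Finset.mem_of_mem_insert_of_ne hi hij)
      have hprod : ∏ i ∈ s, Function.update a' j a i = ∏ i ∈ s, a' i :=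
        Finset.prod_congr rfl fun i hi =>
          Function.update_of_ne (fun hij : i = j => hj (hij ▸ hi)) _ _
      rwa [Finset.prod_insert hj, Function.update_self, hprod] at this
    · rw [mul_left_comm]; exact h2 d _ hx

theorem IsPseudoBasis.reindex {κ : Type*} {Γ : Submodule (𝓞 F) V} {b : Basis ι F V}
    {𝔞 : ι → IdealGroup F} (h : IsPseudoBasis Γ b 𝔞) (e : ι ≃ κ) :
    IsPseudoBasis Γ (b.reindex e) (𝔞 ∘ e.symm) := fun x => by
  rw [h x, ← e.symm.forall_congr_right]
  simp

theorem IsPseudoBasis.smul_mem {Γ : Submodule (𝓞 F) V} {b : Basis ι F V}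
    {𝔞 : ι → IdealGroup F} (h : IsPseudoBasis Γ b 𝔞) {i : ι} {a : F} :
    a • b i ∈ Γ ↔ a ∈ (𝔞 i).1 := by
  rw [h]
  constructor
  · intro h'
    simpa using h' i
  · intro ha j
    by_cases hij : i = j
    · subst hij; simpa using ha
    · simp only [map_smul, Basis.repr_self, Finsupp.smul_apply, Finsupp.single_eq_of_ne' hij,
        smul_zero]
      exact FractionalIdeal.zero_mem _

theorem lineNorm_eq_pseudoVolume [Unique ι] (E : ArakelovBundle F V) {b : Basis ι F V}
    {𝔞 : ι → IdealGroup F} (h : IsPseudoBasis E.lattice b 𝔞) :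
    E.lineNorm = (pseudoVolume E b 𝔞)⁻¹ := by
  rw [lineNorm_eq E (by rw [finrank_eq_card_basis b, Fintype.card_unique]) (b.ne_zero default),
    sectionHeight, pseudoVolume]
  congr 2
  · refine Finset.prod_congr rfl fun v _ => ?_
    rw [Matrix.det_unique]
    rfl
  · rw [Fintype.prod_unique]
    congr 1
    exact Units.ext (FractionalIdeal.ext fun a => (mem_sectionUnit _ _).trans h.smul_mem)

variable [FiniteDimensional F V]

theorem wedge_ne_zero (b : Basis (Fin (finrank F V)) F V) :
    exteriorPower.ιMulti F (finrank F V) b ≠ 0 := by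
  intro h
  have h1 := exteriorPower.alternatingMapLinearEquiv_apply_ιMulti b.det b
  rw [h, map_zero, Basis.det_self] at h1
  exact zero_ne_one h1

theorem wedge_eq_det_smul (b : Basis (Fin (finrank F V)) F V) (x : Fin (finrank F V) → V) :
    exteriorPower.ιMulti F (finrank F V) x =
      b.det x • exteriorPower.ιMulti F (finrank F V) b := by
  obtain ⟨f, hf⟩ : ∃ f : V [⋀^Fin (finrank F V)]→ₗ[F] (⋀[F]^(finrank F V) V),
    f = exteriorPower.ιMulti F (finrank F V) := ⟨_, rfl⟩
  have h : f = (LinearMap.toSpanSingleton F _ (f b)).compAlternatingMap b.det := by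
    refine b.ext_alternating fun v hv => ?_
    have he := Finite.injective_iff_bijective.1 hv
    let e : Equiv.Perm (Fin (finrank F V)) := Equiv.ofBijective v he
    change f (b ∘ e) = b.det (b ∘ e) • f b
    rw [AlternatingMap.map_perm, AlternatingMap.map_perm, Basis.det_self]
    rcases Int.units_eq_one_or (Equiv.Perm.sign e) with h | h
    · rw [h, one_smul, one_smul]
      exact (one_smul F (f b)).symm
    · rw [h, Units.neg_smul, one_smul, Units.neg_smul, one_smul]
      exact (neg_one_smul F (f b)).symm
  rw [← hf]
  exact congrArg (fun g : V [⋀^Fin (finrank F V)]→ₗ[F] (⋀[F]^(finrank F V) V) => g x) h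

theorem det_mem_prod {Γ : Submodule (𝓞 F) V} {b : Basis ι F V}
    {𝔞 : ι → IdealGroup F} (h : IsPseudoBasis Γ b 𝔞) {x : ι → V} (hx : ∀ i, x i ∈ Γ) :
    b.det x ∈ (∏ i, 𝔞 i : IdealGroup F).1 := by
  rw [Basis.det_apply, Matrix.det_apply]
  refine Submodule.sum_mem ((∏ i, 𝔞 i : IdealGroup F).1 : Submodule (𝓞 F) F) fun τ _ => ?_
  have h1 : ∏ i, b.toMatrix x (τ i) i ∈ (∏ i, 𝔞 i : IdealGroup F).1 := by
    rw [← Equiv.prod_comp τ 𝔞]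
    exact prod_mem_prod fun i _ => (h (x i)).1 (hx i) (τ i)
  rcases Int.units_eq_one_or (Equiv.Perm.sign τ) with h | h
  · rw [h, one_smul]; exact h1
  · rw [h, Units.neg_smul, one_smul]
    exact ((∏ i, 𝔞 i : IdealGroup F).1 : Submodule (𝓞 F) F).neg_mem h1

/-- One inclusion is the Leibniz formula: determinants of lattice vectors lie in `∏ 𝔞ᵢ`. The other
holds because this ideal is additively generated by products `∏ aᵢ` with `aᵢ ∈ 𝔞ᵢ`, for which the
multiple of the wedge is `(a₁ b₁) ∧ ⋯ ∧ (aᵣ bᵣ)`. -/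
theorem smul_wedge_mem_detLattice {Γ : Submodule (𝓞 F) V} {b : Basis (Fin (finrank F V)) F V}
    {𝔞 : Fin (finrank F V) → IdealGroup F} (h : IsPseudoBasis Γ b 𝔞) {a : F} :
    a • exteriorPower.ιMulti F (finrank F V) b ∈ detLattice Γ ↔
      a ∈ (∏ i, 𝔞 i : IdealGroup F).1 := by
  constructor
  · intro ha
    have key : ∀ w ∈ detLattice Γ, ∃ c ∈ (∏ i, 𝔞 i : IdealGroup F).1,
        w = c • exteriorPower.ιMulti F (finrank F V) b := by
      intro w hw
      induction hw using Submodule.span_induction with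
      | mem w hw =>
        obtain ⟨x, hx, rfl⟩ := hw
        exact ⟨_, det_mem_prod h hx, wedge_eq_det_smul b x⟩
      | zero => exact ⟨0, FractionalIdeal.zero_mem _, (zero_smul _ _).symm⟩
      | add w w' _ _ hw hw' =>
        obtain ⟨c, hc, rfl⟩ := hw
        obtain ⟨c', hc', rfl⟩ := hw'
        exact ⟨c + c', Submodule.add_mem _ hc hc', (add_smul _ _ _).symm⟩
      | smul d w _ hw =>
        obtain ⟨c, hc, rfl⟩ := hw
        exact ⟨d • c, Submodule.smul_mem _ d hc, (smul_assoc _ _ _).symm⟩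
    obtain ⟨c, hc, hac⟩ := key _ ha
    rwa [smul_left_injective F (wedge_ne_zero b) hac]
  · refine prod_ideal_induction Finset.univ (C := fun a =>
      a • exteriorPower.ιMulti F (finrank F V) b ∈ detLattice Γ) (fun x y hx hy => ?_)
      (fun a ha => ?_) (fun d x hx => ?_) a
    · rw [add_smul]; exact Submodule.add_mem _ hx hy
    · rw [← AlternatingMap.map_smul_univ]
      exact Submodule.subset_span ⟨_, fun i => h.smul_mem.2 (ha i (Finset.mem_univ i)), rfl⟩
    · rw [mul_smul, algebraMap_smul]; exact Submodule.smul_mem _ d hx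

theorem norm_eq_pseudoVolume_fin (E : ArakelovBundle F V) {b : Basis (Fin (finrank F V)) F V}
    {𝔞 : Fin (finrank F V) → IdealGroup F} (h : IsPseudoBasis E.lattice b 𝔞) :
    E.norm = (pseudoVolume E b 𝔞)⁻¹ := by
  rw [ArakelovBundle.norm, lineNorm_eq E.det Arakelov.finrank_top (wedge_ne_zero b), sectionHeight,
    pseudoVolume]
  congr 2
  · refine Finset.prod_congr rfl fun v _ => ?_
    rw [ArakelovBundle.infNorm]
    have := pairing_det (E.metric v.embedding) b 1 1
    simp only [map_one, one_mul, one_smul] at this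
    congr 3
  · congr 1
    exact Units.ext (FractionalIdeal.ext fun a => (mem_sectionUnit _ _).trans
      (smul_wedge_mem_detLattice h))

theorem norm_eq_pseudoVolume (E : ArakelovBundle F V) {b : Basis ι F V}
    {𝔞 : ι → IdealGroup F} (h : IsPseudoBasis E.lattice b 𝔞) :
    E.norm = (pseudoVolume E b 𝔞)⁻¹ := by
  let e : ι ≃ Fin (finrank F V) := Fintype.equivFinOfCardEq (finrank_eq_card_basis b).symm
  rw [norm_eq_pseudoVolume_fin E (h.reindex e), Basis.coe_reindex, pseudoVolume_reindex]

theorem IsPseudoBasis.dual {Γ : Submodule (𝓞 F) V} {b : Basis ι F V}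
    {𝔞 : ι → IdealGroup F} (h : IsPseudoBasis Γ b 𝔞) :
    IsPseudoBasis (dualLattice Γ) b.dualBasis fun i => (𝔞 i)⁻¹ := by
  intro f
  have hint : ∀ x : F, IsIntegral ℤ x ↔
      x ∈ (1 : FractionalIdeal (nonZeroDivisors (𝓞 F)) F) := fun x => by
    rw [FractionalIdeal.mem_one_iff]
    exact ⟨fun hx => ⟨⟨x, hx⟩, rfl⟩, fun ⟨d, hd⟩ => hd ▸ RingOfIntegers.isIntegral_coe d⟩
  simp only [Units.val_inv_eq_inv_val, Basis.dualBasis_repr]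
  constructor
  · intro hf i
    rw [FractionalIdeal.mem_inv_iff (𝔞 i).ne_zero]
    intro a ha
    have := hf (a • b i) (h.smul_mem.2 ha)
    rwa [map_smul, smul_eq_mul, mul_comm, hint] at this
  · intro hf x hx
    rw [hint, ← b.sum_repr x, map_sum]
    refine Submodule.sum_mem
      ((1 : FractionalIdeal (nonZeroDivisors (𝓞 F)) F) : Submodule (𝓞 F) F) fun i _ => ?_
    have := FractionalIdeal.mul_mem_mul ((h x).1 hx i) (hf i)
    rw [mul_inv_cancel₀ (𝔞 i).ne_zero] at this
    rwa [map_smul, smul_eq_mul]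

/-- The transpose appears because the Riesz identification of `V^∨` with `V` is conjugate-linear,
which exchanges the two arguments. -/
theorem gramAt_dual (E : ArakelovBundle F V) (b : Basis (Fin (finrank F V)) F V) (σ : F →+* ℂ) :
    gramAt E.dual b.dualBasis σ = (gramAt E b σ)⁻¹.transpose := by
  ext i j
  refine (pairing_dual (E.metric σ) b _ _).trans ?_
  have h : ∀ i, (fun k => σ (b.dualBasis i (b k))) = Pi.single i 1 := fun i => by
    funext k
    by_cases hik : k = i <;> simp [hik]
  rw [h, h]
  have hs : star (Pi.single i 1 : Fin (finrank F V) → ℂ) = Pi.single i 1 := by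
    rw [← Pi.single_star, star_one]
  rw [hs, Matrix.mulVec_single_one, single_one_dotProduct]
  rfl

theorem gramAt_posDef (E : ArakelovBundle F V) (b : Basis (Fin (finrank F V)) F V) (σ : F →+* ℂ) :
    (gramAt E b σ).PosDef := by
  let := σ.toAlgebra
  have h : gramAt E b σ = _ := gram_eq (E.metric σ) b b
  rw [h]
  refine Matrix.PosDef.conjTranspose_mul_self _ ?_
  have : ((orthoBasis (E.metric σ) finrank_baseChange).toMatrix fun i => (1 : ℂ) ⊗ₜ[F] b i) =
      (orthoBasis (E.metric σ) finrank_baseChange).toMatrix (Algebra.TensorProduct.basis ℂ b) := by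
    congr 1; ext i; simp
  rw [this, Matrix.mulVec_injective_iff_isUnit, Matrix.isUnit_iff_isUnit_det, ← Basis.det_apply]
  exact Basis.isUnit_det _ _

theorem pseudoVolume_pos (E : ArakelovBundle F V) (b : Basis (Fin (finrank F V)) F V)
    (𝔞 : Fin (finrank F V) → IdealGroup F) : 0 < pseudoVolume E b 𝔞 :=
  mul_pos (Finset.prod_pos fun v _ => pow_pos (Real.sqrt_pos.2
    (Complex.pos_iff.1 (gramAt_posDef E b v.embedding).det_pos).1) _) (idealNorm_pos _)

theorem pseudoVolume_dual (E : ArakelovBundle F V) (b : Basis (Fin (finrank F V)) F V)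
    (𝔞 : Fin (finrank F V) → IdealGroup F) :
    pseudoVolume E.dual b.dualBasis (fun i => (𝔞 i)⁻¹) = (pseudoVolume E b 𝔞)⁻¹ := by
  rw [pseudoVolume, pseudoVolume, Finset.prod_inv_distrib, idealNorm_inv, mul_inv,
    ← Finset.prod_inv_distrib]
  congr 1
  refine Finset.prod_congr rfl fun v _ => ?_
  have h := (gramAt_posDef E b v.embedding).det_pos
  rw [← inv_pow, ← Real.sqrt_inv, gramAt_dual, Matrix.det_transpose, Matrix.det_nonsing_inv,
    Ring.inverse_eq_inv', Complex.eq_re_of_ofReal_le (r := 0) h.le, ← Complex.ofReal_inv,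
    Complex.ofReal_re, Complex.ofReal_re]

theorem exists_pseudoBasis (E : ArakelovBundle F V) :
    ∃ (b : Basis (Fin (finrank F V)) F V) (𝔞 : Fin (finrank F V) → IdealGroup F),
      IsPseudoBasis E.lattice b 𝔞 :=
  have := E.isLattice
  exists_isPseudoBasis _ E.lattice rfl

theorem norm_pos (E : ArakelovBundle F V) : 0 < E.norm := by
  obtain ⟨b, 𝔞, h⟩ := exists_pseudoBasis E
  rw [norm_eq_pseudoVolume E h]
  exact inv_pos.2 (pseudoVolume_pos E b 𝔞)

theorem norm_dual (E : ArakelovBundle F V) : E.dual.norm = E.norm⁻¹ := by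
  obtain ⟨b, 𝔞, h⟩ := exists_pseudoBasis E
  rw [norm_eq_pseudoVolume E h, norm_eq_pseudoVolume E.dual h.dual, pseudoVolume_dual]

theorem lineNorm_dual (E : ArakelovBundle F V) (h1 : finrank F V = 1) :
    E.dual.lineNorm = E.lineNorm⁻¹ := by
  obtain ⟨b, 𝔞, h⟩ := exists_pseudoBasis E
  have : Unique (Fin (finrank F V)) := by rw [h1]; infer_instance
  rw [lineNorm_eq_pseudoVolume E h, lineNorm_eq_pseudoVolume E.dual h.dual, pseudoVolume_dual]

theorem sectionHeight_restrict (E : ArakelovBundle F V) (W : Submodule F V) {x : V} (hW : x ∈ W)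
    (hx : x ≠ 0) (hx' : (⟨x, hW⟩ : W) ≠ 0) :
    sectionHeight (E.restrict W) hx' = sectionHeight E hx := by
  rw [sectionHeight, sectionHeight]
  congr 1

/-- Two inversions cancel: `H(P) = N(P^∨) = N(P)⁻¹`, and `N(P)` is itself the inverse of the section
height. This is the only form in which heights are used afterwards. -/
theorem height_eq (E : ArakelovBundle F V) (P : ℙ F V) {x : V} (hx : x ≠ 0) (hP : x ∈ P.submodule) :
    E.height P = sectionHeight E hx := by
  have h1 : finrank F P.submodule = 1 := P.finrank_submodule
  have hx' : (⟨x, hP⟩ : P.submodule) ≠ 0 := fun h => hx (congrArg Subtype.val h)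
  rw [ArakelovBundle.height, lineNorm_dual _ h1, lineNorm_eq _ h1 hx', inv_inv,
    sectionHeight_restrict E _ hP hx]

end Bundle

end PseudoBasis

/-! ### Integral bases, discriminant and different -/

section IntegralBases

open NumberField

variable {F : Type*} [Field F] [NumberField F]

/-- The fibre over `v` has `v.mult` elements. This converts sums over embeddings, natural for
matrices, into the weighted sums over places of the definitions. -/
theorem sum_comp_mk {M : Type*} [AddCommMonoid M] (g : InfinitePlace F → M) :
    ∑ σ : F →+* ℂ, g (InfinitePlace.mk σ) = ∑ v : InfinitePlace F, v.mult • g v := by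
  classical
  rw [← Finset.sum_fiberwise Finset.univ (fun σ : F →+* ℂ => InfinitePlace.mk σ)]
  refine Finset.sum_congr rfl fun v _ => ?_
  rw [Finset.sum_congr rfl fun σ hσ => by rw [(Finset.mem_filter.1 hσ).2], Finset.sum_const,
    InfinitePlace.card_filter_mk_eq]

theorem prod_comp_mk {M : Type*} [CommMonoid M] (g : InfinitePlace F → M) :
    ∏ σ : F →+* ℂ, g (InfinitePlace.mk σ) = ∏ v : InfinitePlace F, g v ^ v.mult :=
  sum_comp_mk (M := Additive M) g

/-- The matrix of all embeddings of a family of elements of `F`. -/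
def embMatrix {κ : Type*} (ω : κ → F) : Matrix (F →+* ℂ) κ ℂ :=
  Matrix.of fun σ k => σ (ω k)

/-- The trace is the sum of the embeddings. Hence the squared determinant is a discriminant, and
trace-dual bases have inverse-transposed matrices. -/
theorem embMatrix_transpose_mul {κ : Type*} (ω ω' : κ → F) :
    (embMatrix ω').transpose * embMatrix ω =
      Matrix.of fun k l => ((Algebra.trace ℚ F (ω' k * ω l) : ℚ) : ℂ) := by
  ext k l
  have h := trace_eq_sum_embeddings (K := ℚ) (L := F) ℂ (x := ω' k * ω l)
  rw [Matrix.mul_apply, Matrix.of_apply, ← eq_ratCast (algebraMap ℚ ℂ), h,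
    ← (RingHom.equivRatAlgHom F ℂ).sum_comp]
  refine Finset.sum_congr rfl fun σ _ => ?_
  simp [embMatrix, RingHom.equivRatAlgHom_apply]

theorem embMatrix_det_sq [DecidableEq (F →+* ℂ)] (ω : (F →+* ℂ) → F) :
    (embMatrix ω).det ^ 2 = (Algebra.discr ℚ ω : ℂ) := by
  have h := embMatrix_transpose_mul ω ω
  have h' := congrArg Matrix.det h
  rw [Matrix.det_mul, Matrix.det_transpose, ← sq] at h'
  rw [h', Algebra.discr_def, ← eq_ratCast (algebraMap ℚ ℂ), RingHom.map_det]
  congr 1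

/-- Passing from an integral basis to a basis of `I` multiplies the discriminant by the square of a
determinant, whose absolute value is the norm of `I`. Reindexing, which does not change the
discriminant, puts both bases on one index type. -/
theorem discr_basisOfFractionalIdeal (I : IdealGroup F) {κ : Type*} [Fintype κ] [DecidableEq κ]
    (e : Free.ChooseBasisIndex ℤ I ≃ κ) :
    (Algebra.discr ℚ ((basisOfFractionalIdeal F I).reindex e) : ℝ) =
      discr F * idealNorm I ^ 2 := by
  have hcard : Fintype.card (Free.ChooseBasisIndex ℤ (𝓞 F)) =
      Fintype.card (Free.ChooseBasisIndex ℤ I) := by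
    rw [← finrank_eq_card_chooseBasisIndex, ← finrank_eq_card_chooseBasisIndex,
      fractionalIdeal_rank]
  classical
  let e' := Fintype.equivOfCardEq hcard
  have h1 : Algebra.discr ℚ ((basisOfFractionalIdeal F I).reindex e) =
      Algebra.discr ℚ ((basisOfFractionalIdeal F I).reindex e'.symm) := by
    have := Algebra.discr_reindex ℚ ((basisOfFractionalIdeal F I).reindex e) (e'.trans e).symm
    rw [← this]
    congr 1
    ext i
    simp
  have h2 := Algebra.discr_of_matrix_vecMul (A := ℚ) (integralBasis F)
    ((integralBasis F).toMatrix ((basisOfFractionalIdeal F I).reindex e'.symm))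
  rw [Basis.toMatrix_map_vecMul, ← Basis.det_apply, ← sq_abs, det_basisOfFractionalIdeal_eq_absNorm,
    ← coe_discr] at h2
  rw [h1, h2, idealNorm_apply]
  push_cast
  ring

/-- A `ℤ`-basis of a fractional ideal, indexed by the embeddings of `F`. -/
theorem exists_integral_basis [DecidableEq (F →+* ℂ)] (I : IdealGroup F) :
    ∃ ω : Basis (F →+* ℂ) ℚ F, (∀ x, x ∈ Submodule.span ℤ (Set.range ω) ↔ x ∈ I.1) ∧
      ‖(embMatrix ω).det‖ ^ 2 = |(discr F : ℝ)| * idealNorm I ^ 2 := by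
  have hcard : Fintype.card (Free.ChooseBasisIndex ℤ I) = Fintype.card (F →+* ℂ) := by
    rw [← finrank_eq_card_chooseBasisIndex, fractionalIdeal_rank, RingOfIntegers.rank,
      Embeddings.card]
  let e := Fintype.equivOfCardEq hcard
  refine ⟨(basisOfFractionalIdeal F I).reindex e, fun x => ?_, ?_⟩
  · rw [Basis.range_reindex, mem_span_basisOfFractionalIdeal]
    rfl
  · have h := discr_basisOfFractionalIdeal I e
    rw [← norm_pow, embMatrix_det_sq, ← Complex.ofReal_ratCast, h, Complex.norm_real,
      Real.norm_eq_abs, abs_mul, abs_of_nonneg (sq_nonneg (idealNorm I))]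

/-- The different ideal as a fractional ideal. -/
def different (F : Type*) [Field F] [NumberField F] : IdealGroup F :=
  (Units.mk0 (FractionalIdeal.dual ℤ ℚ (1 : FractionalIdeal (nonZeroDivisors (𝓞 F)) F))
    (FractionalIdeal.dual_ne_zero ℤ ℚ one_ne_zero))⁻¹

theorem idealNorm_different : idealNorm (different F) = |(discr F : ℝ)| := by
  rw [idealNorm_apply, different, Units.val_inv_eq_inv_val, Units.val_mk0,
    ← coeIdeal_differentIdeal ℤ ℚ F (𝓞 F), FractionalIdeal.coeIdeal_absNorm, absNorm_differentIdeal F (𝓞 F),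
    Nat.cast_natAbs]
  push_cast
  rfl

/-- Poisson summation dualizes with respect to the trace form, which differs from `𝓞 F`-duality by
the inverse different. This is how the different enters the functional equation. -/
theorem mem_span_traceDual {I : IdealGroup F} [DecidableEq (F →+* ℂ)] {ω : Basis (F →+* ℂ) ℚ F}
    (h : ∀ x, x ∈ Submodule.span ℤ (Set.range ω) ↔ x ∈ I.1) (x : F) :
    x ∈ Submodule.span ℤ (Set.range ω.traceDual) ↔ x ∈ ((different F)⁻¹ * I⁻¹).1 := by
  have h1 : ((different F)⁻¹ * I⁻¹).1 = FractionalIdeal.dual ℤ ℚ I.1 := by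
    rw [FractionalIdeal.dual_eq_mul_inv, different, inv_inv]
    simp
  have h2 := Submodule.traceDual_span_of_basis ℤ (K := ℚ) (I.1 : Submodule (𝓞 F) F) ω
    (by ext x; rw [h]; rfl)
  rw [h1, ← h2, ← FractionalIdeal.mem_coe, FractionalIdeal.coe_dual ℤ ℚ I.ne_zero]
  rfl

end IntegralBases

/-! ### Sesquilinear expansion of the metrics -/

section Pairing

variable {F V : Type*} [Field F] [AddCommGroup V] [Module F V] {σ : F →+* ℂ}
  (c : HermitianMetric σ V)

theorem pairing_conj (x y : V) : starRingEnd ℂ (c.pairing y x) = c.pairing x y :=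
  letI := σ.toAlgebra
  c.conj_inner_symm _ _

theorem pairing_add_left (x y z : V) : c.pairing (x + y) z = c.pairing x z + c.pairing y z := by
  let := σ.toAlgebra
  refine Eq.trans (congrArg (fun w => c.inner w (1 ⊗ₜ z)) (TensorProduct.tmul_add _ _ _)) ?_
  exact c.add_left _ _ _

theorem pairing_sum_sum {ι : Type*} (s : Finset ι) (a : ι → F) (x : ι → V) :
    c.pairing (∑ i ∈ s, a i • x i) (∑ i ∈ s, a i • x i) =
      ∑ i ∈ s, ∑ j ∈ s, starRingEnd ℂ (σ (a i)) * σ (a j) * c.pairing (x i) (x j) := by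
  have h0 : ∀ z, c.pairing 0 z = 0 := fun z => by
    have := pairing_add_left c 0 0 z
    rw [add_zero] at this
    simpa using this
  have hl : ∀ (u : ι → V) z, c.pairing (∑ i ∈ s, u i) z = ∑ i ∈ s, c.pairing (u i) z := fun u z => by
    classical
    induction s using Finset.induction_on with
    | empty => simp [h0]
    | insert j s hj ih => rw [Finset.sum_insert hj, Finset.sum_insert hj, pairing_add_left, ih]
  have hr : ∀ (u : ι → V) z, c.pairing z (∑ i ∈ s, u i) = ∑ i ∈ s, c.pairing z (u i) := fun u z => by
    rw [← pairing_conj, hl, map_sum]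
    simp only [pairing_conj]
  simp only [hl, hr, pairing_smul_smul]

end Pairing

/-! ### Theta series of a twisted bundle -/

section Theta

open NumberField

variable {F V : Type*} [Field F] [NumberField F] [AddCommGroup V] [Module F V]
  [Module (𝓞 F) V] [IsScalarTower (𝓞 F) F V] (E : ArakelovBundle F V)

/-- The positive definite quadratic form attached to a point of `ℝ ^ (infinite places)`. -/
def energy (t : InfinitePlace F → ℝ) (x : V) : ℝ :=
  ∑ v : InfinitePlace F, v.mult * Real.exp (-(2 / v.mult) * t v) * E.infNorm v x ^ 2

/-- The Gaussian weight of a vector. -/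
def gauss (t : InfinitePlace F → ℝ) (x : V) : ℝ := Real.exp (-Real.pi * energy E t x)

/-- The vectors `x` with `c x ⊆ Γ`. -/
def twist (c : IdealGroup F) : Set V := {x | ∀ a ∈ c.1, a • x ∈ E.lattice}

/-- The theta series of a bundle twisted by an Arakelov divisor. -/
def theta (c : IdealGroup F) (t : InfinitePlace F → ℝ) : ℝ := ∑' x : twist E c, gauss E t x

/-- The weight of an embedding. -/
def embWeight (t : InfinitePlace F → ℝ) (σ : F →+* ℂ) : ℝ :=
  Real.exp (-(2 / (InfinitePlace.mk σ).mult) * t (InfinitePlace.mk σ))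

/-- The embedding chosen for a place may be the conjugate of `σ`; real type makes the norm
insensitive to this. -/
theorem infNorm_mk_sq (σ : F →+* ℂ) (x : V) :
    E.infNorm (InfinitePlace.mk σ) x ^ 2 = ((E.metric σ).pairing x x).re := by
  rw [infNorm_sq]
  rcases InfinitePlace.embedding_mk_eq σ with h | h
  · rw [h]
  · rw [h, ← E.real_type, Complex.conj_re]

theorem energy_eq_sum (t : InfinitePlace F → ℝ) (x : V) :
    energy E t x = ∑ σ, embWeight t σ * ((E.metric σ).pairing x x).re := by
  simp only [← infNorm_mk_sq, embWeight]
  rw [sum_comp_mk fun v => Real.exp (-(2 / v.mult) * t v) * E.infNorm v x ^ 2]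
  simp only [energy, nsmul_eq_mul, mul_assoc]

/-- The Gram matrix of a family with respect to the energy. -/
def energyMatrix {κ : Type*} (t : InfinitePlace F → ℝ) (e : κ → V) : Matrix κ κ ℝ :=
  Matrix.of fun p q => ∑ σ, embWeight t σ * ((E.metric σ).pairing (e p) (e q)).re

/-- Conjugation permutes the embeddings and, by real type, the terms, so the complex sum is already
real. The determinant and inverse of the real matrix can therefore be computed over `ℂ`. -/
theorem energyMatrix_map {κ : Type*} (t : InfinitePlace F → ℝ) (e : κ → V) (p q : κ) :
    (energyMatrix E t e p q : ℂ) = ∑ σ, embWeight t σ * (E.metric σ).pairing (e p) (e q) := by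
  set S := ∑ σ, (embWeight t σ : ℂ) * (E.metric σ).pairing (e p) (e q) with hS
  have hre : energyMatrix E t e p q = S.re := by
    simp [energyMatrix, hS]
  have hconj : starRingEnd ℂ S = S := by
    rw [hS, map_sum]
    refine Fintype.sum_equiv (Equiv.ofBijective _
      (ComplexEmbedding.involutive_conjugate F).bijective) _ _ fun σ => ?_
    rw [map_mul, Complex.conj_ofReal, E.real_type]
    have h : InfinitePlace.mk (ComplexEmbedding.conjugate σ) = InfinitePlace.mk σ :=
      InfinitePlace.mk_conjugate_eq σ
    change _ = (embWeight t (ComplexEmbedding.conjugate σ) : ℂ) * _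
    simp only [embWeight, h]
    rfl
  rw [hre, Complex.conj_eq_iff_re.1 hconj]

theorem energy_sum_smul {κ : Type*} [Fintype κ] (t : InfinitePlace F → ℝ) (e : κ → V) (z : κ → ℤ) :
    energy E t (∑ p, (z p : F) • e p) = intVec z ⬝ᵥ (energyMatrix E t e).mulVec (intVec z) := by
  rw [energy_eq_sum]
  simp only [pairing_sum_sum, dotProduct, Matrix.mulVec, energyMatrix, Matrix.of_apply, intVec,
    map_intCast, Finset.mul_sum, Finset.sum_mul, Complex.re_sum]
  rw [Finset.sum_comm]
  refine Finset.sum_congr rfl fun p _ => ?_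
  rw [Finset.sum_comm]
  refine Finset.sum_congr rfl fun q _ => Finset.sum_congr rfl fun σ _ => ?_
  have : ((z p : ℂ) * (z q : ℂ) * (E.metric σ).pairing (e p) (e q)).re =
      z p * z q * ((E.metric σ).pairing (e p) (e q)).re := by
    rw [← Complex.re_ofReal_mul]; push_cast; rfl
  rw [this]
  ring

end Theta

/-! ### Positivity of block diagonal and real matrices -/

section PosDef

open scoped ComplexOrder

theorem blockDiagonal_posDef {m o : Type*} [Fintype m] [Fintype o] [DecidableEq o]
    {A : o → Matrix m m ℂ} (hA : ∀ k, (A k).PosDef) : (Matrix.blockDiagonal A).PosDef := by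
  classical
  refine Matrix.PosDef.of_dotProduct_mulVec_pos ?_ fun x hx => ?_
  · rw [Matrix.IsHermitian, Matrix.blockDiagonal_conjTranspose]
    exact congrArg _ (funext fun k => (hA k).isHermitian)
  · have h : star x ⬝ᵥ (Matrix.blockDiagonal A).mulVec x =
        ∑ k, star (fun i => x (i, k)) ⬝ᵥ (A k).mulVec fun i => x (i, k) := by
      simp only [dotProduct, Matrix.mulVec, Fintype.sum_prod_type, Matrix.blockDiagonal_apply,
        Pi.star_apply]
      rw [Finset.sum_comm]
      simp
    rw [h]
    obtain ⟨⟨i, k⟩, hik⟩ := Function.ne_iff.1 hx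
    refine Finset.sum_pos' (fun k _ => (hA k).posSemidef.dotProduct_mulVec_nonneg _)
      ⟨k, Finset.mem_univ _, (hA k).dotProduct_mulVec_pos fun h => hik (congrFun h i)⟩

theorem posDef_of_map_ofReal {m : Type*} [Fintype m] {A : Matrix m m ℝ}
    (hA : (A.map ((↑) : ℝ → ℂ)).PosDef) : A.PosDef := by
  refine Matrix.PosDef.of_dotProduct_mulVec_pos ?_ fun x hx => ?_
  · ext i j
    have := congrFun (congrFun hA.isHermitian i) j
    simpa using this
  · have h := hA.dotProduct_mulVec_pos (x := fun i => (x i : ℂ))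
      fun h => hx (funext fun i => by simpa using congrFun h i)
    have h2 : (star fun i => (x i : ℂ)) ⬝ᵥ (A.map ((↑) : ℝ → ℂ)).mulVec (fun i => (x i : ℂ)) =
        ((star x ⬝ᵥ A.mulVec x : ℝ) : ℂ) := by
      simp [dotProduct, Matrix.mulVec]
    rw [h2] at h
    exact_mod_cast h

end PosDef

/-! ### Integral coordinates on the twisted lattice and its covolume -/

section Frame

open NumberField
open scoped ComplexOrder

variable {F V : Type*} [Field F] [NumberField F] [AddCommGroup V] [Module F V]
  [Module (𝓞 F) V] [IsScalarTower (𝓞 F) F V] (E : ArakelovBundle F V)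
  {ι : Type*}

/-- The products of the members of `ℚ`-bases of `F` with those of a basis of `V`. -/
def frame (b : Basis ι F V) (ω : ι → Basis (F →+* ℂ) ℚ F) (p : (F →+* ℂ) × ι) : V :=
  ω p.2 p.1 • b p.2

theorem mem_inv_mul {c 𝔞 : IdealGroup F} {y : F} :
    y ∈ (c⁻¹ * 𝔞).1 ↔ ∀ a ∈ c.1, a * y ∈ 𝔞.1 := by
  rw [mul_comm, Units.val_mul, Units.val_inv_eq_inv_val, ← div_eq_mul_inv,
    FractionalIdeal.mem_div_iff_of_ne_zero c.ne_zero]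
  simp only [mul_comm y]

variable {E} in
theorem mem_twist_iff {b : Basis ι F V} {𝔞 : ι → IdealGroup F} (h : IsPseudoBasis E.lattice b 𝔞)
    {c : IdealGroup F} {x : V} : x ∈ twist E c ↔ ∀ i, b.repr x i ∈ (c⁻¹ * 𝔞 i).1 := by
  simp only [twist, Set.mem_ofPred_eq, h _, mem_inv_mul, map_smul, Finsupp.smul_apply, smul_eq_mul]
  exact ⟨fun h i a ha => h a ha i, fun h a ha i => h i a ha⟩

variable [Fintype ι]

theorem repr_frame (b : Basis ι F V) (ω : ι → Basis (F →+* ℂ) ℚ F) (z : (F →+* ℂ) × ι → ℤ) (i : ι) :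
    b.repr (∑ p, (z p : F) • frame b ω p) i = ∑ k, z (k, i) • ω i k := by
  classical
  have : ∑ p, (z p : F) • frame b ω p = ∑ i, (∑ k, z (k, i) • ω i k) • b i := by
    rw [Fintype.sum_prod_type, Finset.sum_comm]
    simp only [frame, Finset.sum_smul, smul_smul, zsmul_eq_mul]
  rw [this, b.repr_sum_self]

/-- The coordinates of the vectors of a twisted lattice. -/
def twistEquiv {b : Basis ι F V} {𝔞 : ι → IdealGroup F} (h : IsPseudoBasis E.lattice b 𝔞)
    {c : IdealGroup F} {ω : ι → Basis (F →+* ℂ) ℚ F}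
    (hω : ∀ i x, x ∈ Submodule.span ℤ (Set.range (ω i)) ↔ x ∈ (c⁻¹ * 𝔞 i).1) :
    ((F →+* ℂ) × ι → ℤ) ≃ twist E c :=
  Equiv.ofBijective (fun z => ⟨∑ p, (z p : F) • frame b ω p, by
      rw [mem_twist_iff h]
      intro i
      rw [repr_frame, ← hω, Submodule.mem_span_range_iff_exists_fun]
      exact ⟨_, rfl⟩⟩)
    ⟨fun z z' hz => by
      have h1 := congrArg Subtype.val hz
      funext ⟨k, i⟩
      have h2 := congrArg (fun x => b.repr x i) h1
      simp only [repr_frame, ← Int.cast_smul_eq_zsmul ℚ] at h2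
      have h3 := congrArg (fun x => (ω i).repr x k) h2
      simp only [(ω i).repr_sum_self] at h3
      exact_mod_cast h3,
    fun ⟨x, hx⟩ => by
      rw [mem_twist_iff h] at hx
      simp only [← hω, Submodule.mem_span_range_iff_exists_fun] at hx
      choose z hz using hx
      refine ⟨fun p => z p.2 p.1, Subtype.ext (b.repr.injective (Finsupp.ext fun i => ?_))⟩
      rw [repr_frame, hz]⟩

theorem energy_twistEquiv {b : Basis ι F V} {𝔞 : ι → IdealGroup F} (h : IsPseudoBasis E.lattice b 𝔞)
    {c : IdealGroup F} {ω : ι → Basis (F →+* ℂ) ℚ F}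
    (hω : ∀ i x, x ∈ Submodule.span ℤ (Set.range (ω i)) ↔ x ∈ (c⁻¹ * 𝔞 i).1)
    (t : InfinitePlace F → ℝ) (z : (F →+* ℂ) × ι → ℤ) :
    energy E t (twistEquiv E h hω z) =
      intVec z ⬝ᵥ (energyMatrix E t (frame b ω)).mulVec (intVec z) :=
  energy_sum_smul E t _ z

variable [DecidableEq (F →+* ℂ)] [DecidableEq ι]

/-- The block matrix of all embeddings of `ℚ`-bases of `F`. -/
def frameMatrix (ω : ι → Basis (F →+* ℂ) ℚ F) :
    Matrix ((F →+* ℂ) × ι) ((F →+* ℂ) × ι) ℂ :=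
  Matrix.blockDiagonal fun i => embMatrix (ω i)

/-- The block matrix of the weighted metrics. -/
def metricMatrix (t : InfinitePlace F → ℝ) (b : ι → V) :
    Matrix ((F →+* ℂ) × ι) ((F →+* ℂ) × ι) ℂ :=
  (Matrix.blockDiagonal fun σ => (embWeight t σ : ℂ) • gramAt E b σ).submatrix
    (Equiv.prodComm _ _) (Equiv.prodComm _ _)

/-- Separates arithmetic from metrics: the outer factors have one block per basis vector of `V`, the
middle one has one block per embedding. Positivity, determinant and inverse are then found factor by
factor. -/
theorem energyMatrix_frame (t : InfinitePlace F → ℝ) (b : Basis ι F V)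
    (ω : ι → Basis (F →+* ℂ) ℚ F) :
    (energyMatrix E t (frame b ω)).map ((↑) : ℝ → ℂ) =
      (frameMatrix ω).conjTranspose * metricMatrix E t b * frameMatrix ω := by
  ext ⟨k, i⟩ ⟨l, j⟩
  rw [Matrix.map_apply, energyMatrix_map]
  simp only [frame, pairing_smul_smul, Matrix.mul_apply, Fintype.sum_prod_type, frameMatrix,
    metricMatrix, Matrix.conjTranspose_apply, Matrix.blockDiagonal_apply, Matrix.submatrix_apply,
    Equiv.prodComm_apply, Prod.swap, embMatrix, gramAt, Matrix.of_apply, Matrix.smul_apply]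
  refine Finset.sum_congr rfl fun σ _ => ?_
  simp [apply_ite star, ite_mul, mul_ite]
  ring

theorem frameMatrix_det_ne_zero (ω : ι → Basis (F →+* ℂ) ℚ F) : (frameMatrix ω).det ≠ 0 := by
  rw [frameMatrix, Matrix.det_blockDiagonal]
  refine Finset.prod_ne_zero_iff.2 fun i _ h => ?_
  have h1 := embMatrix_det_sq (ω i)
  rw [h] at h1
  have h2 := Algebra.discr_not_zero_of_basis ℚ (ω i)
  rw [zero_pow two_ne_zero] at h1
  exact h2 (by exact_mod_cast h1.symm)

theorem metricMatrix_det (t : InfinitePlace F → ℝ) (b : ι → V) :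
    (metricMatrix E t b).det =
      ∏ σ, ((embWeight t σ : ℂ) ^ Fintype.card ι * (gramAt E b σ).det) := by
  rw [metricMatrix, Matrix.det_submatrix_equiv_self, Matrix.det_blockDiagonal]
  simp only [Matrix.det_smul]

theorem embWeight_pos (t : InfinitePlace F → ℝ) (σ : F →+* ℂ) : 0 < embWeight t σ :=
  Real.exp_pos _

theorem metricMatrix_posDef (t : InfinitePlace F → ℝ) {b : ι → V}
    (hb : ∀ σ, (gramAt E b σ).PosDef) : (metricMatrix E t b).PosDef := by
  refine Matrix.PosDef.submatrix (blockDiagonal_posDef fun σ => (hb σ).smul ?_)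
    (Equiv.prodComm _ _).injective
  exact_mod_cast embWeight_pos t σ

theorem energyMatrix_posDef (t : InfinitePlace F → ℝ) {b : Basis ι F V}
    (hb : ∀ σ, (gramAt E b σ).PosDef) (ω : ι → Basis (F →+* ℂ) ℚ F) :
    (energyMatrix E t (frame b ω)).PosDef := by
  refine posDef_of_map_ofReal ?_
  rw [energyMatrix_frame]
  refine (metricMatrix_posDef E t hb).conjTranspose_mul_mul_same ?_
  rw [Matrix.mulVec_injective_iff_isUnit, Matrix.isUnit_iff_isUnit_det]
  exact (frameMatrix_det_ne_zero ω).isUnit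

theorem det_gramAt_re (b : ι → V) (σ : F →+* ℂ) :
    (gramAt E b σ).det.re = (gramAt E b (InfinitePlace.mk σ).embedding).det.re := by
  rcases InfinitePlace.embedding_mk_eq σ with h | h
  · rw [h]
  · rw [h]
    have : gramAt E b (ComplexEmbedding.conjugate σ) = (gramAt E b σ).map (starRingEnd ℂ) := by
      ext i j
      exact (E.real_type σ _ _).symm
    rw [this]
    have h2 := (RingHom.map_det (starRingEnd ℂ) (gramAt E b σ)).symm
    rw [RingHom.mapMatrix_apply] at h2
    rw [h2, Complex.conj_re]

theorem prod_embWeight (t : InfinitePlace F → ℝ) :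
    ∏ σ, embWeight t σ = Real.exp (-(∑ v, t v)) ^ 2 := by
  rw [← Real.exp_nat_mul]
  unfold embWeight
  rw [prod_comp_mk fun v : InfinitePlace F => Real.exp (-(2 / v.mult) * t v)]
  simp only [← Real.exp_nat_mul, ← Real.exp_sum]
  congr 1
  rw [Nat.cast_ofNat, mul_neg, Finset.mul_sum, ← Finset.sum_neg_distrib]
  refine Finset.sum_congr rfl fun v _ => ?_
  have : (v.mult : ℝ) ≠ 0 := by exact_mod_cast v.mult_pos.ne'
  field_simp

/-- The frame factors contribute the discriminant and the ideal norms, the metric factor the weights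
and the Gram determinants. A place `v` occurs for `n_v` embeddings, which matches the exponents in
`pseudoVolume`. -/
theorem sqrt_det_energyMatrix (t : InfinitePlace F → ℝ) {b : Basis ι F V} {𝔞 : ι → IdealGroup F}
    (hb : ∀ σ, (gramAt E b σ).PosDef) {ω : ι → Basis (F →+* ℂ) ℚ F}
    (hω : ∀ i, ‖(embMatrix (ω i)).det‖ ^ 2 = |(discr F : ℝ)| * idealNorm (𝔞 i) ^ 2) :
    √(energyMatrix E t (frame b ω)).det =
      √|(discr F : ℝ)| ^ Fintype.card ι * Real.exp (-(∑ v, t v)) ^ Fintype.card ι *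
        pseudoVolume E b 𝔞 := by
  have hdet : ((energyMatrix E t (frame b ω)).det : ℂ) =
      ((‖(frameMatrix ω).det‖ ^ 2 *
        ∏ σ, (embWeight t σ ^ Fintype.card ι * (gramAt E b σ).det.re) : ℝ) : ℂ) := by
    have h1 := RingHom.map_det Complex.ofRealHom (energyMatrix E t (frame b ω))
    have h2 : Complex.ofRealHom.mapMatrix (energyMatrix E t (frame b ω)) = _ :=
      energyMatrix_frame E t b ω
    rw [h2, Matrix.det_mul, Matrix.det_mul, Matrix.det_conjTranspose, metricMatrix_det] at h1
    refine h1.trans ?_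
    push_cast
    rw [mul_right_comm, ← Complex.conj_mul']
    congr 1
    refine Finset.prod_congr rfl fun σ _ => ?_
    congr 1
    exact Complex.eq_re_of_ofReal_le (r := 0) (hb σ).det_pos.le
  have hdet' := Complex.ofReal_injective hdet
  have hsq : (energyMatrix E t (frame b ω)).det =
      (√|(discr F : ℝ)| ^ Fintype.card ι * Real.exp (-(∑ v, t v)) ^ Fintype.card ι *
        pseudoVolume E b 𝔞) ^ 2 := by
    rw [hdet', frameMatrix, Matrix.det_blockDiagonal, norm_prod, ← Finset.prod_pow,
      Finset.prod_congr rfl fun i _ => hω i, Finset.prod_mul_distrib, Finset.prod_const,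
      Finset.card_univ, Finset.prod_mul_distrib, Finset.prod_pow Finset.univ _ (embWeight t), prod_embWeight,
      Finset.prod_congr rfl fun σ _ => det_gramAt_re E b σ,
      prod_comp_mk fun v : InfinitePlace F => (gramAt E b v.embedding).det.re, pseudoVolume,
      map_prod]
    have : ∀ v : InfinitePlace F, (√(gramAt E b v.embedding).det.re ^ v.mult) ^ 2 =
        (gramAt E b v.embedding).det.re ^ v.mult := fun v => by
      rw [← pow_mul, mul_comm, pow_mul,
        Real.sq_sqrt (Complex.pos_iff.1 (hb v.embedding).det_pos).1.le]
    have h2 := Real.sq_sqrt (abs_nonneg (discr F : ℝ))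
    simp only [mul_pow, ← Finset.prod_pow, this]
    conv_lhs => rw [← h2]
    ring
  rw [hsq, Real.sqrt_sq]
  unfold pseudoVolume
  have := idealNorm_pos (∏ i, 𝔞 i)
  positivity

end Frame

/-! ### Functional equation of theta: Riemann-Roch by Poisson summation -/

section FunctionalEquation

open NumberField
open scoped ComplexOrder

variable {F V : Type*} [Field F] [NumberField F] [AddCommGroup V] [Module F V]
  [Module (𝓞 F) V] [IsScalarTower (𝓞 F) F V] [FiniteDimensional F V] (E : ArakelovBundle F V)

theorem energyMatrix_transpose {κ : Type*} (t : InfinitePlace F → ℝ) (e : κ → V) :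
    (energyMatrix E t e).transpose = energyMatrix E t e := by
  ext p q
  simp only [energyMatrix, Matrix.transpose_apply, Matrix.of_apply]
  refine Finset.sum_congr rfl fun σ _ => ?_
  rw [← pairing_conj, Complex.conj_re]

theorem embWeight_neg_mul (t : InfinitePlace F → ℝ) (σ : F →+* ℂ) :
    embWeight t σ * embWeight (-t) σ = 1 := by
  rw [embWeight, embWeight, ← Real.exp_add, Pi.neg_apply]
  simp

theorem metricMatrix_dual [DecidableEq (F →+* ℂ)] (t : InfinitePlace F → ℝ)
    (b : Basis (Fin (finrank F V)) F V) :
    metricMatrix E t b * (metricMatrix E.dual (-t) b.dualBasis).transpose = 1 := by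
  rw [metricMatrix, metricMatrix, Matrix.transpose_submatrix, Matrix.submatrix_mul_equiv,
    Matrix.blockDiagonal_transpose, ← Matrix.blockDiagonal_mul]
  have : ∀ σ, (embWeight t σ : ℂ) • gramAt E b σ *
      ((embWeight (-t) σ : ℂ) • gramAt E.dual b.dualBasis σ).transpose = 1 := fun σ => by
    rw [gramAt_dual, Matrix.transpose_smul, Matrix.transpose_transpose, Matrix.smul_mul,
      Matrix.mul_smul, smul_smul, Matrix.mul_nonsing_inv _
        (gramAt_posDef E b σ).det_pos.ne'.isUnit]
    rw [← Complex.ofReal_mul, embWeight_neg_mul, Complex.ofReal_one, one_smul]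
  simp only [this]
  rw [← Pi.one_def, Matrix.blockDiagonal_one, Matrix.submatrix_one_equiv]

theorem frameMatrix_traceDual {ι : Type*} [Fintype ι] [DecidableEq ι] [DecidableEq (F →+* ℂ)]
    (ω : ι → Basis (F →+* ℂ) ℚ F) :
    (frameMatrix fun i => (ω i).traceDual).transpose * frameMatrix ω = 1 := by
  rw [frameMatrix, frameMatrix, Matrix.blockDiagonal_transpose, ← Matrix.blockDiagonal_mul]
  have : ∀ i, (embMatrix (ω i).traceDual).transpose * embMatrix (ω i) = 1 := fun i => by
    rw [embMatrix_transpose_mul]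
    ext k l
    have := (ω i).trace_traceDual_mul k l
    rw [Matrix.of_apply, this, Matrix.one_apply]
    by_cases hkl : l = k
    · simp [hkl]
    · simp [hkl, Ne.symm hkl]
  simp only [this]
  rw [← Pi.one_def, Matrix.blockDiagonal_one]

/-- Both factors of `energyMatrix_frame` are inverted up to transposition: the frame matrix by the
trace-dual frame, the metric matrix by the dual metric at `-t`. Since the energy matrix is
symmetric, transposing the dual one costs nothing and makes the factors cancel. -/
theorem energyMatrix_dual [DecidableEq (F →+* ℂ)] (t : InfinitePlace F → ℝ)
    (b : Basis (Fin (finrank F V)) F V) (ω : Fin (finrank F V) → Basis (F →+* ℂ) ℚ F) :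
    (energyMatrix E t (frame b ω))⁻¹ =
      energyMatrix E.dual (-t) (frame b.dualBasis fun i => (ω i).traceDual) := by
  refine Matrix.inv_eq_right_inv ?_
  refine Matrix.map_injective Complex.ofReal_injective ?_
  beta_reduce
  have hmul : ∀ A B : Matrix ((F →+* ℂ) × Fin (finrank F V)) ((F →+* ℂ) × Fin (finrank F V)) ℝ,
      (A * B).map ((↑) : ℝ → ℂ) = A.map (↑) * B.map (↑) := fun A B =>
    Matrix.map_mul (f := Complex.ofRealHom)
  rw [← energyMatrix_transpose E.dual, hmul, Matrix.transpose_map, energyMatrix_frame,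
    energyMatrix_frame, Matrix.map_one _ Complex.ofReal_zero Complex.ofReal_one]
  set M := frameMatrix ω
  set M' := frameMatrix fun i => (ω i).traceDual
  have h1 : M'.transpose * M = 1 := frameMatrix_traceDual ω
  have h2 : M * M'.transpose = 1 := mul_eq_one_comm.1 h1
  have h3 : M.conjTranspose * M'.conjTranspose.transpose = 1 := by
    have := congrArg Matrix.conjTranspose h1
    rw [Matrix.conjTranspose_mul, Matrix.conjTranspose_one] at this
    exact this
  rw [Matrix.transpose_mul, Matrix.transpose_mul, Matrix.mul_assoc, ← Matrix.mul_assoc M, h2,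
    Matrix.one_mul, Matrix.mul_assoc, ← Matrix.mul_assoc (metricMatrix E t b), metricMatrix_dual,
    Matrix.one_mul, h3]

/-- The functional equation of the theta series. -/
theorem theta_eq_theta_dual (c : IdealGroup F) (t : InfinitePlace F → ℝ) :
    theta E c t = (√|(discr F : ℝ)| ^ finrank F V)⁻¹ * E.norm * idealNorm c ^ finrank F V *
      Real.exp (∑ v, t v) ^ finrank F V * theta E.dual (c⁻¹ * different F) (-t) := by
  classical
  obtain ⟨b, 𝔞, h⟩ := exists_pseudoBasis E
  choose ω hω hdet using fun i => exists_integral_basis (c⁻¹ * 𝔞 i)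
  -- The twisted lattice has summands `c⁻¹ 𝔞ᵢ`. Their trace duals are `c 𝔡⁻¹ 𝔞ᵢ⁻¹`, with `𝔡` the
  -- different, and these are the summands of the dual lattice twisted by `c⁻¹ 𝔡`.
  have hω' : ∀ i x, x ∈ Submodule.span ℤ (Set.range (ω i).traceDual) ↔
      x ∈ ((c⁻¹ * different F)⁻¹ * (𝔞 i)⁻¹).1 := fun i x => by
    rw [mem_span_traceDual (hω i)]
    simp only [mul_inv, inv_inv]
    rw [← mul_assoc, mul_comm (different F)⁻¹ c]
  have hA := energyMatrix_posDef E t (gramAt_posDef E b) ω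
  have h1 : theta E c t = ∑' z, Real.exp (-Real.pi *
      (intVec z ⬝ᵥ (energyMatrix E t (frame b ω)).mulVec (intVec z))) := by
    rw [theta, ← (twistEquiv E h hω).tsum_eq]
    simp only [gauss, energy_twistEquiv]
  have h2 : theta E.dual (c⁻¹ * different F) (-t) = ∑' z, Real.exp (-Real.pi *
      (intVec z ⬝ᵥ (energyMatrix E t (frame b ω))⁻¹.mulVec (intVec z))) := by
    rw [theta, ← (twistEquiv E.dual h.dual (ω := fun i => (ω i).traceDual) hω').tsum_eq,
      energyMatrix_dual]
    refine tsum_congr fun z => ?_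
    rw [gauss, energy_twistEquiv E.dual h.dual (ω := fun i => (ω i).traceDual) hω']
  rw [h1, h2, tsum_exp_neg_quadratic hA, sqrt_det_energyMatrix E t (gramAt_posDef E b) hdet,
    norm_eq_pseudoVolume E h, Fintype.card_fin]
  congr 1
  have hp : pseudoVolume E b (fun i => c⁻¹ * 𝔞 i) =
      (idealNorm c ^ finrank F V)⁻¹ * pseudoVolume E b 𝔞 := by
    rw [pseudoVolume, pseudoVolume, Finset.prod_mul_distrib, Finset.prod_const, Finset.card_univ,
      Fintype.card_fin, map_mul, map_pow, idealNorm_inv, inv_pow]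
    ring
  rw [hp, Real.exp_neg, mul_inv, mul_inv, mul_inv, inv_pow, inv_inv, inv_inv]
  ring

end FunctionalEquation

/-! ### Invariance, continuity and decay of theta -/

section ThetaBounds

open NumberField

variable {F V : Type*} [Field F] [NumberField F] [AddCommGroup V] [Module F V]
  [Module (𝓞 F) V] [IsScalarTower (𝓞 F) F V] (E : ArakelovBundle F V)

/-- The logarithmic absolute values of a unit of `F`. -/
def absShift (a : Fˣ) (v : InfinitePlace F) : ℝ := v.mult * Real.log (v (a : F))

theorem sum_absShift (a : Fˣ) :
    ∑ v, absShift a v = Real.log (idealNorm (toPrincipalIdeal (𝓞 F) F a)) := by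
  rw [idealNorm_principal, Real.log_prod]
  · simp only [absShift, Real.log_pow]
  · exact fun v _ => pow_ne_zero _ ((map_ne_zero v).2 a.ne_zero)

theorem mult_cast_pos (v : InfinitePlace F) : (0 : ℝ) < v.mult := by exact_mod_cast v.mult_pos

/-- The exponent `-2 / n_v` is normalized for this: shifting `t v` by `n_v log |a|_v` divides the
weight by `|a|_v²`, which the scaling of the norm restores. -/
theorem energy_add_absShift (t : InfinitePlace F → ℝ) (a : Fˣ) (x : V) :
    energy E (t + absShift a) ((a : F) • x) = energy E t x := by
  refine Finset.sum_congr rfl fun v _ => ?_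
  have h0 : 0 < v (a : F) := InfinitePlace.pos_iff.2 a.ne_zero
  have h1 : -(2 / (v.mult : ℝ)) * (t + absShift a) v =
      -(2 / (v.mult : ℝ)) * t v + -(2 * Real.log (v (a : F))) := by
    have := (mult_cast_pos v).ne'
    rw [Pi.add_apply, absShift]
    field_simp
    ring
  have h2 : Real.exp (-(2 * Real.log (v (a : F)))) = (v (a : F) ^ 2)⁻¹ := by
    rw [Real.exp_neg, show (2 : ℝ) = ((2 : ℕ) : ℝ) by norm_num, ← Real.log_pow,
      Real.exp_log (by positivity)]
  rw [infNorm_smul, h1, Real.exp_add, h2]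
  field_simp

theorem gauss_add_absShift (t : InfinitePlace F → ℝ) (a : Fˣ) (x : V) :
    gauss E (t + absShift a) ((a : F) • x) = gauss E t x := by
  rw [gauss, gauss, energy_add_absShift]

theorem mem_twist_mul_principal {c : IdealGroup F} {a : Fˣ} {x : V} :
    x ∈ twist E (c * toPrincipalIdeal (𝓞 F) F a) ↔ (a : F) • x ∈ twist E c := by
  constructor
  · intro h b hb
    rw [smul_smul]
    refine h _ (mem_mul_principal.2 ?_)
    rwa [mul_comm b, inv_mul_cancel_left₀ a.ne_zero]
  · intro h b hb
    have := h _ (mem_mul_principal.1 hb)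
    rwa [smul_smul, mul_right_comm, inv_mul_cancel₀ a.ne_zero, one_mul] at this

/-- Multiplication by `a` carries one lattice onto the other. So theta depends only on the class of
the Arakelov divisor. -/
theorem theta_mul_principal (c : IdealGroup F) (a : Fˣ) (t : InfinitePlace F → ℝ) :
    theta E (c * toPrincipalIdeal (𝓞 F) F a) t = theta E c (t + absShift a) := by
  let e : twist E (c * toPrincipalIdeal (𝓞 F) F a) ≃ twist E c :=
    (MulAction.toPerm a : Equiv.Perm V).subtypeEquiv fun x => by
      rw [mem_twist_mul_principal]; rfl
  rw [theta, theta, ← e.tsum_eq]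
  exact tsum_congr fun x => (gauss_add_absShift E t a _).symm

theorem energy_sub (t : InfinitePlace F → ℝ) (s : ℝ) (x : V) :
    energy E (fun v => t v - v.mult * s) x = Real.exp (2 * s) * energy E t x := by
  rw [energy, energy, Finset.mul_sum]
  refine Finset.sum_congr rfl fun v _ => ?_
  have h1 : -(2 / (v.mult : ℝ)) * (t v - v.mult * s) = 2 * s + -(2 / (v.mult : ℝ)) * t v := by
    have := (mult_cast_pos v).ne'
    field_simp
    ring
  rw [h1, Real.exp_add]
  ring

theorem exp_mul_energy_le {t : InfinitePlace F → ℝ} {B : ℝ} (hB : 0 ≤ B) (ht : ∀ v, t v ≤ B)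
    (x : V) : Real.exp (-(2 * B)) * energy E 0 x ≤ energy E t x := by
  rw [energy, energy, Finset.mul_sum]
  refine Finset.sum_le_sum fun v _ => ?_
  have h0 := mult_cast_pos v
  have h3 : (1 : ℝ) ≤ v.mult := by exact_mod_cast v.mult_pos
  have h1 : -(2 * B) ≤ -(2 / (v.mult : ℝ)) * t v := by
    rw [neg_mul, neg_le_neg_iff, div_mul_eq_mul_div, div_le_iff₀ h0]
    nlinarith [ht v]
  rw [Pi.zero_apply, mul_zero, Real.exp_zero, mul_one, mul_left_comm, ← mul_assoc]
  gcongr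

theorem gauss_zero_right (t : InfinitePlace F → ℝ) : gauss E t 0 = 1 := by
  have : ∀ v, E.infNorm v 0 = 0 := fun v => by
    have := infNorm_smul E v 0 0
    simpa using this
  simp [gauss, energy, this]

theorem gauss_pos (t : InfinitePlace F → ℝ) (x : V) : 0 < gauss E t x := Real.exp_pos _

theorem zero_mem_twist (c : IdealGroup F) : (0 : V) ∈ twist E c := fun a _ => by
  rw [smul_zero]; exact E.lattice.zero_mem

theorem continuous_gauss (x : V) : Continuous fun t => gauss E t x := by
  unfold gauss energy
  fun_prop

variable [FiniteDimensional F V]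

/-- Coordinates on a twisted lattice in which the energy is bounded below. -/
theorem exists_twist_coordinates (c : IdealGroup F) :
    ∃ δ > 0, ∃ φ : ((F →+* ℂ) × Fin (finrank F V) → ℤ) ≃ twist E c, (φ 0 : V) = 0 ∧
      ∀ z, δ * ∑ i, intVec z i ^ 2 ≤ energy E 0 (φ z) := by
  classical
  obtain ⟨b, 𝔞, h⟩ := exists_pseudoBasis E
  choose ω hω hdet using fun i => exists_integral_basis (c⁻¹ * 𝔞 i)
  obtain ⟨δ, hδ, hle⟩ := exists_lower_bound (energyMatrix_posDef E 0 (gramAt_posDef E b) ω)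
  refine ⟨δ, hδ, twistEquiv E h hω, ?_, fun z => ?_⟩
  · change ∑ p, (((0 : (F →+* ℂ) × Fin (finrank F V) → ℤ) p : ℤ) : F) • frame b ω p = 0
    simp
  · rw [energy_twistEquiv]
    exact hle _

theorem one_le_sum_sq {κ : Type*} [Fintype κ] {z : κ → ℤ} (hz : z ≠ 0) :
    1 ≤ ∑ i, intVec z i ^ 2 := by
  obtain ⟨i, hi⟩ := Function.ne_iff.1 hz
  have h1 : (1 : ℝ) ≤ intVec z i ^ 2 := by
    have h2 : 0 < z i ^ 2 := sq_pos_of_ne_zero hi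
    change (1 : ℝ) ≤ ((z i : ℤ) : ℝ) ^ 2
    exact_mod_cast h2
  exact h1.trans (Finset.single_le_sum (f := fun i => intVec z i ^ 2)
    (fun i _ => sq_nonneg _) (Finset.mem_univ i))

/-- Energy decreases in each `t v`, so an upper bound on `t` bounds it below by a multiple of the
energy at `0`, and one Gaussian serves for all such `t`. -/
theorem exists_summable_majorant (c : IdealGroup F) (B : ℝ) :
    ∃ u : twist E c → ℝ, Summable u ∧
      ∀ t : InfinitePlace F → ℝ, (∀ v, t v ≤ B) → ∀ x : twist E c, gauss E t x ≤ u x := by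
  classical
  obtain ⟨δ, hδ, φ, -, hφ⟩ := exists_twist_coordinates E c
  have hs : 0 < Real.pi * (Real.exp (-(2 * |B|)) * δ) :=
    mul_pos Real.pi_pos (mul_pos (Real.exp_pos _) hδ)
  refine ⟨fun x => Real.exp (-(Real.pi * (Real.exp (-(2 * |B|)) * δ)) *
    ∑ i, intVec (φ.symm x) i ^ 2), φ.symm.summable_iff.2 (summable_exp_neg_sum_sq hs),
    fun t ht x => Real.exp_le_exp.2 ?_⟩
  have h1 := exp_mul_energy_le E (abs_nonneg B) (fun v => (ht v).trans (le_abs_self B)) (x : V)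
  have h2 := hφ (φ.symm x)
  rw [φ.apply_symm_apply] at h2
  rw [neg_mul, neg_mul, neg_le_neg_iff, mul_assoc, mul_assoc]
  refine mul_le_mul_of_nonneg_left (le_trans ?_ h1) Real.pi_pos.le
  gcongr

theorem summable_gauss (c : IdealGroup F) (t : InfinitePlace F → ℝ) :
    Summable fun x : twist E c => gauss E t x := by
  obtain ⟨u, hu, h⟩ := exists_summable_majorant E c (∑ v, |t v|)
  exact hu.of_nonneg_of_le (fun x => (gauss_pos E t x).le) fun x => h t (fun v =>
    (le_abs_self _).trans (Finset.single_le_sum (f := fun v => |t v|) (fun v _ => abs_nonneg _)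
      (Finset.mem_univ v))) x

theorem continuous_theta (c : IdealGroup F) : Continuous (theta E c) := by
  rw [continuous_iff_continuousAt]
  intro t₀
  obtain ⟨u, hu, h⟩ := exists_summable_majorant E c (∑ v, |t₀ v| + 1)
  have hU : {t : InfinitePlace F → ℝ | ∀ v, t v < ∑ v, |t₀ v| + 1} ∈ nhds t₀ := by
    refine IsOpen.mem_nhds ?_ fun v => ?_
    · simp only [Set.ofPred_forall]
      exact isOpen_iInter_of_finite fun v => isOpen_lt (continuous_apply v) continuous_const
    · have := Finset.single_le_sum (f := fun v => |t₀ v|) (fun v _ => abs_nonneg _)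
        (Finset.mem_univ v)
      have := le_abs_self (t₀ v)
      linarith
  refine ContinuousOn.continuousAt (continuousOn_tsum
    (fun x => (continuous_gauss E (x : V)).continuousOn) hu fun x t ht => ?_) hU
  rw [Real.norm_of_nonneg (gauss_pos E t x).le]
  exact h t (fun v => (ht v).le) x

open Classical in
theorem theta_eq_one_add (c : IdealGroup F) (t : InfinitePlace F → ℝ) :
    theta E c t = 1 + ∑' x : twist E c, if (x : V) = 0 then 0 else gauss E t x := by
  rw [theta, (summable_gauss E c t).tsum_eq_add_tsum_ite ⟨0, zero_mem_twist E c⟩, gauss_zero_right]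
  simp only [Subtype.ext_iff]

theorem one_le_theta (c : IdealGroup F) (t : InfinitePlace F → ℝ) : 1 ≤ theta E c t := by
  classical
  rw [theta_eq_one_add, le_add_iff_nonneg_right]
  refine tsum_nonneg fun x => ?_
  split_ifs
  · rfl
  · exact (gauss_pos E t x).le

/-- The shift multiplies the energy by `e^(2s)`. For a nonzero vector the lower bound `q = a ∑ zᵢ²`
is at least `a`, whence `e^(2s) q ≥ a e^(2s) + q - a`. The term in `s` leaves the sum, and what
remains is a convergent Gaussian series times `e^a`. -/
theorem theta_sub_one_le (c : IdealGroup F) (B : ℝ) :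
    ∃ C > 0, ∃ a > 0, ∀ t : InfinitePlace F → ℝ, (∀ v, t v ≤ B) → ∀ s : ℝ, 0 ≤ s →
      theta E c (fun v => t v - v.mult * s) - 1 ≤ C * Real.exp (-a * Real.exp (2 * s)) := by
  classical
  obtain ⟨δ, hδ, φ, hφ0, hφ⟩ := exists_twist_coordinates E c
  set a := Real.pi * (Real.exp (-(2 * |B|)) * δ) with ha
  have hs : 0 < a := mul_pos Real.pi_pos (mul_pos (Real.exp_pos _) hδ)
  have hsum := summable_exp_neg_sum_sq (ι := (F →+* ℂ) × Fin (finrank F V)) hs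
  refine ⟨Real.exp a * ∑' z : (F →+* ℂ) × Fin (finrank F V) → ℤ,
    Real.exp (-a * ∑ i, intVec z i ^ 2), mul_pos (Real.exp_pos _) (hsum.tsum_pos
      (fun _ => (Real.exp_pos _).le) 0 (Real.exp_pos _)), a, hs, fun t ht s h0 => ?_⟩
  rw [theta_eq_one_add, add_sub_cancel_left, mul_right_comm, ← Real.exp_add, ← tsum_mul_left,
    ← φ.tsum_eq]
  have hle : ∀ z, (if ((φ z : V)) = 0 then 0 else
      gauss E (fun v => t v - v.mult * s) (φ z)) ≤
      Real.exp (a + -a * Real.exp (2 * s)) * Real.exp (-a * ∑ i, intVec z i ^ 2) := fun z => by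
    split_ifs with hz
    · positivity
    · have hz0 : z ≠ 0 := fun h => hz (by rw [h, hφ0])
      have h1 := exp_mul_energy_le E (abs_nonneg B) (fun v => (ht v).trans (le_abs_self B)) (φ z : V)
      have h2 : a * ∑ i, intVec z i ^ 2 ≤ Real.pi * energy E t (φ z) := by
        rw [ha, mul_assoc, mul_assoc]
        refine mul_le_mul_of_nonneg_left (le_trans ?_ h1) Real.pi_pos.le
        exact mul_le_mul_of_nonneg_left (hφ z) (Real.exp_pos _).le
      have h3 : 1 ≤ Real.exp (2 * s) := Real.one_le_exp (by positivity)
      have h4 := one_le_sum_sq hz0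
      rw [gauss, energy_sub, ← Real.exp_add]
      refine Real.exp_le_exp.2 ?_
      have h5 : Real.exp (2 * s) * (a * ∑ i, intVec z i ^ 2) ≤
          Real.exp (2 * s) * (Real.pi * energy E t (φ z)) := by gcongr
      have h6 : 0 ≤ (Real.exp (2 * s) - 1) * (a * (∑ i, intVec z i ^ 2 - 1)) :=
        mul_nonneg (by linarith) (mul_nonneg hs.le (by linarith))
      nlinarith
  have hsum' := hsum.mul_left (Real.exp (a + -a * Real.exp (2 * s)))
  refine Summable.tsum_le_tsum hle (hsum'.of_nonneg_of_le (fun z => ?_) hle) hsum'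
  split_ifs
  · rfl
  · exact (gauss_pos _ _ _).le

end ThetaBounds

/-! ### Trace coordinates and a fundamental domain for the units -/

section Coordinates

open NumberField NumberField.Units NumberField.Units.dirichletUnitTheorem MeasureTheory
open scoped Classical

variable {F : Type*} [Field F] [NumberField F]

/-- The point of `ℝ ^ (infinite places)` of trace `T` with the given components. -/
def toPlaces (T : ℝ) (y : logSpace F) (v : InfinitePlace F) : ℝ :=
  v.mult * (T / finrank ℚ F) + if h : v = w₀ then -∑ w, y w else y ⟨v, h⟩

theorem degree_cast_pos : (0 : ℝ) < finrank ℚ F := by exact_mod_cast finrank_pos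

theorem sum_mult_cast : ∑ v : InfinitePlace F, (v.mult : ℝ) = finrank ℚ F := by
  exact_mod_cast InfinitePlace.sum_mult_eq (K := F)

theorem sum_toPlaces (T : ℝ) (y : logSpace F) : ∑ v, toPlaces T y v = T := by
  classical
  simp only [toPlaces, Finset.sum_add_distrib, ← Finset.sum_mul, sum_mult_cast]
  rw [Fintype.sum_eq_add_sum_subtype_ne _ w₀, dif_pos rfl]
  have : ∀ w : {w : InfinitePlace F // w ≠ w₀},
      (if h : (w : InfinitePlace F) = w₀ then -∑ w, y w else y ⟨w, h⟩) = y w := fun w =>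
    dif_neg w.2
  simp only [this, neg_add_cancel, add_zero]
  have := degree_cast_pos (F := F)
  field_simp

theorem toPlaces_add (T T' : ℝ) (y y' : logSpace F) :
    toPlaces (T + T') (y + y') = toPlaces T y + toPlaces T' y' := by
  funext v
  simp only [toPlaces, Pi.add_apply, Finset.sum_add_distrib]
  split_ifs <;> ring

theorem toPlaces_neg (T : ℝ) (y : logSpace F) : toPlaces (-T) (-y) = -toPlaces T y := by
  funext v
  simp only [toPlaces, Pi.neg_apply, Finset.sum_neg_distrib]
  split_ifs <;> ring

theorem continuous_toPlaces : Continuous fun p : ℝ × logSpace F => toPlaces p.1 p.2 := by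
  refine continuous_pi fun v => ?_
  unfold toPlaces
  split_ifs <;> fun_prop

theorem exists_eq_toPlaces (t : InfinitePlace F → ℝ) : ∃ y, t = toPlaces (∑ v, t v) y := by
  classical
  refine ⟨fun w => t w - w.1.mult * ((∑ v, t v) / finrank ℚ F), funext fun v => ?_⟩
  unfold toPlaces
  split_ifs with h
  · have h1 := Fintype.sum_eq_add_sum_subtype_ne
      (fun v => t v - v.mult * ((∑ v, t v) / finrank ℚ F)) (w₀ : InfinitePlace F)
    rw [Finset.sum_sub_distrib, ← Finset.sum_mul, sum_mult_cast,
      mul_div_cancel₀ _ (degree_cast_pos (F := F)).ne', sub_self] at h1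
    subst h
    linarith
  · simp

/-- The image of a unit of the ring of integers in the units of the field. -/
def unitToField : (𝓞 F)ˣ →* Fˣ := Units.map (algebraMap (𝓞 F) F).toMonoidHom

/-- The component at `w₀`, omitted by `logEmbedding`, is minus the sum of the others because units
have absolute norm one. -/
theorem absShift_unit (u : (𝓞 F)ˣ) :
    absShift (unitToField u) = toPlaces 0 (logEmbedding F (Additive.ofMul u)) := by
  funext v
  unfold toPlaces
  rw [zero_div, mul_zero, zero_add]
  split_ifs with h
  · subst h
    rw [sum_logEmbedding_component, neg_mul, neg_neg]
    rfl
  · rfl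

theorem unit_smul_mem_one (u : (𝓞 F)ˣ) {x : F}
    (hx : x ∈ (1 : FractionalIdeal (nonZeroDivisors (𝓞 F)) F)) :
    (unitToField u : F) * x ∈ (1 : FractionalIdeal (nonZeroDivisors (𝓞 F)) F) := by
  rw [FractionalIdeal.mem_one_iff] at hx ⊢
  obtain ⟨y, rfl⟩ := hx
  exact ⟨u * y, map_mul _ _ _⟩

theorem mem_principal {a : Fˣ} {x : F} :
    x ∈ (toPrincipalIdeal (𝓞 F) F a).1 ↔
      (a : F)⁻¹ * x ∈ (1 : FractionalIdeal (nonZeroDivisors (𝓞 F)) F) := by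
  conv_lhs => rw [← one_mul (toPrincipalIdeal (𝓞 F) F a), mem_mul_principal, Units.val_one]

theorem principal_unit (u : (𝓞 F)ˣ) : toPrincipalIdeal (𝓞 F) F (unitToField u) = 1 := by
  refine Units.ext (FractionalIdeal.ext fun x => ?_)
  rw [mem_principal, Units.val_one, ← Units.val_inv_eq_inv_val, ← map_inv]
  refine ⟨fun h => ?_, unit_smul_mem_one u⁻¹⟩
  have := unit_smul_mem_one u h
  rwa [map_inv, Units.mul_inv_cancel_left] at this

theorem exists_unit_of_principal {a : Fˣ} (ha : toPrincipalIdeal (𝓞 F) F a = 1) :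
    ∃ u, unitToField u = a := by
  have h1 : (a : F) ∈ (1 : FractionalIdeal (nonZeroDivisors (𝓞 F)) F) := by
    rw [← Units.val_one, ← ha, mem_principal, inv_mul_cancel₀ a.ne_zero]
    exact FractionalIdeal.one_mem_one _
  have h2 : (a : F)⁻¹ ∈ (1 : FractionalIdeal (nonZeroDivisors (𝓞 F)) F) := by
    have h : (1 : F) ∈ (toPrincipalIdeal (𝓞 F) F a).1 := by
      rw [ha]; exact FractionalIdeal.one_mem_one _
    rwa [mem_principal, mul_one] at h
  rw [FractionalIdeal.mem_one_iff] at h1 h2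
  obtain ⟨x, hx⟩ := h1
  obtain ⟨y, hy⟩ := h2
  have hxy : x * y = 1 := by
    refine FaithfulSMul.algebraMap_injective (𝓞 F) F ?_
    rw [map_mul, hx, hy, mul_inv_cancel₀ a.ne_zero, map_one]
  exact ⟨⟨x, y, hxy, by rw [mul_comm, hxy]⟩, Units.ext hx⟩

/-- A fundamental domain for the lattice of logarithms of units. -/
def unitDomain (F : Type*) [Field F] [NumberField F] : Set (logSpace F) :=
  ZSpan.fundamentalDomain ((basisUnitLattice F).ofZLatticeBasis ℝ)

theorem isAddFundamentalDomain_unitDomain :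
    IsAddFundamentalDomain (unitLattice F) (unitDomain F) volume :=
  ZLattice.isAddFundamentalDomain (basisUnitLattice F) volume

theorem measurableSet_unitDomain : MeasurableSet (unitDomain F) :=
  ZSpan.fundamentalDomain_measurableSet _

theorem isBounded_unitDomain : Bornology.IsBounded (unitDomain F) :=
  ZSpan.fundamentalDomain_isBounded _

theorem volume_unitDomain_lt_top : volume (unitDomain F) < ⊤ :=
  isBounded_unitDomain.measure_lt_top

theorem volume_unitDomain : volume.real (unitDomain F) = regulator F :=
  (ZLattice.covolume_eq_measure_fundamentalDomain (unitLattice F) volume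
    isAddFundamentalDomain_unitDomain).symm

instance : VAddInvariantMeasure (unitLattice F) (logSpace F) volume :=
  ⟨fun l s _ => measure_preimage_add volume (l : logSpace F) s⟩

theorem countable_unitLattice : Countable (unitLattice F) :=
  inferInstance

/-- The preimage of the fundamental domain under `f` is again a fundamental domain, and a periodic
function has the same integral over any two of them. -/
theorem setIntegral_unitDomain_comp {G : logSpace F → ℝ}
    (hG : ∀ (l : unitLattice F) y, G (l +ᵥ y) = G y) {f : logSpace F → logSpace F}
    (hf : MeasurePreserving f) (hf' : MeasurableEmbedding f) {e : unitLattice F → unitLattice F}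
    (he : Function.Bijective e) (hef : ∀ l y, f (e l +ᵥ y) = l +ᵥ f y) :
    ∫ y in unitDomain F, G (f y) = ∫ y in unitDomain F, G y := by
  have := countable_unitLattice (F := F)
  have h1 : IsAddFundamentalDomain (unitLattice F) (f ⁻¹' unitDomain F) volume :=
    isAddFundamentalDomain_unitDomain.preimage_of_equiv hf.quasiMeasurePreserving he
      fun l y => hef l y
  rw [← hf.setIntegral_preimage_emb hf' G]
  refine isAddFundamentalDomain_unitDomain.setIntegral_eq (f := fun y => G (f y)) h1 fun l y => ?_
  obtain ⟨l, rfl⟩ := he.2 l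
  rw [hef, hG]

theorem setIntegral_unitDomain_add {G : logSpace F → ℝ}
    (hG : ∀ (l : unitLattice F) y, G (l +ᵥ y) = G y) (z : logSpace F) :
    ∫ y in unitDomain F, G (y + z) = ∫ y in unitDomain F, G y :=
  setIntegral_unitDomain_comp hG (measurePreserving_add_right volume z)
    (measurableEmbedding_addRight z) Function.bijective_id fun _ _ => add_assoc _ _ _

theorem setIntegral_unitDomain_neg {G : logSpace F → ℝ}
    (hG : ∀ (l : unitLattice F) y, G (l +ᵥ y) = G y) :
    ∫ y in unitDomain F, G (-y) = ∫ y in unitDomain F, G y :=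
  setIntegral_unitDomain_comp hG (Measure.measurePreserving_neg volume)
    (Homeomorph.neg _).measurableEmbedding (neg_involutive (G := unitLattice F)).bijective
      fun l y => by
        change -(((-l : unitLattice F) : logSpace F) + y) = (l : logSpace F) + -y
        simp [add_comm]

end Coordinates

/-! ### The theta average over divisor classes of fixed degree -/

section Total

open NumberField NumberField.Units NumberField.Units.dirichletUnitTheorem MeasureTheory
open scoped Classical

variable {F V : Type*} [Field F] [NumberField F] [AddCommGroup V] [Module F V]
  [Module (𝓞 F) V] [IsScalarTower (𝓞 F) F V] (E : ArakelovBundle F V)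

/-- A unit generates the trivial ideal, so invariance under principal divisors becomes periodicity
in the logarithmic variable. -/
theorem theta_periodic (c : IdealGroup F) (T : ℝ) (l : unitLattice F) (y : logSpace F) :
    theta E c (toPlaces T (l +ᵥ y)) = theta E c (toPlaces T y) := by
  obtain ⟨_, ⟨u, -, rfl⟩⟩ := l
  have h : toPlaces T (logEmbedding F u + y) = toPlaces T y + absShift (unitToField u.toMul) := by
    rw [absShift_unit, ← toPlaces_add, add_zero, add_comm]
    rfl
  change theta E c (toPlaces T (logEmbedding F u + y)) = _
  rw [h, ← theta_mul_principal, principal_unit, mul_one]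

/-- The theta series averaged over a fundamental domain for the units. -/
def thetaMean (c : IdealGroup F) (T : ℝ) : ℝ :=
  ∫ y in unitDomain F, theta E c (toPlaces (T - Real.log (idealNorm c)) y)

/-- The subtracted `log (idealNorm c)` makes `T` the total degree of the divisor. Multiplying `c` by
`(a)` then only translates `y`, which an average over a fundamental domain does not see. -/
theorem thetaMean_mul_principal (c : IdealGroup F) (a : Fˣ) (T : ℝ) :
    thetaMean E (c * toPrincipalIdeal (𝓞 F) F a) T = thetaMean E c T := by
  obtain ⟨z, hz⟩ := exists_eq_toPlaces (absShift a)
  rw [sum_absShift] at hz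
  have h : ∀ y, theta E (c * toPrincipalIdeal (𝓞 F) F a) (toPlaces (T -
      Real.log (idealNorm (c * toPrincipalIdeal (𝓞 F) F a))) y) =
      theta E c (toPlaces (T - Real.log (idealNorm c)) (y + z)) := fun y => by
    rw [theta_mul_principal, hz, ← toPlaces_add, map_mul,
      Real.log_mul (idealNorm_pos _).ne' (idealNorm_pos _).ne']
    congr 2
    ring
  simp only [thetaMean, h]
  exact setIntegral_unitDomain_add (G := fun y => theta E c (toPlaces (T - Real.log (idealNorm c)) y))
    (theta_periodic E c _) z

/-- The class group as a group of classes of fractional ideals of `F`. -/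
abbrev IdealClass (F : Type*) [Field F] [NumberField F] : Type _ :=
  IdealGroup F ⧸ (toPrincipalIdeal (𝓞 F) F).range

instance : Fintype (IdealClass F) := Fintype.ofEquiv _ (ClassGroup.equiv F).toEquiv

theorem card_idealClass : Fintype.card (IdealClass F) = classNumber F :=
  (Fintype.card_congr (ClassGroup.equiv F).toEquiv).symm

theorem thetaMean_out (c : IdealGroup F) (T : ℝ) :
    thetaMean E (Quotient.out (QuotientGroup.mk c : IdealClass F)) T = thetaMean E c T := by
  obtain ⟨⟨_, a, rfl⟩, ha⟩ := QuotientGroup.mk_out_eq_mul (toPrincipalIdeal (𝓞 F) F).range c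
  rw [ha, thetaMean_mul_principal]

/-- The sum of the theta means over the ideal classes. -/
def thetaTotal (T : ℝ) : ℝ := ∑ κ : IdealClass F, thetaMean E κ.out T

variable [FiniteDimensional F V]

/-- The duality `D ↦ K - D` acts as `y ↦ -y` in logarithmic space and, since the different has norm
`|Δ|`, as `T ↦ log |Δ| - T` on degrees. -/
theorem thetaMean_eq_dual (c : IdealGroup F) (T : ℝ) :
    thetaMean E c T = (√|(discr F : ℝ)| ^ finrank F V)⁻¹ * E.norm * Real.exp T ^ finrank F V *
      thetaMean E.dual (c⁻¹ * different F) (Real.log |(discr F : ℝ)| - T) := by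
  have h0 : |(discr F : ℝ)| ≠ 0 := abs_ne_zero.2 (by exact_mod_cast discr_ne_zero F)
  have h : ∀ y, theta E c (toPlaces (T - Real.log (idealNorm c)) y) =
      (√|(discr F : ℝ)| ^ finrank F V)⁻¹ * E.norm * Real.exp T ^ finrank F V *
        theta E.dual (c⁻¹ * different F) (toPlaces (Real.log |(discr F : ℝ)| - T -
          Real.log (idealNorm (c⁻¹ * different F))) (-y)) := fun y => by
    rw [theta_eq_theta_dual, sum_toPlaces, ← toPlaces_neg, map_mul, idealNorm_inv,
      idealNorm_different, Real.log_mul (inv_ne_zero (idealNorm_pos _).ne') h0, Real.log_inv,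
      Real.exp_sub, Real.exp_log (idealNorm_pos _), div_pow]
    have h1 : -(T - Real.log (idealNorm c)) = Real.log |(discr F : ℝ)| - T -
      (-Real.log (idealNorm c) + Real.log |(discr F : ℝ)|) := by ring
    rw [h1]
    have := (idealNorm_pos c).ne'
    field_simp
  simp only [thetaMean, h]
  rw [integral_const_mul]
  congr 1
  exact setIntegral_unitDomain_neg (G := fun y => theta E.dual (c⁻¹ * different F) (toPlaces
    (Real.log |(discr F : ℝ)| - T - Real.log (idealNorm (c⁻¹ * different F))) y))
    (theta_periodic E.dual _ _)

/-- The map `κ ↦ κ⁻¹ [𝔡]` permutes the ideal classes, and the mean does not depend on the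
representative of a class. -/
theorem thetaTotal_eq_dual (T : ℝ) :
    thetaTotal E T = (√|(discr F : ℝ)| ^ finrank F V)⁻¹ * E.norm * Real.exp T ^ finrank F V *
      thetaTotal E.dual (Real.log |(discr F : ℝ)| - T) := by
  rw [thetaTotal, thetaTotal, Finset.mul_sum]
  refine Fintype.sum_equiv ((Equiv.inv (IdealClass F)).trans
    (Equiv.mulRight (QuotientGroup.mk (different F)))) _ _ fun κ => ?_
  rw [thetaMean_eq_dual, ← thetaMean_out E.dual]
  congr 4
  rw [QuotientGroup.mk_mul, QuotientGroup.mk_inv, QuotientGroup.out_eq']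
  rfl

theorem continuous_theta_toPlaces (c : IdealGroup F) :
    Continuous fun p : ℝ × logSpace F => theta E c (toPlaces p.1 p.2) :=
  (continuous_theta E c).comp continuous_toPlaces

theorem integrableOn_theta (c : IdealGroup F) (T : ℝ) :
    IntegrableOn (fun y => theta E c (toPlaces T y)) (unitDomain F) :=
  (((continuous_theta_toPlaces E c).comp (Continuous.prodMk_right T)).continuousOn.integrableOn_compact
    isBounded_unitDomain.isCompact_closure).mono_set subset_closure

theorem continuous_thetaMean (c : IdealGroup F) : Continuous (thetaMean E c) := by
  have h : Continuous fun T => ∫ y in unitDomain F, theta E c (toPlaces T y) := by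
    rw [continuous_iff_continuousAt]
    intro T₀
    obtain ⟨M, hM⟩ := ((isCompact_Icc (a := T₀ - 1) (b := T₀ + 1)).prod
      (isBounded_unitDomain (F := F)).isCompact_closure).exists_bound_of_continuousOn
      (continuous_theta_toPlaces E c).continuousOn
    have hT : Set.Icc (T₀ - 1) (T₀ + 1) ∈ nhds T₀ := Icc_mem_nhds (by linarith) (by linarith)
    refine continuousAt_of_dominated (bound := fun _ => M)
      (Filter.Eventually.of_forall fun T => (integrableOn_theta E c T).aestronglyMeasurable)
      (Filter.eventually_of_mem hT fun T hT' => ?_) ?_ ?_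
    · exact (ae_restrict_mem measurableSet_unitDomain).mono fun y hy =>
        hM (T, y) ⟨hT', subset_closure hy⟩
    · exact integrableOn_const volume_unitDomain_lt_top.ne
    · exact Filter.Eventually.of_forall fun y =>
        ((continuous_theta_toPlaces E c).comp (Continuous.prodMk_left y)).continuousAt
  exact h.comp (continuous_sub_right _)

theorem continuous_thetaTotal : Continuous (thetaTotal E) :=
  continuous_finsetSum _ fun _ _ => continuous_thetaMean E _

theorem thetaMean_sub_regulator (c : IdealGroup F) (T : ℝ) :
    thetaMean E c T - regulator F =
      ∫ y in unitDomain F, (theta E c (toPlaces (T - Real.log (idealNorm c)) y) - 1) := by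
  rw [integral_sub (integrableOn_theta E c _) (integrableOn_const volume_unitDomain_lt_top.ne),
    setIntegral_const, volume_unitDomain, smul_eq_mul, mul_one]
  rfl

theorem toPlaces_eq_sub (T : ℝ) (y : logSpace F) :
    toPlaces T y = fun v => toPlaces 0 y v - v.mult * (-T / finrank ℚ F) := by
  funext v
  unfold toPlaces
  ring

/-- With `n = [F : ℚ]`, moving the degree towards `-∞` is the uniform shift by `s = (log X - L') /
n`, and `e^(2s)` is a constant times `X^(2/n)`. The bound `exp (-b X^(2/n))` beats every power of
`X`. -/
theorem thetaMean_isBigO (c : IdealGroup F) (L k : ℝ) :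
    (fun X : ℝ => thetaMean E c (L - Real.log X) - regulator F) =O[Filter.atTop]
      fun X : ℝ => X ^ k := by
  obtain ⟨B, hB⟩ := (isBounded_unitDomain (F := F)).isCompact_closure.exists_bound_of_continuousOn
    (continuous_toPlaces.comp (Continuous.prodMk_right (0 : ℝ))).continuousOn
  obtain ⟨C, hC, a, ha, h⟩ := theta_sub_one_le E c B
  set n : ℝ := ((finrank ℚ F : ℕ) : ℝ) with hn
  have hn0 : 0 < n := degree_cast_pos
  set L' := L - Real.log (idealNorm c) with hL
  set b := a * Real.exp (-(2 * L' / n)) with hb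
  have hb0 : 0 < b := mul_pos ha (Real.exp_pos _)
  have hlim : Filter.Tendsto (fun X : ℝ => X ^ (2 / n)) Filter.atTop Filter.atTop :=
    tendsto_rpow_atTop (by positivity)
  have h1 := (isLittleO_exp_neg_mul_rpow_atTop hb0 (k * n / 2)).isBigO.comp_tendsto hlim
  refine Asymptotics.IsBigO.trans (Asymptotics.IsBigO.of_bound (C * regulator F) ?_) (h1.congr' 
    (Filter.EventuallyEq.refl _ _) ?_)
  · filter_upwards [Filter.eventually_ge_atTop (Real.exp L')] with X hX
    have hX0 : 0 < X := (Real.exp_pos _).trans_le hX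
    have hs : 0 ≤ (Real.log X - L') / n :=
      div_nonneg (sub_nonneg.2 ((Real.le_log_iff_exp_le hX0).2 hX)) hn0.le
    rw [thetaMean_sub_regulator]
    have hexp : a * Real.exp (2 * ((Real.log X - L') / n)) = b * X ^ (2 / n) := by
      rw [hb, Real.rpow_def_of_pos hX0, mul_assoc, ← Real.exp_add]
      congr 2
      ring
    have hle : ∀ y ∈ unitDomain F, ‖theta E c (toPlaces (L - Real.log X -
        Real.log (idealNorm c)) y) - 1‖ ≤ C * Real.exp (-b * X ^ (2 / n)) := fun y hy => by
      rw [Real.norm_of_nonneg (sub_nonneg.2 (one_le_theta E c _)), toPlaces_eq_sub, neg_mul,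
        ← hexp, ← neg_mul]
      have h2 := h (toPlaces 0 y) (fun v => ?_) _ hs
      · convert h2 using 5
        rw [hL]; ring
      · exact (le_abs_self _).trans ((norm_le_pi_norm (toPlaces 0 y) v).trans
          (hB y (subset_closure hy)))
    refine (norm_setIntegral_le_of_norm_le_const volume_unitDomain_lt_top hle).trans ?_
    rw [volume_unitDomain, Function.comp_apply, Real.norm_of_nonneg (Real.exp_pos _).le]
    exact le_of_eq (by ring)
  · filter_upwards [Filter.eventually_gt_atTop 0] with X hX
    rw [Function.comp_apply, ← Real.rpow_mul hX.le]
    congr 1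
    field_simp

theorem thetaTotal_isBigO (L k : ℝ) :
    (fun X : ℝ => thetaTotal E (L - Real.log X) - classNumber F * regulator F) =O[Filter.atTop]
      fun X : ℝ => X ^ k := by
  have h := Asymptotics.IsBigO.sum (s := Finset.univ) fun (κ : IdealClass F) _ =>
    thetaMean_isBigO E κ.out L k
  refine h.congr_left fun X => ?_
  rw [Finset.sum_apply, Finset.sum_sub_distrib, Finset.sum_const, Finset.card_univ,
    card_idealClass, nsmul_eq_mul]
  rfl

/-- The pair of functions on the positive reals attached to a bundle and its dual. -/
def thetaPair (hr : 0 < finrank F V) : WeakFEPair ℂ where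
  f X := thetaTotal E (Real.log |(discr F : ℝ)| / 2 - Real.log X)
  g X := thetaTotal E.dual (Real.log |(discr F : ℝ)| / 2 - Real.log X)
  k := finrank F V
  ε := E.norm
  f₀ := (classNumber F * regulator F : ℝ)
  g₀ := (classNumber F * regulator F : ℝ)
  hf_int := by
    refine ContinuousOn.locallyIntegrableOn (Complex.continuous_ofReal.comp_continuousOn ?_) measurableSet_Ioi
    exact (continuous_thetaTotal E).comp_continuousOn
      (continuousOn_const.sub (Real.continuousOn_log.mono fun x hx => (ne_of_gt hx)))
  hg_int := by
    refine ContinuousOn.locallyIntegrableOn (Complex.continuous_ofReal.comp_continuousOn ?_) measurableSet_Ioi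
    exact (continuous_thetaTotal E.dual).comp_continuousOn
      (continuousOn_const.sub (Real.continuousOn_log.mono fun x hx => (ne_of_gt hx)))
  hk := by exact_mod_cast hr
  hε := by exact_mod_cast (norm_pos E).ne'
  -- Centring at `log |Δ| / 2` turns `T ↦ log |Δ| - T` into `X ↦ 1/X`. The factor `|Δ|^(-r/2)`
  -- cancels against `e^(rT) = |Δ|^(r/2) X^r`, leaving `ε = N(V)`.
  h_feq X hX := by
    have hX : 0 < X := hX
    have h0 : 0 < |(discr F : ℝ)| := abs_pos.2 (by exact_mod_cast discr_ne_zero F)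
    rw [thetaTotal_eq_dual, one_div, Real.log_inv, sub_neg_eq_add, Real.exp_add,
      Real.exp_log hX, Real.exp_half, Real.exp_log h0]
    have h1 : Real.log |(discr F : ℝ)| - (Real.log |(discr F : ℝ)| / 2 + Real.log X) =
      Real.log |(discr F : ℝ)| / 2 - Real.log X := by ring
    have h2 : √|(discr F : ℝ)| ^ finrank F V ≠ 0 := pow_ne_zero _ (Real.sqrt_pos.2 h0).ne'
    rw [h1, smul_eq_mul, ← Complex.ofReal_mul, ← Complex.ofReal_mul, Real.rpow_natCast, mul_pow]
    congr 1
    field_simp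
  hf_top k := by
    have := (thetaTotal_isBigO E (Real.log |(discr F : ℝ)| / 2) k)
    refine Asymptotics.IsBigO.of_norm_left (this.norm_left.congr_left fun X => ?_)
    rw [← Complex.ofReal_sub, Complex.norm_real]
  hg_top k := by
    have := (thetaTotal_isBigO E.dual (Real.log |(discr F : ℝ)| / 2) k)
    refine Asymptotics.IsBigO.of_norm_left (this.norm_left.congr_left fun X => ?_)
    rw [← Complex.ofReal_sub, Complex.norm_real]

end Total

/-! ### Regrouping of nonnegative sums along quotients -/

section Sums

open scoped ENNReal

theorem tsum_eq_tsum_quotient {G : Type*} [Group G] (H : Subgroup G) (f : G → ℝ≥0∞) :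
    ∑' g, f g = ∑' q : G ⧸ H, ∑' h : H, f (q.out * h) := by
  have hb : Function.Bijective fun p : (G ⧸ H) × H => p.1.out * (p.2 : G) := by
    refine ⟨fun ⟨q, h⟩ ⟨q', h'⟩ e => ?_, fun g => ?_⟩
    · have e : q.out * (h : G) = q'.out * h' := e
      have h1 : q = q' := by
        have h2 := congrArg (QuotientGroup.mk (s := H)) e
        rwa [QuotientGroup.mk_mul_of_mem _ h.2, QuotientGroup.mk_mul_of_mem _ h'.2,
          QuotientGroup.out_eq', QuotientGroup.out_eq'] at h2
      subst h1
      rw [Subtype.ext (mul_left_cancel e)]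
    · obtain ⟨h, hh⟩ := QuotientGroup.mk_out_eq_mul H g
      exact ⟨⟨QuotientGroup.mk g, h⁻¹⟩, by simp [hh]⟩
  rw [← (Equiv.ofBijective _ hb).tsum_eq, ENNReal.tsum_prod']
  rfl

/-- Splits a sum along the cokernel and then the image of `φ`. For `Fˣ` mapping to fractional
ideals, the indices are ideal classes and elements of `Fˣ` modulo units. -/
theorem tsum_units_quotient {G H : Type*} [CommGroup G] [CommGroup H] (φ : G →* H) (f : H → ℝ≥0∞) :
    ∑' h, f h = ∑' κ : H ⧸ φ.range, ∑' q : G ⧸ φ.ker, f (κ.out * φ q.out) := by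
  rw [tsum_eq_tsum_quotient φ.range]
  refine tsum_congr fun κ => ?_
  rw [← (QuotientGroup.quotientKerEquivRange φ).toEquiv.tsum_eq]
  refine tsum_congr fun q => ?_
  conv_lhs => rw [← QuotientGroup.out_eq' q]
  rfl

open Classical in
theorem tsum_nonzero {F V : Type*} [Field F] [AddCommGroup V] [Module F V] (f : V → ℝ≥0∞) :
    ∑' x, (if x = 0 then 0 else f x) = ∑' P : ℙ F V, ∑' a : Fˣ, f ((a : F) • P.rep) := by
  have hne : ∀ (P : ℙ F V) (a : Fˣ), (a : F) • P.rep ≠ 0 := fun P a =>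
    smul_ne_zero a.ne_zero P.rep_nonzero
  have hb : Function.Bijective fun p : ℙ F V × Fˣ =>
      (⟨(p.2 : F) • p.1.rep, hne p.1 p.2⟩ : {x : V | x ≠ 0}) := by
    refine ⟨fun ⟨P, a⟩ ⟨P', a'⟩ e => ?_, fun ⟨x, hx⟩ => ?_⟩
    · have e : (a : F) • P.rep = (a' : F) • P'.rep := congrArg Subtype.val e
      have h1 : P = P' := by
        rw [← P.mk_rep, ← P'.mk_rep, Projectivization.mk_eq_mk_iff']
        exact ⟨(a : F)⁻¹ * a', by rw [mul_smul, ← e, smul_smul, inv_mul_cancel₀ a.ne_zero, one_smul]⟩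
      subst h1
      rw [Units.ext (smul_left_injective F P.rep_nonzero e)]
    · obtain ⟨a, ha⟩ := (Projectivization.mk_eq_mk_iff F _ _ (Projectivization.mk F x hx).rep_nonzero
        hx).1 (Projectivization.mk_rep _)
      refine ⟨⟨Projectivization.mk F x hx, a⁻¹⟩, Subtype.ext ?_⟩
      change ((a⁻¹ : Fˣ) : F) • (Projectivization.mk F x hx).rep = x
      rw [← ha]
      exact inv_smul_smul a x
  have h1 : ∑' x, (if x = 0 then 0 else f x) = ∑' x, ({x : V | x ≠ 0}).indicator f x := by
    refine tsum_congr fun x => ?_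
    by_cases hx : x = 0 <;> simp [hx]
  rw [h1, ← tsum_subtype, ← (Equiv.ofBijective _ hb).tsum_eq, ENNReal.tsum_prod']
  rfl

end Sums

/-! ### Roots of unity and Lebesgue measure in trace coordinates -/

section Coordinates

open NumberField NumberField.Units NumberField.Units.dirichletUnitTheorem MeasureTheory
open scoped Classical ENNReal

variable {F : Type*} [Field F] [NumberField F]

/-- The kernel of the logarithmic embedding is the group of roots of unity. This is the source of
`w` in the residue. -/
theorem tsum_logEmbedding (f : logSpace F → ℝ≥0∞) :
    ∑' u : (𝓞 F)ˣ, f (logEmbedding F (Additive.ofMul u)) =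
      torsionOrder F * ∑' l : unitLattice F, f l := by
  rw [tsum_eq_tsum_quotient (torsion F), ← (logEmbeddingEquiv F).toEquiv.tsum_eq,
    ← ENNReal.tsum_mul_left, ← Additive.ofMul.tsum_eq]
  refine tsum_congr fun q => ?_
  have h : ((logEmbeddingEquiv F (Additive.ofMul q) : unitLattice F) : logSpace F) =
      logEmbedding F (Additive.ofMul q.out) := by
    conv_lhs => rw [← QuotientGroup.out_eq' q]
    exact logEmbeddingEquiv_apply F _
  have h2 : ∀ u : torsion F, logEmbedding F (Additive.ofMul (q.out * (u : (𝓞 F)ˣ))) =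
      logEmbedding F (Additive.ofMul q.out) := fun u => by
    rw [ofMul_mul, map_add, logEmbedding_eq_zero_iff.2 u.2, add_zero]
  simp only [h2]
  rw [ENNReal.tsum_const, ENat.card_eq_coe_natCard]
  change _ = _ * f ((logEmbeddingEquiv F (Additive.ofMul q) : unitLattice F) : logSpace F)
  rw [h]
  rfl

/-- The coordinates preserve Lebesgue measure. For fixed `T` a translation in `y` reduces the map to
`y` together with the `w₀`-coordinate `T - ∑ y`; after exchanging the integrals, a translation in
`T` finishes. -/
theorem lintegral_toPlaces {g : (InfinitePlace F → ℝ) → ℝ≥0∞} (hg : Measurable g) :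
    ∫⁻ T : ℝ, ∫⁻ y : logSpace F, g (toPlaces T y) = ∫⁻ t, g t := by
  let p : InfinitePlace F → Prop := fun v => v ≠ w₀
  let uq : Unique {v : InfinitePlace F // ¬ p v} :=
    ⟨⟨⟨w₀, fun h => h rfl⟩⟩, fun v => Subtype.ext (not_not.1 v.2)⟩
  let e₁ := MeasurableEquiv.piEquivPiSubtypeProd (fun _ : InfinitePlace F => ℝ) p
  let e₂ := MeasurableEquiv.funUnique {v : InfinitePlace F // ¬ p v} ℝ
  let q : logSpace F → ℝ → InfinitePlace F → ℝ := fun y u => e₁.symm (y, e₂.symm u)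
  have hq : Measurable (Function.uncurry q) :=
    e₁.symm.measurable.comp (measurable_fst.prodMk (e₂.symm.measurable.comp measurable_snd))
  have hq1 : ∀ y u v, q y u v = if h : v = w₀ then u else y ⟨v, h⟩ := fun y u v => by
    by_cases h : v = w₀
    · rw [dif_pos h]
      exact dif_neg (not_not.2 h)
    · rw [dif_neg h]
      exact dif_pos h
  have h1 : ∫⁻ t, g t = ∫⁻ y, ∫⁻ u, g (q y u) := by
    have hp : MeasurePreserving e₁ volume volume :=
      volume_preserving_piEquivPiSubtypeProd (fun _ : InfinitePlace F => ℝ) p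
    rw [← hp.symm.lintegral_comp_emb e₁.symm.measurableEmbedding, Measure.volume_eq_prod]
    refine (lintegral_prod (fun z => g (e₁.symm z))
      (hg.comp e₁.symm.measurable).aemeasurable).trans ?_
    refine lintegral_congr fun y => ?_
    have hp2 : MeasurePreserving e₂ volume volume := by
      convert volume_preserving_funUnique {v : InfinitePlace F // ¬ p v} ℝ
    exact (hp2.symm.lintegral_comp_emb e₂.symm.measurableEmbedding
      fun z => g (e₁.symm (y, z))).symm
  have hn := degree_cast_pos (F := F)
  have h2 : ∀ T (y : logSpace F), toPlaces T y =
      q (y + fun w => w.1.mult * (T / finrank ℚ F))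
        (T + -∑ w, (y + fun w : {w : InfinitePlace F // w ≠ w₀} =>
          (w.1.mult : ℝ) * (T / finrank ℚ F)) w) := fun T y => by
    have hs := sum_mult_cast (F := F)
    rw [Fintype.sum_eq_add_sum_subtype_ne _ w₀] at hs
    funext v
    rw [hq1, toPlaces]
    split_ifs with h
    · subst h
      simp only [Pi.add_apply, Finset.sum_add_distrib, ← Finset.sum_mul]
      rw [show ∑ w : {w : InfinitePlace F // w ≠ w₀}, (w.1.mult : ℝ) =
        finrank ℚ F - (w₀ : InfinitePlace F).mult by linarith]
      field_simp
      ring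
    · rw [Pi.add_apply, add_comm]
  have h3 : ∀ T, ∫⁻ y : logSpace F, g (toPlaces T y) = ∫⁻ y, g (q y (T + -∑ w, y w)) := fun T => by
    simp only [h2]
    exact lintegral_add_right_eq_self (fun y => g (q y (T + -∑ w, y w))) _
  simp only [h3]
  rw [lintegral_lintegral_swap, h1]
  · exact lintegral_congr fun y => lintegral_add_right_eq_self (fun u => g (q y u)) _
  · refine (hg.comp (hq.comp (f := fun p : ℝ × logSpace F => (p.2, p.1 + -∑ w, p.2 w)) ?_)).aemeasurable
    fun_prop

end Coordinates

/-! ### Unfolding the theta average into a sum over lines -/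

section Unfolding

open NumberField NumberField.Units NumberField.Units.dirichletUnitTheorem MeasureTheory
  IsDedekindDomain
open scoped Classical ENNReal

variable {F V : Type*} [Field F] [NumberField F] [AddCommGroup V] [Module F V]
  [Module (𝓞 F) V] [IsScalarTower (𝓞 F) F V] (E : ArakelovBundle F V) (ψ : ℝ → ℝ≥0∞)

/-- The integral of a Gaussian against a function of the degree. -/
def weight (c : IdealGroup F) (x : V) : ℝ≥0∞ :=
  ∫⁻ t : InfinitePlace F → ℝ, ψ (∑ v, t v + Real.log (idealNorm c)) * ENNReal.ofReal (gauss E t x)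

/-- The part of `weight` which comes from a fundamental domain for the units. -/
def unitWeight (c : IdealGroup F) (x : V) : ℝ≥0∞ :=
  ∫⁻ T : ℝ, ∫⁻ y in unitDomain F, ψ (T + Real.log (idealNorm c)) *
    ENNReal.ofReal (gauss E (toPlaces T y) x)

theorem measurable_weight_integrand (hψ : Measurable ψ) (c : IdealGroup F) (x : V) :
    Measurable fun t : InfinitePlace F → ℝ =>
      ψ (∑ v, t v + Real.log (idealNorm c)) * ENNReal.ofReal (gauss E t x) :=
  (hψ.comp (by fun_prop)).mul (continuous_gauss E x).measurable.ennreal_ofReal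

theorem weight_smul (c : IdealGroup F) (a : Fˣ) (x : V) :
    weight E ψ c ((a : F) • x) = weight E ψ (c * toPrincipalIdeal (𝓞 F) F a) x := by
  rw [weight, weight, ← lintegral_add_right_eq_self _ (absShift a)]
  refine lintegral_congr fun t => ?_
  rw [gauss_add_absShift, map_mul, Real.log_mul (idealNorm_pos _).ne' (idealNorm_pos _).ne',
    ← sum_absShift]
  simp only [Pi.add_apply, Finset.sum_add_distrib]
  congr 2
  ring

theorem smul_unit_mem_twist {c : IdealGroup F} (u : (𝓞 F)ˣ) {x : V} :
    (unitToField u : F) • x ∈ twist E c ↔ x ∈ twist E c := by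
  rw [← mem_twist_mul_principal, principal_unit, mul_one]

variable {ψ} in
-- The translates of the fundamental domain by the unit lattice tile logarithmic space, and each
-- translate comes from `w` units.
theorem tsum_unitWeight (hψ : Measurable ψ) (c : IdealGroup F) (x : V) :
    ∑' u : (𝓞 F)ˣ, unitWeight E ψ c ((unitToField u : F) • x) =
      torsionOrder F * weight E ψ c x := by
  have := countable_unitLattice (F := F)
  have h1 : ∀ u : (𝓞 F)ˣ, unitWeight E ψ c ((unitToField u : F) • x) =
      (fun l : logSpace F => ∫⁻ T : ℝ, ∫⁻ y in unitDomain F, ψ (T + Real.log (idealNorm c)) *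
        ENNReal.ofReal (gauss E (toPlaces T (-l + y)) x)) (logEmbedding F (Additive.ofMul u)) :=
    fun u => by
      refine lintegral_congr fun T => lintegral_congr fun y => ?_
      rw [← gauss_add_absShift E (toPlaces T (-logEmbedding F (Additive.ofMul u) + y))
        (unitToField u), absShift_unit, ← toPlaces_add, add_zero,
        neg_add_eq_sub, sub_add_cancel]
  have hm : Measurable fun p : ℝ × logSpace F => ψ (p.1 + Real.log (idealNorm c)) *
      ENNReal.ofReal (gauss E (toPlaces p.1 p.2) x) :=
    (hψ.comp (by fun_prop)).mul
      ((continuous_gauss E x).comp continuous_toPlaces).measurable.ennreal_ofReal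
  rw [tsum_congr h1, tsum_logEmbedding (fun l : logSpace F => ∫⁻ T : ℝ, ∫⁻ y in unitDomain F,
    ψ (T + Real.log (idealNorm c)) * ENNReal.ofReal (gauss E (toPlaces T (-l + y)) x)),
    ← lintegral_tsum]
  · congr 1
    rw [weight, ← lintegral_toPlaces (measurable_weight_integrand E ψ hψ c x)]
    refine lintegral_congr fun T => ?_
    simp only [sum_toPlaces]
    exact (isAddFundamentalDomain_unitDomain.lintegral_eq_tsum'
      fun y => ψ (T + Real.log (idealNorm c)) * ENNReal.ofReal (gauss E (toPlaces T y) x)).symm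
  · intro l
    refine Measurable.aemeasurable ?_
    exact (hm.comp (f := fun p : ℝ × logSpace F => (p.1, -(l : logSpace F) + p.2))
      (by fun_prop)).lintegral_prod_right' (ν := volume.restrict (unitDomain F))

/-- The units of the ring of integers as the kernel of the map to ideals. -/
def unitsEquivKer : (𝓞 F)ˣ ≃ (toPrincipalIdeal (𝓞 F) F).ker :=
  Equiv.ofBijective (fun u => ⟨unitToField u, principal_unit u⟩)
    ⟨fun u v h => by
      have h1 : unitToField u = unitToField v := congrArg Subtype.val h
      refine Units.ext (FaithfulSMul.algebraMap_injective (𝓞 F) F ?_)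
      exact congrArg Units.val h1,
    fun ⟨a, ha⟩ => by
      obtain ⟨u, rfl⟩ := exists_unit_of_principal ha
      exact ⟨u, rfl⟩⟩

variable {ψ} in
-- Pairs of an ideal class and an element of `Fˣ` modulo units enumerate all fractional ideals; the
-- remaining sum over units completes the fundamental domain to the full space.
theorem sum_tsum_unitWeight (hψ : Measurable ψ) (x : V) :
    ∑ κ : IdealClass F, ∑' a : Fˣ, (twist E κ.out).indicator (unitWeight E ψ κ.out) ((a : F) • x) =
      torsionOrder F * ∑' c, (twist E c).indicator (fun x => weight E ψ c x) x := by
  rw [tsum_units_quotient (toPrincipalIdeal (𝓞 F) F), tsum_fintype, Finset.mul_sum]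
  refine Finset.sum_congr rfl fun κ _ => ?_
  rw [tsum_eq_tsum_quotient (toPrincipalIdeal (𝓞 F) F).ker, ← ENNReal.tsum_mul_left]
  refine tsum_congr fun q => ?_
  rw [← unitsEquivKer.tsum_eq]
  have h : ∀ u : (𝓞 F)ˣ, (((q.out * (unitsEquivKer u : (toPrincipalIdeal (𝓞 F) F).ker) : Fˣ) : F) • x) =
      (unitToField u : F) • (q.out : F) • x := fun u => by
    rw [smul_smul, mul_comm]
    rfl
  simp only [h]
  by_cases hx : (q.out : F) • x ∈ twist E κ.out
  · rw [Set.indicator_of_mem (mem_twist_mul_principal E |>.2 hx), ← weight_smul,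
      ← tsum_unitWeight E hψ]
    exact tsum_congr fun u => Set.indicator_of_mem ((smul_unit_mem_twist E u).2 hx) _
  · rw [Set.indicator_of_notMem (fun h => hx (mem_twist_mul_principal E |>.1 h)), mul_zero,
      ENNReal.tsum_eq_zero]
    exact fun u => Set.indicator_of_notMem (fun h => hx ((smul_unit_mem_twist E u).1 h)) _

/-- The logarithmic norms of a vector. -/
def normShift (x : V) (v : InfinitePlace F) : ℝ := v.mult * Real.log (E.infNorm v x)

theorem gauss_add_normShift (t : InfinitePlace F → ℝ) {x : V} (hx : x ≠ 0) :
    gauss E (t + normShift E x) x =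
      ∏ v : InfinitePlace F, Real.exp (-(v.mult * Real.pi * Real.exp (-(2 / v.mult) * t v))) := by
  rw [gauss, energy, Finset.mul_sum, Real.exp_sum]
  refine Finset.prod_congr rfl fun v _ => ?_
  have h0 := infNorm_pos E v hx
  have h1 : -(2 / (v.mult : ℝ)) * (t + normShift E x) v =
      -(2 / (v.mult : ℝ)) * t v + -(2 * Real.log (E.infNorm v x)) := by
    have := (mult_cast_pos v).ne'
    rw [Pi.add_apply, normShift]
    field_simp
    ring
  have h2 : Real.exp (-(2 * Real.log (E.infNorm v x))) = (E.infNorm v x ^ 2)⁻¹ := by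
    rw [Real.exp_neg, show (2 : ℝ) = ((2 : ℕ) : ℝ) by norm_num, ← Real.log_pow,
      Real.exp_log (by positivity)]
  rw [h1, Real.exp_add, h2]
  field_simp

/-- A vector lies in the lattice twisted by an ideal exactly when that ideal is contained in the
ideal of the vector, which then cancels. -/
theorem mem_twist_mul_sectionUnit {x : V} (hx : x ≠ 0) {c : IdealGroup F} :
    x ∈ twist E (c * sectionUnit E hx) ↔ c.1 ≤ 1 := by
  have h1 : x ∈ twist E (c * sectionUnit E hx) ↔ (c * sectionUnit E hx).1 ≤ (sectionUnit E hx).1 :=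
    Iff.rfl
  rw [h1, Units.val_mul]
  constructor
  · intro h
    have h2 := mul_le_mul_left h ((sectionUnit E hx)⁻¹).1
    rwa [mul_assoc, Units.mul_inv, mul_one] at h2
  · exact fun h => mul_le_of_le_one_left' h

theorem log_sectionHeight {x : V} (hx : x ≠ 0) :
    Real.log (sectionHeight E hx) = ∑ v, normShift E x v + Real.log (idealNorm (sectionUnit E hx)) := by
  rw [sectionHeight, Real.log_mul _ (idealNorm_pos _).ne', Real.log_prod]
  · simp only [normShift, Real.log_pow]
  · exact fun v _ => (pow_pos (infNorm_pos E v hx) _).ne'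
  · exact (Finset.prod_pos fun v _ => pow_pos (infNorm_pos E v hx) _).ne'

/-- Countability makes the counting measure σ-finite and lets measurability be checked one finite
divisor at a time. -/
theorem countable_divisors : Countable (HeightOneSpectrum (𝓞 F) →₀ ℤ) := by
  have h1 : Countable F := (finBasis ℚ F).equivFun.injective.countable
  have h2 : Countable (𝓞 F) := (FaithfulSMul.algebraMap_injective (𝓞 F) F).countable
  have h3 : Countable (Ideal (𝓞 F)) := by
    refine Function.Surjective.countable (f := fun s : Finset (𝓞 F) => Ideal.span (s : Set (𝓞 F)))
      fun I => ?_
    exact (IsNoetherian.noetherian I)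
  have h4 : Countable (HeightOneSpectrum (𝓞 F)) :=
    Function.Injective.countable (f := HeightOneSpectrum.asIdeal) fun v w h =>
      HeightOneSpectrum.ext h
  infer_instance

theorem lintegral_haar (g : ArakelovDivisor F → ℝ≥0∞)
    (hg : ∀ D, Measurable fun t => g (t, D)) :
    letI : MeasurableSpace (HeightOneSpectrum (𝓞 F) →₀ ℤ) := ⊤
    ∫⁻ D, g D ∂(ArakelovDivisor.haar F) = ∑' c : IdealGroup F, ∫⁻ t, g (t, idealEquiv c) := by
  let : MeasurableSpace (HeightOneSpectrum (𝓞 F) →₀ ℤ) := ⊤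
  have : MeasurableSingletonClass (HeightOneSpectrum (𝓞 F) →₀ ℤ) := ⟨fun _ => trivial⟩
  have := countable_divisors (F := F)
  rw [idealEquiv.tsum_eq fun D => ∫⁻ t, g (t, D), ArakelovDivisor.haar, lintegral_prod_symm',
    lintegral_count]
  exact measurable_from_prod_countable_left hg

theorem measurable_effectivity (D : HeightOneSpectrum (𝓞 F) →₀ ℤ) :
    Measurable fun t : InfinitePlace F → ℝ => ArakelovDivisor.effectivity ((t, D) : ArakelovDivisor F) := by
  unfold ArakelovDivisor.effectivity
  by_cases h : 0 ≤ D
  · simp only [h, if_true]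
    fun_prop
  · simp only [h, if_false]
    fun_prop

theorem measurable_degree (D : HeightOneSpectrum (𝓞 F) →₀ ℤ) :
    Measurable fun t : InfinitePlace F → ℝ => ArakelovDivisor.degree ((t, D) : ArakelovDivisor F) := by
  unfold ArakelovDivisor.degree
  dsimp only
  exact Measurable.add_const (f := fun t : InfinitePlace F → ℝ => ∑ v, t v) (by fun_prop) _

variable {ψ} in
-- Translation by the divisor of `x`: multiplying `c` by the ideal of `x` turns membership of `x`
-- into integrality, and shifting `t` by the logarithmic norms of `x` turns the Gaussian into the
-- effectivity. The degree moves by the logarithm of the height.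
theorem tsum_weight (hψ : Measurable ψ) {x : V} (hx : x ≠ 0) :
    letI : MeasurableSpace (HeightOneSpectrum (𝓞 F) →₀ ℤ) := ⊤
    ∑' c, (twist E c).indicator (fun x => weight E ψ c x) x =
      ∫⁻ D, ψ (ArakelovDivisor.degree D + Real.log (sectionHeight E hx)) *
        ENNReal.ofReal (ArakelovDivisor.effectivity D) ∂(ArakelovDivisor.haar F) := by
  rw [lintegral_haar _ fun D => (hψ.comp ((measurable_degree D).add_const _)).mul
    (measurable_effectivity D).ennreal_ofReal, ← (Equiv.mulRight (sectionUnit E hx)).tsum_eq]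
  refine tsum_congr fun c => ?_
  simp only [degree_eq, ArakelovDivisor.effectivity, idealEquiv_nonneg]
  rw [Equiv.coe_mulRight]
  by_cases hc : c.1 ≤ 1
  · rw [Set.indicator_of_mem ((mem_twist_mul_sectionUnit E hx).2 hc), weight,
      ← lintegral_add_right_eq_self _ (normShift E x)]
    refine lintegral_congr fun t => ?_
    rw [if_pos hc, gauss_add_normShift E t hx, log_sectionHeight, map_mul,
      Real.log_mul (idealNorm_pos _).ne' (idealNorm_pos _).ne']
    simp only [Pi.add_apply, Finset.sum_add_distrib]
    congr 2
    ring
  · rw [Set.indicator_of_notMem (fun h => hc ((mem_twist_mul_sectionUnit E hx).1 h))]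
    simp [hc]

variable [FiniteDimensional F V]

theorem ofReal_theta_sub_one (c : IdealGroup F) (t : InfinitePlace F → ℝ) :
    ENNReal.ofReal (theta E c t - 1) =
      ∑' x : twist E c, if (x : V) = 0 then 0 else ENNReal.ofReal (gauss E t x) := by
  have h0 : ∀ x : twist E c, 0 ≤ if (x : V) = 0 then 0 else gauss E t x := fun x => by
    split_ifs
    · rfl
    · exact (gauss_pos E t x).le
  rw [theta_eq_one_add, add_sub_cancel_left, ENNReal.ofReal_tsum_of_nonneg h0]
  · refine tsum_congr fun x => ?_
    split_ifs <;> simp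
  · refine (summable_gauss E c t).of_nonneg_of_le h0 fun x => ?_
    split_ifs
    · exact (gauss_pos E t x).le
    · rfl

theorem countable_twist (c : IdealGroup F) : Countable (twist E c) := by
  obtain ⟨-, -, φ, -⟩ := exists_twist_coordinates E c
  exact φ.symm.injective.countable

theorem ofReal_thetaMean_sub (c : IdealGroup F) (T : ℝ) :
    ENNReal.ofReal (thetaMean E c T - regulator F) = ∑' x : twist E c, if (x : V) = 0 then 0 else
      ∫⁻ y in unitDomain F,
        ENNReal.ofReal (gauss E (toPlaces (T - Real.log (idealNorm c)) y) x) := by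
  have := countable_twist E c
  have hm : ∀ x : twist E c, Measurable fun y : logSpace F =>
      ENNReal.ofReal (gauss E (toPlaces (T - Real.log (idealNorm c)) y) x) := fun x =>
    ((continuous_gauss E (x : V)).comp (continuous_toPlaces.comp
      (Continuous.prodMk_right _))).measurable.ennreal_ofReal
  have hi : Integrable (fun y => theta E c (toPlaces (T - Real.log (idealNorm c)) y) - 1)
      (volume.restrict (unitDomain F)) :=
    (integrableOn_theta E c _).sub (integrableOn_const volume_unitDomain_lt_top.ne)
  rw [thetaMean_sub_regulator, ofReal_integral_eq_lintegral_ofReal hi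
    (Filter.Eventually.of_forall fun y => sub_nonneg.2 (one_le_theta E c _))]
  simp only [ofReal_theta_sub_one]
  rw [lintegral_tsum]
  · refine tsum_congr fun x => ?_
    split_ifs <;> simp
  · intro x
    split_ifs
    · exact aemeasurable_const
    · exact (hm x).aemeasurable

variable {ψ} in
-- Subtracting the regulator removes exactly the zero vector, whose Gaussian is `1` on a domain of
-- volume `R`. Tonelli distributes the rest over the lines and their scalars.
theorem lintegral_thetaMean (hψ : Measurable ψ) (c : IdealGroup F) :
    ∫⁻ T, ψ T * ENNReal.ofReal (thetaMean E c T - regulator F) =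
      ∑' P : ℙ F V, ∑' a : Fˣ, (twist E c).indicator (unitWeight E ψ c) ((a : F) • P.rep) := by
  have := countable_twist E c
  have hm : ∀ x : V, Measurable fun p : ℝ × logSpace F =>
      ENNReal.ofReal (gauss E (toPlaces p.1 p.2) x) := fun x =>
    ((continuous_gauss E (x : V)).comp continuous_toPlaces).measurable.ennreal_ofReal
  have h1 : ∀ x : V, ∫⁻ T, ψ T * ∫⁻ y in unitDomain F,
        ENNReal.ofReal (gauss E (toPlaces (T - Real.log (idealNorm c)) y) x) =
      unitWeight E ψ c x := fun x => by
    rw [← lintegral_add_right_eq_self _ (Real.log (idealNorm c)), unitWeight]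
    refine lintegral_congr fun T => ?_
    rw [add_sub_cancel_right, lintegral_const_mul]
    exact ((continuous_gauss E x).comp (continuous_toPlaces.comp
      (Continuous.prodMk_right T))).measurable.ennreal_ofReal
  rw [← tsum_nonzero fun x => (twist E c).indicator (unitWeight E ψ c) x]
  have h2 : ∑' x, (if x = 0 then 0 else (twist E c).indicator (unitWeight E ψ c) x) =
      ∑' x : twist E c, if (x : V) = 0 then 0 else unitWeight E ψ c x := by
    rw [tsum_subtype (twist E c) fun x => if x = 0 then 0 else unitWeight E ψ c x]
    refine tsum_congr fun x => ?_
    by_cases hx : x = 0 <;> simp [Set.indicator_apply, hx]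
  rw [h2]
  simp only [ofReal_thetaMean_sub, ← ENNReal.tsum_mul_left]
  rw [lintegral_tsum]
  · refine tsum_congr fun x => ?_
    split_ifs
    · simp
    · exact h1 x
  · intro x
    split_ifs
    · exact aemeasurable_const.congr (Filter.Eventually.of_forall fun _ => (mul_zero _).symm)
    · refine (hψ.mul ?_).aemeasurable
      exact ((hm x).comp (f := fun p : ℝ × logSpace F => (p.1 - Real.log (idealNorm c), p.2))
        (by fun_prop)).lintegral_prod_right' (ν := volume.restrict (unitDomain F))

theorem regulator_le_thetaMean (c : IdealGroup F) (T : ℝ) : regulator F ≤ thetaMean E c T := by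
  rw [← sub_nonneg, thetaMean_sub_regulator]
  exact setIntegral_nonneg measurableSet_unitDomain fun y _ => sub_nonneg.2 (one_le_theta E c _)

theorem thetaTotal_sub (T : ℝ) :
    thetaTotal E T - classNumber F * regulator F =
      ∑ κ : IdealClass F, (thetaMean E κ.out T - regulator F) := by
  rw [Finset.sum_sub_distrib, Finset.sum_const, Finset.card_univ, card_idealClass, nsmul_eq_mul]
  rfl

theorem thetaTotal_sub_nonneg (T : ℝ) : 0 ≤ thetaTotal E T - classNumber F * regulator F := by
  rw [thetaTotal_sub]
  exact Finset.sum_nonneg fun κ _ => sub_nonneg.2 (regulator_le_thetaMean E _ _)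

variable {ψ} in
/-- The unfolding of the height zeta function. -/
theorem lintegral_thetaTotal (hψ : Measurable ψ) :
    letI : MeasurableSpace (HeightOneSpectrum (𝓞 F) →₀ ℤ) := ⊤
    ∫⁻ T, ψ T * ENNReal.ofReal (thetaTotal E T - classNumber F * regulator F) =
      torsionOrder F * ∑' P : ℙ F V, ∫⁻ D, ψ (ArakelovDivisor.degree D + Real.log (E.height P)) *
        ENNReal.ofReal (ArakelovDivisor.effectivity D) ∂(ArakelovDivisor.haar F) := by
  have hm : ∀ κ : IdealClass F, Measurable fun T =>
      ψ T * ENNReal.ofReal (thetaMean E κ.out T - regulator F) := fun κ =>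
    hψ.mul (((continuous_thetaMean E κ.out).measurable.sub_const _).ennreal_ofReal)
  simp only [thetaTotal_sub, ENNReal.ofReal_sum_of_nonneg fun (κ : IdealClass F) _ =>
    sub_nonneg.2 (regulator_le_thetaMean E κ.out _), Finset.mul_sum]
  rw [lintegral_finsetSum _ fun κ _ => hm κ]
  simp only [lintegral_thetaMean E hψ]
  rw [← Summable.tsum_finsetSum fun κ _ => ENNReal.summable, ← ENNReal.tsum_mul_left]
  refine tsum_congr fun P => ?_
  rw [sum_tsum_unitWeight E hψ, tsum_weight E hψ P.rep_nonzero,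
    height_eq E P P.rep_nonzero]
  rw [Projectivization.submodule_eq]
  exact Submodule.mem_span_singleton_self _

end Unfolding

/-! ### The Mellin transform as a product of zeta functions -/

section Mellin

open NumberField NumberField.Units MeasureTheory IsDedekindDomain
open scoped ENNReal

variable {F V : Type*} [Field F] [NumberField F] [AddCommGroup V] [Module F V]
  [Module (𝓞 F) V] [IsScalarTower (𝓞 F) F V] (E : ArakelovBundle F V)

/-- The discrete measurable structure on the group of finite divisors. -/
abbrev finiteDivisorMeasurableSpace (F : Type*) [Field F] [NumberField F] :
    MeasurableSpace (HeightOneSpectrum (𝓞 F) →₀ ℤ) := ⊤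

attribute [local instance] finiteDivisorMeasurableSpace

instance : MeasurableSingletonClass (HeightOneSpectrum (𝓞 F) →₀ ℤ) := ⟨fun _ => trivial⟩

theorem measurable_divisor_degree : Measurable (ArakelovDivisor.degree (F := F)) :=
  have := countable_divisors (F := F)
  measurable_from_prod_countable_left measurable_degree

theorem measurable_divisor_effectivity : Measurable (ArakelovDivisor.effectivity (F := F)) :=
  have := countable_divisors (F := F)
  measurable_from_prod_countable_left measurable_effectivity

theorem effectivity_nonneg (D : ArakelovDivisor F) : 0 ≤ D.effectivity := by
  unfold ArakelovDivisor.effectivity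
  split_ifs
  · exact Finset.prod_nonneg fun v _ => (Real.exp_pos _).le
  · rfl

/-- The distribution of the degree of divisors weighted by their effectivity. -/
def degreeMeasure (F : Type*) [Field F] [NumberField F] : Measure ℝ :=
  ((ArakelovDivisor.haar F).withDensity fun D => ENNReal.ofReal D.effectivity).map
    ArakelovDivisor.degree

theorem lintegral_degreeMeasure {ψ : ℝ → ℝ≥0∞} (hψ : Measurable ψ) :
    ∫⁻ T, ψ T ∂(degreeMeasure F) =
      ∫⁻ D, ψ D.degree * ENNReal.ofReal D.effectivity ∂(ArakelovDivisor.haar F) := by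
  rw [degreeMeasure, lintegral_map hψ measurable_divisor_degree]
  refine (lintegral_withDensity_eq_lintegral_mul (ArakelovDivisor.haar F)
    measurable_divisor_effectivity.ennreal_ofReal (hψ.comp measurable_divisor_degree)).trans ?_
  exact lintegral_congr fun D => mul_comm _ _

theorem measurable_cexp (s : ℂ) : Measurable fun T : ℝ => Complex.exp (-(s * T)) := by fun_prop

theorem norm_cpow (D : ArakelovDivisor F) (s : ℂ) :
    (D.norm : ℂ) ^ (-s) = Complex.exp (-(s * D.degree)) := by
  rw [ArakelovDivisor.norm, Complex.ofReal_exp,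
    Complex.cpow_def_of_ne_zero (Complex.exp_ne_zero _), ← Complex.ofReal_exp,
    ← Complex.ofReal_log (Real.exp_pos _).le, Real.log_exp]
  congr 1
  ring

theorem completedDedekindXi_eq (s : ℂ) :
    completedDedekindXi F s = ∫ T : ℝ, Complex.exp (-(s * T)) ∂(degreeMeasure F) := by
  rw [degreeMeasure, integral_map measurable_divisor_degree.aemeasurable
    (measurable_cexp s).aestronglyMeasurable, integral_withDensity_eq_integral_toReal_smul
    measurable_divisor_effectivity.ennreal_ofReal
    (Filter.Eventually.of_forall fun D => ENNReal.ofReal_lt_top)]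
  refine integral_congr_ae (Filter.Eventually.of_forall fun D => ?_)
  dsimp only
  rw [norm_cpow, ENNReal.toReal_ofReal (effectivity_nonneg D), Complex.real_smul, mul_comm]

variable [FiniteDimensional F V]

/-- The density of the theta integral of a bundle. -/
def thetaDensity (T : ℝ) : ℝ≥0∞ :=
  ENNReal.ofReal (thetaTotal E T - classNumber F * regulator F)

theorem measurable_thetaDensity : Measurable (thetaDensity E) :=
  ((continuous_thetaTotal E).measurable.sub_const _).ennreal_ofReal

/-- The unfolding tested on indicator functions. As an identity of measures it can be applied to the
complex function `e^(-sT)`, and integrability for the left side passes to every translate on the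
right. -/
theorem withDensity_thetaDensity :
    volume.withDensity (thetaDensity E) = (torsionOrder F : ℝ≥0∞) • Measure.sum fun P : ℙ F V =>
      (degreeMeasure F).map (· + Real.log (E.height P)) := by
  ext s hs
  have hψ : Measurable (s.indicator (1 : ℝ → ℝ≥0∞)) := measurable_one.indicator hs
  have h := lintegral_thetaTotal E hψ
  rw [withDensity_apply _ hs, Measure.smul_apply, Measure.sum_apply _ hs, smul_eq_mul,
    ← lintegral_indicator hs]
  refine Eq.trans (lintegral_congr fun T => ?_) (h.trans ?_)
  · by_cases hT : T ∈ s <;> simp [hT, thetaDensity]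
  · congr 1
    refine tsum_congr fun P => ?_
    rw [← lintegral_indicator_one hs, lintegral_map hψ (measurable_add_const _),
      lintegral_degreeMeasure (ψ := fun T => s.indicator 1 (T + Real.log (E.height P)))
        (hψ.comp (measurable_add_const _))]

/-- The substitution `X = |Δ|^(1/2) e^(-T)` turns the Mellin transform into a Laplace transform in
the degree; the centring produces the power of `|Δ|`. -/
theorem integral_thetaDensity {s m : ℂ} (h : HasMellin (fun X : ℝ =>
      (thetaTotal E (Real.log |(discr F : ℝ)| / 2 - Real.log X) : ℂ) -
        ((classNumber F * regulator F : ℝ) : ℂ)) s m) :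
    Integrable (fun T : ℝ => Complex.exp (-(s * T))) (volume.withDensity (thetaDensity E)) ∧
      ((|(discr F : ℝ)| : ℝ) : ℂ) ^ (s / 2) *
        ∫ T : ℝ, Complex.exp (-(s * T)) ∂(volume.withDensity (thetaDensity E)) = m := by
  have h0 : 0 < |(discr F : ℝ)| := abs_pos.2 (by exact_mod_cast discr_ne_zero F)
  set L := Real.log |(discr F : ℝ)| with hL
  set φ : ℝ → ℝ := fun T => Real.exp (L / 2 - T) with hφ
  have himg : φ '' Set.univ = Set.Ioi 0 := by
    rw [Set.image_univ]
    ext X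
    refine ⟨fun ⟨T, hT⟩ => hT ▸ Real.exp_pos _, fun hX => ⟨L / 2 - Real.log X, ?_⟩⟩
    rw [hφ]
    dsimp only
    rw [sub_sub_cancel, Real.exp_log hX]
  have hder : ∀ T ∈ Set.univ, HasDerivWithinAt φ (-φ T) Set.univ T := fun T _ => by
    have h1 := ((hasDerivAt_id T).const_sub (L / 2)).exp
    rw [hasDerivWithinAt_univ]
    simpa [hφ] using h1
  have hinj : Set.InjOn φ Set.univ := fun T _ T' _ hTT => by
    have := Real.exp_injective hTT
    linarith
  obtain ⟨hint, hval⟩ := h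
  rw [MellinConvergent, ← himg, integrableOn_image_iff_integrableOn_abs_deriv_smul
    MeasurableSet.univ hder hinj, integrableOn_univ] at hint
  rw [mellin, ← himg, integral_image_eq_integral_abs_deriv_smul MeasurableSet.univ hder hinj,
    Measure.restrict_univ] at hval
  have hpow : ((|(discr F : ℝ)| : ℝ) : ℂ) ^ (s / 2) = Complex.exp (L / 2 * s) := by
    rw [Complex.cpow_def_of_ne_zero (by exact_mod_cast h0.ne'), ← Complex.ofReal_log h0.le]
    congr 1
    ring
  have hfun : ∀ T : ℝ, |-φ T| • (((φ T : ℝ) : ℂ) ^ (s - 1) •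
      ((thetaTotal E (L / 2 - Real.log (φ T)) : ℂ) - ((classNumber F * regulator F : ℝ) : ℂ))) =
      Complex.exp (L / 2 * s) * ((thetaDensity E T).toReal • Complex.exp (-(s * T))) := fun T => by
    have hφ0 : 0 < φ T := Real.exp_pos _
    have h1 : (φ T : ℂ) * (φ T : ℂ) ^ (s - 1) = Complex.exp (L / 2 * s) * Complex.exp (-(s * T)) := by
      rw [← Complex.exp_add, Complex.cpow_sub _ _ (by exact_mod_cast hφ0.ne'), Complex.cpow_one,
        mul_div_cancel₀ _ (by exact_mod_cast hφ0.ne'),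
        Complex.cpow_def_of_ne_zero (by exact_mod_cast hφ0.ne'), ← Complex.ofReal_log hφ0.le, hφ]
      dsimp only
      rw [Real.log_exp]
      push_cast
      congr 1
      ring
    rw [thetaDensity, ENNReal.toReal_ofReal (thetaTotal_sub_nonneg E T), abs_neg, abs_of_pos hφ0,
      Complex.real_smul, Complex.real_smul, smul_eq_mul, ← mul_assoc, h1,
      show Real.log (φ T) = L / 2 - T from Real.log_exp _, sub_sub_cancel]
    push_cast
    ring
  simp only [hfun] at hint hval
  have hexp : Complex.exp (L / 2 * s) ≠ 0 := Complex.exp_ne_zero _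
  constructor
  · rw [integrable_withDensity_iff_integrable_smul' (measurable_thetaDensity E)
      (Filter.Eventually.of_forall fun T => ENNReal.ofReal_lt_top)]
    exact (integrable_const_mul_iff hexp.isUnit _).1 hint
  · rw [integral_withDensity_eq_integral_toReal_smul (measurable_thetaDensity E)
      (Filter.Eventually.of_forall fun T => ENNReal.ofReal_lt_top), hpow, ← hval]
    exact (integral_const_mul _ _).symm

theorem height_pos (P : ℙ F V) : 0 < E.height P := by
  rw [height_eq E P P.rep_nonzero]
  · exact sectionHeight_pos E _
  · rw [Projectivization.submodule_eq]
    exact Submodule.mem_span_singleton_self _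

theorem height_cpow (P : ℙ F V) (s : ℂ) :
    (E.height P : ℂ) ^ (-s) = Complex.exp (-(s * Real.log (E.height P))) := by
  have h := height_pos E P
  rw [Complex.cpow_def_of_ne_zero (by exact_mod_cast h.ne'), ← Complex.ofReal_log h.le]
  congr 1
  ring

/-- The Mellin transform of the theta integral is the product of the zeta functions. -/
theorem hasSum_height_mul_xi {s m : ℂ} (h : HasMellin (fun X : ℝ =>
      (thetaTotal E (Real.log |(discr F : ℝ)| / 2 - Real.log X) : ℂ) -
        ((classNumber F * regulator F : ℝ) : ℂ)) s m) :
    (Nonempty (ℙ F V) → Integrable (fun T : ℝ => Complex.exp (-(s * T))) (degreeMeasure F)) ∧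
    HasSum (fun P : ℙ F V => torsionOrder F * ((|(discr F : ℝ)| : ℝ) : ℂ) ^ (s / 2) *
      completedDedekindXi F s * (E.height P : ℂ) ^ (-s)) m := by
  obtain ⟨h1, h2⟩ := integral_thetaDensity E h
  have hw : (torsionOrder F : ℝ≥0∞) ≠ 0 := by exact_mod_cast torsionOrder_ne_zero F
  rw [withDensity_thetaDensity, integrable_smul_measure hw (ENNReal.natCast_ne_top _)] at h1
  rw [withDensity_thetaDensity, integral_smul_measure, ENNReal.toReal_natCast] at h2
  have hae : ∀ P : ℙ F V, AEStronglyMeasurable (fun T : ℝ => Complex.exp (-(s * T)))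
      ((degreeMeasure F).map (· + Real.log (E.height P))) := fun P =>
    (measurable_cexp s).aestronglyMeasurable
  have hsplit : ∀ (P : ℙ F V) (T : ℝ), Complex.exp (-(s * ((T + Real.log (E.height P) : ℝ) : ℂ))) =
      (E.height P : ℂ) ^ (-s) * Complex.exp (-(s * T)) := fun P T => by
    rw [height_cpow, ← Complex.exp_add]
    push_cast
    congr 1
    ring
  constructor
  -- A single line suffices: its translate of `degreeMeasure` is dominated by the sum, and undoing
  -- the translation costs only the nonzero factor `H(P)^(-s)`.
  · rintro ⟨P⟩
    have h3 := h1.mono_measure (Measure.le_sum (fun P : ℙ F V =>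
      (degreeMeasure F).map (· + Real.log (E.height P))) P)
    rw [integrable_map_measure (hae P) (measurable_add_const _).aemeasurable] at h3
    have h4 : (fun T : ℝ => Complex.exp (-(s * T))) ∘ (· + Real.log (E.height P)) =
        fun T : ℝ => (E.height P : ℂ) ^ (-s) * Complex.exp (-(s * T)) := funext (hsplit P)
    rw [h4] at h3
    refine (integrable_const_mul_iff (IsUnit.mk0 _ ?_) _).1 h3
    rw [height_cpow]
    exact Complex.exp_ne_zero _
  · have h3 := hasSum_integral_measure h1
    have h4 : ∀ P : ℙ F V, ∫ T : ℝ, Complex.exp (-(s * T))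
        ∂((degreeMeasure F).map (· + Real.log (E.height P))) =
        (E.height P : ℂ) ^ (-s) * completedDedekindXi F s := fun P => by
      rw [integral_map (measurable_add_const _).aemeasurable (hae P), completedDedekindXi_eq,
        ← integral_const_mul]
      exact integral_congr_ae (Filter.Eventually.of_forall (hsplit P))
    simp only [h4] at h3
    have h5 := h3.mul_left (torsionOrder F * ((|(discr F : ℝ)| : ℝ) : ℂ) ^ (s / 2))
    have h6 : (torsionOrder F * ((|(discr F : ℝ)| : ℝ) : ℂ) ^ (s / 2)) *
        ∫ T : ℝ, Complex.exp (-(s * T)) ∂(Measure.sum fun P : ℙ F V =>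
          (degreeMeasure F).map (· + Real.log (E.height P))) = m := by
      rw [← h2, Complex.real_smul]
      push_cast
      ring
    rw [h6] at h5
    refine h5.congr_fun fun P => ?_
    ring

end Mellin

/-! ### Nonvanishing of multiplicative sums -/

section Euler

open Finset

/-- An absolutely convergent sum of a multiplicative function over a free commutative monoid does
not vanish. -/
theorem tsum_ne_zero_of_multiplicative {α : Type*} (f : (α →₀ ℕ) → ℂ) (h0 : f 0 = 1)
    (hmul : ∀ D D', f (D + D') = f D * f D') (hs : Summable f) : ∑' D, f D ≠ 0 := by
  classical
  intro hzero
  let g : Finset α → (α →₀ ℕ) → ℂ := fun S D => if ∀ p ∈ S, D p = 0 then f D else 0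
  have hn : Summable fun D => ‖f D‖ := hs.norm
  have hg : ∀ S, Summable (g S) := fun S => by
    refine .of_norm_bounded hn fun D => ?_
    dsimp only [g]
    split_ifs
    · rfl
    · simp
  -- The sieve: the terms in which `p` occurs add up to `f(p)` times the sum for `S`, so a vanishing
  -- sum stays zero when they are removed.
  have hA : ∀ S, ∑' D, g S D = 0 := fun S => by
    induction S using Finset.induction_on with
    | empty => simpa [g] using hzero
    | insert p S hp ih =>
      have hinj : Function.Injective fun D : α →₀ ℕ => D + Finsupp.single p 1 :=
        add_left_injective _
      have h1 : ∀ D, g S D = g (insert p S) D + (if D p = 0 then 0 else g S D) := fun D => by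
        by_cases h : D p = 0 <;> simp [g, h]
      have h2 : ∑' D, (if D p = 0 then 0 else g S D) = ∑' D, f (Finsupp.single p 1) * g S D := by
        rw [← hinj.tsum_eq]
        · refine tsum_congr fun D => ?_
          have h3 : ∀ q ∈ S, (Finsupp.single p 1 : α →₀ ℕ) q = 0 := fun q hq =>
            Finsupp.single_eq_of_ne fun h => hp (h ▸ hq)
          have h4 : (∀ q ∈ S, (D + Finsupp.single p 1 : α →₀ ℕ) q = 0) ↔ ∀ q ∈ S, D q = 0 :=
            forall₂_congr fun q hq => by rw [Finsupp.add_apply, h3 q hq, add_zero]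
          have h5 : (D + Finsupp.single p 1 : α →₀ ℕ) p ≠ 0 := by simp
          dsimp only [g]
          rw [if_neg h5, if_congr h4 rfl rfl, hmul, mul_ite, mul_zero, mul_comm]
        · intro D hD
          have hDp : D p ≠ 0 := fun h => hD (by simp [h])
          refine ⟨D - Finsupp.single p 1, tsub_add_cancel_of_le ?_⟩
          rw [Finsupp.single_le_iff]
          omega
      have h5 : Summable fun D => if D p = 0 then 0 else g S D := by
        refine .of_norm_bounded (hg S).norm fun D => ?_
        split_ifs
        · simp
        · rfl
      have h6 := (hg (insert p S)).tsum_add h5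
      rw [← tsum_congr h1, h2, tsum_mul_left, ih, mul_zero, add_zero] at h6
      exact h6.symm
  -- `T` contains `0` and carries all but less than `1` of the total norm. After sieving by every
  -- prime occurring in `T`, only `0` survives from `T`, so the other terms have sum of norm less
  -- than `1`; yet that sum must be `-f(0) = -1`.
  obtain ⟨T, hT⟩ := ((hn.hasSum.eventually (lt_mem_nhds (sub_one_lt _))).and
    (Filter.eventually_ge_atTop {0})).exists
  have h8 := (hg (T.biUnion Finsupp.support)).tsum_eq_add_tsum_ite 0
  rw [hA] at h8
  have h9 : g (T.biUnion Finsupp.support) 0 = 1 := by simp [g, h0]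
  have h10 : ‖∑' D, if D = 0 then 0 else g (T.biUnion Finsupp.support) D‖ < 1 := by
    have h11 : HasSum (fun D => if D ∈ T then 0 else ‖f D‖) (∑' D, ‖f D‖ - ∑ D ∈ T, ‖f D‖) := by
      have h12 := hn.hasSum.sub (hasSum_sum_of_ne_finset_zero
        (f := fun D => if D ∈ T then ‖f D‖ else 0) (s := T) fun D hD => if_neg hD)
      rw [Finset.sum_congr rfl fun D hD => if_pos hD] at h12
      refine h12.congr_fun fun D => ?_
      split_ifs <;> simp
    refine (tsum_of_norm_bounded h11 fun D => ?_).trans_lt (by linarith [hT.1])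
    by_cases hD : D = 0
    · rw [if_pos hD, norm_zero]
      split_ifs
      · rfl
      · exact norm_nonneg _
    rw [if_neg hD]
    dsimp only [g]
    by_cases hDT : D ∈ T
    · rw [if_pos hDT, if_neg, norm_zero]
      intro h
      refine hD (Finsupp.ext fun q => ?_)
      by_contra hq
      exact hq (h q (Finset.mem_biUnion.2 ⟨D, hDT, Finsupp.mem_support_iff.2 hq⟩))
    · rw [if_neg hDT]
      split_ifs
      · rfl
      · simp
  have h13 : ∑' D, (if D = 0 then 0 else g (T.biUnion Finsupp.support) D) = -1 := by
    rw [h9] at h8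
    exact (eq_neg_of_add_eq_zero_right h8.symm)
  rw [h13] at h10
  simp at h10

end Euler

/-! ### The archimedean local integral -/

section Gamma

open MeasureTheory

/-- The archimedean factor of the completed zeta function. -/
theorem integral_cexp_mul_exp_exp {m : ℝ} (hm : 0 < m) {s : ℂ} (hs : 0 < s.re) :
    ∫ t : ℝ, Complex.exp (-(s * t)) * ((Real.exp (-(m * Real.pi * Real.exp (-(2 / m) * t))) : ℝ) : ℂ)
      ≠ 0 := by
  -- The substitution `X = exp (-2 t / m)` reduces the integral to `Γ(m s / 2)` times a nonzero
  -- power.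
  set φ : ℝ → ℝ := fun t => Real.exp (-(2 / m) * t) with hφ
  have hc : 0 < 2 / m := by positivity
  have himg : φ '' Set.univ = Set.Ioi 0 := by
    rw [Set.image_univ]
    ext X
    refine ⟨fun ⟨T, hT⟩ => hT ▸ Real.exp_pos _, fun hX => ⟨-(m / 2) * Real.log X, ?_⟩⟩
    rw [hφ]
    dsimp only
    rw [← mul_assoc, show -(2 / m) * -(m / 2) = 1 by field_simp, one_mul, Real.exp_log hX]
  have hder : ∀ T ∈ Set.univ, HasDerivWithinAt φ (-(2 / m) * φ T) Set.univ T := fun T _ => by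
    have h1 := ((hasDerivAt_id T).const_mul (-(2 / m))).exp
    rw [hasDerivWithinAt_univ]
    simpa [hφ, mul_comm] using h1
  have hinj : Set.InjOn φ Set.univ := fun T _ T' _ hTT => by
    have := Real.exp_injective hTT
    exact mul_left_cancel₀ (neg_ne_zero.2 hc.ne') this
  have h1 := Complex.integral_cpow_mul_exp_neg_mul_Ioi (a := m / 2 * s) (r := m * Real.pi)
    (by
      rw [show ((m : ℂ) / 2 * s) = ((m / 2 : ℝ) : ℂ) * s by push_cast; ring, Complex.re_ofReal_mul]
      positivity)
    (by positivity)
  rw [← himg, integral_image_eq_integral_abs_deriv_smul MeasurableSet.univ hder hinj,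
    Measure.restrict_univ] at h1
  have h2 : ∀ t : ℝ, |-(2 / m) * φ t| • (((φ t : ℝ) : ℂ) ^ ((m : ℂ) / 2 * s - 1) *
      Complex.exp (-(((m * Real.pi : ℝ) : ℂ) * (φ t : ℂ)))) = ((2 / m : ℝ) : ℂ) * (Complex.exp (-(s * t)) *
      ((Real.exp (-(m * Real.pi * Real.exp (-(2 / m) * t))) : ℝ) : ℂ)) := fun t => by
    have hφ0 : 0 < φ t := Real.exp_pos _
    have h3 : (φ t : ℂ) * (φ t : ℂ) ^ ((m : ℂ) / 2 * s - 1) = Complex.exp (-(s * t)) := by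
      rw [Complex.cpow_sub _ _ (by exact_mod_cast hφ0.ne'), Complex.cpow_one,
        mul_div_cancel₀ _ (by exact_mod_cast hφ0.ne'),
        Complex.cpow_def_of_ne_zero (by exact_mod_cast hφ0.ne'), ← Complex.ofReal_log hφ0.le, hφ]
      dsimp only
      rw [Real.log_exp]
      push_cast
      congr 1
      have : (m : ℂ) ≠ 0 := by exact_mod_cast hm.ne'
      field_simp
    rw [abs_mul, abs_neg, abs_of_pos hc, abs_of_pos hφ0, Complex.real_smul, ← h3,
      show Real.exp (-(2 / m) * t) = φ t from rfl]
    push_cast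
    ring
  simp only [h2] at h1
  rw [integral_const_mul] at h1
  intro h
  rw [h, mul_zero] at h1
  refine mul_ne_zero ?_ (Complex.Gamma_ne_zero_of_re_pos ?_) h1.symm
  · rw [Complex.cpow_def_of_ne_zero]
    · exact Complex.exp_ne_zero _
    · exact one_div_ne_zero (by exact_mod_cast (mul_pos hm Real.pi_pos).ne')
  · rw [show ((m : ℂ) / 2 * s) = ((m / 2 : ℝ) : ℂ) * s by push_cast; ring, Complex.re_ofReal_mul]
    positivity

end Gamma

/-! ### Nonvanishing of ξ where its integral converges -/

section Nonvanishing

open NumberField MeasureTheory IsDedekindDomain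
open scoped ENNReal

variable {F : Type*} [Field F] [NumberField F]

attribute [local instance] finiteDivisorMeasurableSpace

/-- The degree of a finite divisor. -/
def finiteDegree (D : HeightOneSpectrum (𝓞 F) →₀ ℤ) : ℝ :=
  D.sum fun v m => (m : ℝ) * Real.log (Ideal.absNorm v.asIdeal)

theorem finiteDegree_add (D D' : HeightOneSpectrum (𝓞 F) →₀ ℤ) :
    finiteDegree (D + D') = finiteDegree D + finiteDegree D' :=
  Finsupp.sum_add_index' (fun v => by simp) fun v a b => by push_cast; ring

/-- The completed zeta function does not vanish in the region of absolute convergence. -/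
theorem completedDedekindXi_ne_zero {s : ℂ} (hs : 0 < s.re)
    (h : Integrable (fun T : ℝ => Complex.exp (-(s * T))) (degreeMeasure F)) :
    completedDedekindXi F s ≠ 0 := by
  classical
  have hcount := countable_divisors (F := F)
  let A : (InfinitePlace F → ℝ) → ℂ := fun t => ∏ v, (Complex.exp (-(s * t v)) *
    ((Real.exp (-(v.mult * Real.pi * Real.exp (-(2 / v.mult) * t v))) : ℝ) : ℂ))
  let B : (HeightOneSpectrum (𝓞 F) →₀ ℤ) → ℂ := fun D =>
    if 0 ≤ D then Complex.exp (-(s * finiteDegree D)) else 0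
  have hAB : ∀ D : ArakelovDivisor F, (D.effectivity : ℂ) * Complex.exp (-(s * D.degree)) =
      A D.1 * B D.2 := fun D => by
    dsimp only [A, B]
    by_cases hD : 0 ≤ D.2
    · rw [ArakelovDivisor.effectivity, if_pos hD, if_pos hD, ArakelovDivisor.degree,
        Finset.prod_mul_distrib, ← Complex.exp_sum, Finset.sum_neg_distrib, ← Finset.mul_sum]
      push_cast
      rw [mul_add, neg_add, Complex.exp_add, finiteDegree]
      ring
    · rw [ArakelovDivisor.effectivity, if_neg hD, if_neg hD]
      simp
  have hA0 : ∀ t, A t ≠ 0 := fun t => Finset.prod_ne_zero_iff.2 fun v _ =>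
    mul_ne_zero (Complex.exp_ne_zero _) (by exact_mod_cast (Real.exp_pos _).ne')
  have hxi : completedDedekindXi F s = (∫ t, A t) * ∫ D, B D ∂Measure.count := by
    rw [← integral_prod_mul]
    refine integral_congr_ae (Filter.Eventually.of_forall fun D => ?_)
    dsimp only
    rw [← hAB, norm_cpow, mul_comm]
  -- By Fubini the product is integrable in `D` for some fixed `t`; as `A t ≠ 0`, the Dirichlet
  -- series itself converges absolutely.
  have hB : Summable B := by
    rw [degreeMeasure, integrable_map_measure (measurable_cexp s).aestronglyMeasurable
      measurable_divisor_degree.aemeasurable, integrable_withDensity_iff_integrable_smul'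
      measurable_divisor_effectivity.ennreal_ofReal
      (Filter.Eventually.of_forall fun D => ENNReal.ofReal_lt_top)] at h
    have h1 : Integrable (fun D : ArakelovDivisor F => A D.1 * B D.2)
        (ArakelovDivisor.haar F) := by
      refine h.congr (Filter.Eventually.of_forall fun D => ?_)
      dsimp only [Function.comp_apply]
      rw [ENNReal.toReal_ofReal (effectivity_nonneg D), Complex.real_smul, hAB]
    obtain ⟨t, ht⟩ := h1.prod_right_ae.exists
    have h2 := (integrable_const_mul_iff (IsUnit.mk0 _ (hA0 t)) _).1 ht
    exact (integrable_count_iff.1 h2).of_norm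
  have hBsum : ∫ D, B D ∂Measure.count = ∑' D, B D := by
    rw [integral_countable (integrable_count_iff.2 hB.norm)]
    simp
  rw [hxi, hBsum]
  refine mul_ne_zero ?_ ?_
  · rw [integral_fintype_prod_volume_eq_prod (fun (v : InfinitePlace F) (t : ℝ) =>
      Complex.exp (-(s * t)) *
        ((Real.exp (-(v.mult * Real.pi * Real.exp (-(2 / v.mult) * t))) : ℝ) : ℂ))]
    exact Finset.prod_ne_zero_iff.2 fun v _ => integral_cexp_mul_exp_exp (mult_cast_pos v) hs
  -- `B` is supported on effective divisors, a free commutative monoid, and is multiplicative there.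
  · let ι : (HeightOneSpectrum (𝓞 F) →₀ ℕ) → (HeightOneSpectrum (𝓞 F) →₀ ℤ) :=
      Finsupp.mapRange Nat.cast Nat.cast_zero
    have hι : Function.Injective ι := Finsupp.mapRange_injective _ _ Nat.cast_injective
    have hι0 : ∀ D, 0 ≤ ι D := fun D v => by simp [ι]
    have hιB : ∀ D, B (ι D) = Complex.exp (-(s * finiteDegree (ι D))) := fun D => if_pos (hι0 D)
    rw [← hι.tsum_eq]
    · refine tsum_ne_zero_of_multiplicative _ ?_ (fun D D' => ?_) (hB.comp_injective hι)
      · rw [hιB, show ι 0 = 0 from Finsupp.mapRange_zero, finiteDegree, Finsupp.sum_zero_index]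
        simp
      · rw [hιB, hιB, hιB, show ι (D + D') = ι D + ι D' from
          Finsupp.mapRange_add (fun _ _ => Nat.cast_add _ _) _ _, finiteDegree_add,
          ← Complex.exp_add]
        push_cast
        congr 1
        ring
    · intro D hD
      have hD0 : 0 ≤ D := by
        by_contra hneg
        exact hD (if_neg hneg)
      refine ⟨D.mapRange Int.toNat rfl, Finsupp.ext fun v => ?_⟩
      simpa [ι] using hD0 v

end Nonvanishing

/-! ### Meromorphic continuation and residues -/

section Continuation

open NumberField NumberField.Units Filter Topology

theorem exists_meromorphicNFOn {f : ℂ → ℂ} (hf : MeromorphicOn f Set.univ) :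
    ∃ g : ℂ → ℂ, MeromorphicNFOn g Set.univ ∧ (∀ x, g =ᶠ[𝓝[≠] x] f) ∧
      ∀ x, AnalyticAt ℂ f x → g =ᶠ[𝓝 x] f := by
  refine ⟨toMeromorphicNFOn f Set.univ, meromorphicNFOn_toMeromorphicNFOn f Set.univ,
    fun x => hf.toMeromorphicNFOn_eq_self_on_nhdsNE (Set.mem_univ x), fun x hx => ?_⟩
  have h := toMeromorphicNFOn_eq_toMeromorphicNFAt_on_nhds hf (Set.mem_univ x)
  rwa [toMeromorphicNFAt_eq_self.2 hx.meromorphicNFAt] at h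

variable {F : Type*} [Field F] [NumberField F]

variable (F) in
/-- The entire nonvanishing factor in the completed height zeta function. -/
def discrFactor (s : ℂ) : ℂ := torsionOrder F * ((|(discr F : ℝ)| : ℝ) : ℂ) ^ (s / 2)

theorem discr_cast_ne_zero : ((|(discr F : ℝ)| : ℝ) : ℂ) ≠ 0 := by
  have h0 : 0 < |(discr F : ℝ)| := abs_pos.2 (by exact_mod_cast discr_ne_zero F)
  exact_mod_cast h0.ne'

theorem discrFactor_ne_zero (s : ℂ) : discrFactor F s ≠ 0 := by
  refine mul_ne_zero (by exact_mod_cast torsionOrder_ne_zero F) ?_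
  rw [Complex.cpow_def_of_ne_zero discr_cast_ne_zero]
  exact Complex.exp_ne_zero _

theorem differentiable_discrFactor : Differentiable ℂ (discrFactor F) := fun _ =>
  ((differentiableAt_id.div_const 2).const_cpow (Or.inl discr_cast_ne_zero)).const_mul _

theorem analyticAt_discrFactor (s : ℂ) : AnalyticAt ℂ (discrFactor F) s :=
  differentiable_discrFactor.analyticAt s

theorem analyticAt_lambda (P : WeakFEPair ℂ) {s : ℂ} (h0 : s ≠ 0) (hk : s ≠ P.k) :
    AnalyticAt ℂ P.Λ s := by
  have hU : IsOpen ({0, (P.k : ℂ)}ᶜ : Set ℂ) := (Set.toFinite _).isClosed.isOpen_compl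
  refine DifferentiableOn.analyticAt (s := {0, (P.k : ℂ)}ᶜ) (fun z hz => ?_)
    (hU.mem_nhds (by simp [h0, hk]))
  simp only [Set.mem_compl_iff, Set.mem_insert_iff, Set.mem_singleton_iff, not_or] at hz
  exact (P.differentiableAt_Λ (.inl hz.1) (.inl hz.2)).differentiableWithinAt

theorem meromorphicAt_lambda (P : WeakFEPair ℂ) (s : ℂ) : MeromorphicAt P.Λ s := by
  have h : MeromorphicAt P.Λ₀ s := (P.differentiable_Λ₀.analyticAt s).meromorphicAt
  have h1 : MeromorphicAt (fun s : ℂ => 1 / s * P.f₀) s := by fun_prop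
  have h2 : MeromorphicAt (fun s : ℂ => P.ε / (P.k - s) * P.g₀) s := by fun_prop
  exact (h.sub h1).sub h2

/-- Meromorphic continuation of a quotient of completed functions. -/
theorem exists_continuation (P : WeakFEPair ℂ) (hk : 1 ≤ P.k) {ξ : ℂ → ℂ}
    (hξ : MeromorphicNFOn ξ Set.univ) (hξ1 : AnalyticOnNhd ℂ ξ {s | 1 < s.re})
    (hξ0 : ∀ s : ℂ, 1 < s.re → ξ s ≠ 0) {ζ : ℂ → ℂ}
    (hζ : ∀ s : ℂ, P.k < s.re → discrFactor F s * ξ s * ζ s = P.Λ s) :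
    ∃ Z : ℂ → ℂ, MeromorphicNFOn Z Set.univ ∧ Set.EqOn Z ζ {s | P.k < s.re} ∧
      (∀ x, ∀ᶠ s in 𝓝[≠] x, discrFactor F s * ξ s * Z s = P.Λ s) ∧
      AnalyticOnNhd ℂ Z ({s | 1 < s.re} \ {(P.k : ℂ)}) := by
  have hf : MeromorphicOn (fun s => P.Λ s / (discrFactor F s * ξ s)) Set.univ := fun x _ =>
    (meromorphicAt_lambda P x).div
      ((analyticAt_discrFactor x).meromorphicAt.mul (hξ (Set.mem_univ x)).meromorphicAt)
  have hfa : ∀ s : ℂ, 1 < s.re → s ≠ P.k →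
      AnalyticAt ℂ (fun s => P.Λ s / (discrFactor F s * ξ s)) s := fun s hs hsk =>
    (analyticAt_lambda P (fun h => by simp [h] at hs; linarith) hsk).div
      ((analyticAt_discrFactor s).mul (hξ1 s hs)) (mul_ne_zero (discrFactor_ne_zero s) (hξ0 s hs))
  obtain ⟨Z, hZ, hZne, hZa⟩ := exists_meromorphicNFOn hf
  refine ⟨Z, hZ, fun s hs => ?_, fun x => ?_, fun s hs => ?_⟩
  · have hs : P.k < s.re := hs
    have hs1 : 1 < s.re := hk.trans_lt hs
    rw [(hZa s (hfa s hs1 fun h => by simp [h] at hs)).eq_of_nhds]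
    rw [← hζ s hs, mul_div_cancel_left₀ _ (mul_ne_zero (discrFactor_ne_zero s) (hξ0 s hs1))]
  -- Nonvanishing at `2` propagates through the connected plane: `ξ` is not identically zero near
  -- any point, so it can be divided out on punctured neighbourhoods.
  · have hord : meromorphicOrderAt ξ x ≠ ⊤ := by
      refine hξ.meromorphicOn.meromorphicOrderAt_ne_top_of_isPreconnected (x := 2)
        isPreconnected_univ (Set.mem_univ _) (Set.mem_univ _) ?_
      have h2 : (2 : ℂ) ∈ {s : ℂ | 1 < s.re} := by simp
      have : meromorphicOrderAt ξ 2 = 0 := by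
        rw [(hξ (Set.mem_univ _)).meromorphicOrderAt_eq_zero_iff]
        exact hξ0 2 h2
      simp [this]
    have hne := (meromorphicOrderAt_ne_top_iff_eventually_ne_zero
      (hξ (Set.mem_univ x)).meromorphicAt).1 hord
    filter_upwards [hne, hZne x] with s h1 h2
    rw [h2]
    exact mul_div_cancel₀ _ (mul_ne_zero (discrFactor_ne_zero s) h1)
  · exact (hfa s hs.1 hs.2).congr (hZa s (hfa s hs.1 hs.2)).symm

variable {V : Type*} [AddCommGroup V] [Module F V] [Module (𝓞 F) V] [IsScalarTower (𝓞 F) F V]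
  [FiniteDimensional F V] (E : ArakelovBundle F V)

theorem subsingleton_projectivization (h : finrank F V = 1) : Subsingleton (ℙ F V) := by
  refine ⟨fun P Q => ?_⟩
  obtain ⟨a, ha⟩ := (finrank_eq_one_iff_of_nonzero' _ Q.rep_nonzero).1 h P.rep
  rw [← P.mk_rep, ← Q.mk_rep, Projectivization.mk_eq_mk_iff']
  exact ⟨a, ha⟩

/-- The completed zeta function of the field in terms of the completed zeta function of a line
bundle. -/
theorem completedDedekindXi_eq_of_line (hV : finrank F V = 1) (P : ℙ F V) {s : ℂ} (hs : 1 < s.re) :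
    completedDedekindXi F s ≠ 0 ∧ completedDedekindXi F s =
      (thetaPair E (hV ▸ one_pos)).Λ s / (discrFactor F s * (E.height P : ℂ) ^ (-s)) := by
  have hk : (thetaPair E (hV ▸ one_pos)).k < s.re := by
    change ((finrank F V : ℕ) : ℝ) < s.re
    rw [hV]
    exact_mod_cast hs
  obtain ⟨h1, h2⟩ := hasSum_height_mul_xi E ((thetaPair E (hV ▸ one_pos)).hasMellin hk)
  have hsub := subsingleton_projectivization (F := F) hV
  refine ⟨completedDedekindXi_ne_zero (one_pos.trans hs) (h1 ⟨P⟩), ?_⟩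
  have h3 := h2.unique (hasSum_single P fun Q hQ => absurd (Subsingleton.elim Q P) hQ)
  rw [h3, ← discrFactor, eq_div_iff (mul_ne_zero (discrFactor_ne_zero s) ?_)]
  · ring
  · rw [height_cpow]
    exact Complex.exp_ne_zero _

/-- A rank-one bundle has a single line, so `Λ(s) = w |Δ|^(s/2) H^(-s) ξ(s)`, and `Λ` is already
continued. Its possible poles `0` and `1` lie outside `1 < re s`. -/
theorem exists_xi_continuation (E : ArakelovBundle F V) (hV : finrank F V = 1) :
    ∃ ξ : ℂ → ℂ, MeromorphicNFOn ξ Set.univ ∧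
      Set.EqOn ξ (completedDedekindXi F) {s | 1 < s.re} ∧
      AnalyticOnNhd ℂ ξ {s | 1 < s.re} ∧ ∀ s : ℂ, 1 < s.re → ξ s ≠ 0 := by
  have : Nontrivial V := nontrivial_of_finrank_pos (R := F) (hV ▸ one_pos)
  obtain ⟨x, hx⟩ := exists_ne (0 : V)
  let P : ℙ F V := Projectivization.mk F x hx
  have hH : ∀ s : ℂ, AnalyticAt ℂ (fun s => (E.height P : ℂ) ^ (-s)) s := fun s => by
    simp only [height_cpow]
    fun_prop
  have hH0 : ∀ s : ℂ, (E.height P : ℂ) ^ (-s) ≠ 0 := fun s => by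
    rw [height_cpow]
    exact Complex.exp_ne_zero _
  have hf : MeromorphicOn (fun s => (thetaPair E (hV ▸ one_pos)).Λ s /
      (discrFactor F s * (E.height P : ℂ) ^ (-s))) Set.univ := fun x _ =>
    (meromorphicAt_lambda _ x).div
      ((analyticAt_discrFactor x).meromorphicAt.mul (hH x).meromorphicAt)
  have hfa : ∀ s : ℂ, 1 < s.re → AnalyticAt ℂ (fun s => (thetaPair E (hV ▸ one_pos)).Λ s /
      (discrFactor F s * (E.height P : ℂ) ^ (-s))) s := fun s hs => by
    refine (analyticAt_lambda _ (fun h => ?_) fun h => ?_).div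
      ((analyticAt_discrFactor s).mul (hH s)) (mul_ne_zero (discrFactor_ne_zero s) (hH0 s))
    · rw [h, Complex.zero_re] at hs
      linarith
    · rw [h, Complex.ofReal_re] at hs
      change (1 : ℝ) < (finrank F V : ℕ) at hs
      rw [hV] at hs
      simp at hs
  obtain ⟨ξ, hξ, -, hξa⟩ := exists_meromorphicNFOn hf
  have heq : Set.EqOn ξ (completedDedekindXi F) {s | 1 < s.re} := fun s hs => by
    rw [(hξa s (hfa s hs)).eq_of_nhds, (completedDedekindXi_eq_of_line E hV P hs).2]
  refine ⟨ξ, hξ, heq, fun s hs => (hfa s hs).congr (hξa s (hfa s hs)).symm, fun s hs => ?_⟩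
  rw [heq hs]
  exact (completedDedekindXi_eq_of_line E hV P hs).1

/-- The convergent series carries the factor `ξ(s)`; as this is nonzero it can be divided out. This
is what proves absolute convergence of the height zeta function. -/
theorem height_mul_xi {P : WeakFEPair ℂ} {s : ℂ} (h : HasMellin (fun X : ℝ =>
      (thetaTotal E (Real.log |(discr F : ℝ)| / 2 - Real.log X) : ℂ) -
        ((classNumber F * regulator F : ℝ) : ℂ)) s (P.Λ s)) (hs : completedDedekindXi F s ≠ 0) :
    (Summable fun P : ℙ F V => (E.height P : ℂ) ^ (-s)) ∧
      discrFactor F s * completedDedekindXi F s * E.heightZeta s = P.Λ s := by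
  obtain ⟨-, h2⟩ := hasSum_height_mul_xi E h
  have h0 : discrFactor F s * completedDedekindXi F s ≠ 0 :=
    mul_ne_zero (discrFactor_ne_zero s) hs
  refine ⟨(summable_mul_left_iff h0).1 h2.summable, ?_⟩
  rw [ArakelovBundle.heightZeta, ← tsum_mul_left]
  exact h2.tsum_eq

/-- The residue of `Λ` at `k` is `ε g₀`, and dividing by `D` gives the limit. As the limit is finite
and nonzero, `(s - k) Z` has order `0`, so `Z` has a simple pole. -/
theorem residue_of_eventually (P : WeakFEPair ℂ) {D Z : ℂ → ℂ}
    (hD : ContinuousAt D P.k) (hD0 : D P.k ≠ 0) (hZ : MeromorphicAt Z P.k) (hg : P.g₀ ≠ 0)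
    (h : ∀ᶠ s in 𝓝[≠] (P.k : ℂ), D s * Z s = P.Λ s) :
    meromorphicOrderAt Z P.k = -1 ∧
      Tendsto (fun s => (s - P.k) * Z s) (𝓝[≠] (P.k : ℂ)) (𝓝 (P.ε * P.g₀ / D P.k)) := by
  have hlim : Tendsto (fun s => (s - P.k) * Z s) (𝓝[≠] (P.k : ℂ)) (𝓝 (P.ε * P.g₀ / D P.k)) := by
    refine (P.Λ_residue_k.div (hD.tendsto.mono_left nhdsWithin_le_nhds) hD0).congr' ?_
    filter_upwards [h, (hD.eventually_ne hD0).filter_mono nhdsWithin_le_nhds] with s h1 h2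
    rw [Pi.div_apply, smul_eq_mul, ← h1]
    field_simp
  refine ⟨?_, hlim⟩
  have hid : MeromorphicAt (fun s : ℂ => s - P.k) P.k := by fun_prop
  have h0 := (tendsto_ne_zero_iff_meromorphicOrderAt_eq_zero (hid.mul hZ)).1
    ⟨_, div_ne_zero (mul_ne_zero P.hε hg) hD0, hlim⟩
  have h1 : meromorphicOrderAt (fun s : ℂ => s - P.k) P.k = 1 :=
    meromorphicOrderAt_id_sub_const
  rw [meromorphicOrderAt_mul hid hZ, h1] at h0
  lift meromorphicOrderAt Z P.k to ℤ using (fun h => by simp [h] at h0) with n hn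
  have h2 : n = -1 := by
    norm_cast at h0
    linarith
  rw [h2]
  rfl

end Continuation

end Arakelov

end

/-! ### The main theorem -/

open Arakelov Filter Topology NumberField NumberField.Units

theorem mainTheorem1 (F : Type*) [Field F] [NumberField F] (V : Type*) [AddCommGroup V]
    [Module F V] [FiniteDimensional F V] [Module (𝓞 F) V] [IsScalarTower (𝓞 F) F V]
    (E : ArakelovBundle F V) (r : ℕ) (hr : Module.finrank F V = r) (hr1 : 1 ≤ r) :
    (∀ s : ℂ, (r : ℝ) < s.re → Summable fun P : ℙ F V => (E.height P : ℂ) ^ (-s)) ∧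
    DifferentiableOn ℂ E.heightZeta {s : ℂ | (r : ℝ) < s.re} ∧
    ∃ ξ Z Z' : ℂ → ℂ,
      IsMeromorphicContinuation (completedDedekindXi F) 1 ξ ∧
      IsMeromorphicContinuation E.heightZeta r Z ∧
      IsMeromorphicContinuation E.dual.heightZeta r Z' ∧
      DifferentiableOn ℂ Z ({s : ℂ | 1 < s.re} \ {(r : ℂ)}) ∧
      (2 ≤ r →
        meromorphicOrderAt Z (r : ℂ) = -1 ∧
        Filter.Tendsto (fun s : ℂ => (s - r) * Z s) (nhdsWithin (r : ℂ) {(r : ℂ)}ᶜ)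
          (nhds ((NumberField.Units.regulator F : ℂ) * (NumberField.classNumber F : ℂ) *
              (E.norm : ℂ) /
            ((NumberField.Units.torsionOrder F : ℂ) *
              ((|NumberField.discr F| : ℤ) : ℂ) ^ ((r : ℂ) / 2) * ξ r)))) ∧
      ∀ s : ℂ, AnalyticAt ℂ ξ s → AnalyticAt ℂ Z s →
        AnalyticAt ℂ ξ (r - s) → AnalyticAt ℂ Z' (r - s) →
        (E.norm : ℂ) ^ (-(1 / 2) : ℂ) * ((|NumberField.discr F| : ℤ) : ℂ) ^ (s / 2) *
            ξ s * Z s =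
          (E.dual.norm : ℂ) ^ (-(1 / 2) : ℂ) *
            ((|NumberField.discr F| : ℤ) : ℂ) ^ (((r : ℂ) - s) / 2) * ξ (r - s) * Z' (r - s) := by
  subst hr
  have hdisc : ((|discr F| : ℤ) : ℂ) = ((|(discr F : ℝ)| : ℝ) : ℂ) := by
    rw [← Int.cast_abs, Complex.ofReal_intCast]
  rw [hdisc]
  have hrpos : 0 < finrank F V := hr1
  have hdual : finrank F (Dual F V) = finrank F V := Subspace.dual_finrank_eq
  set P := thetaPair E hrpos with hP
  have hPk : P.k = (finrank F V : ℝ) := rfl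
  have hPkC : (P.k : ℂ) = (finrank F V : ℂ) := Complex.ofReal_natCast _
  have hk1 : 1 ≤ P.k := by
    rw [hPk]
    exact_mod_cast hr1
  have : Nontrivial V := nontrivial_of_finrank_pos (R := F) hrpos
  obtain ⟨x, hx⟩ := exists_ne (0 : V)
  -- Any line in `V`, with its subbundle structure, serves as the rank-one bundle that continues
  -- `ξ`.
  obtain ⟨ξ, hξ, hξeq, hξa, hξ0⟩ := exists_xi_continuation
    (E.restrict (Projectivization.mk F x hx).submodule)
    (Projectivization.finrank_submodule _)
  have hE : ∀ s : ℂ, P.k < s.re → (Summable fun P : ℙ F V => (E.height P : ℂ) ^ (-s)) ∧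
      discrFactor F s * ξ s * E.heightZeta s = P.Λ s := fun s hs => by
    have hs1 : s ∈ {s : ℂ | 1 < s.re} := hk1.trans_lt hs
    rw [hξeq hs1]
    exact height_mul_xi E (P.hasMellin hs) (hξeq hs1 ▸ hξ0 s hs1)
  -- The first function of `P.symm` is the theta average of `E.dual`. Using it instead of the pair
  -- attached to `E.dual` avoids comparing `E` with its bidual.
  have hE' : ∀ s : ℂ, P.k < s.re →
      discrFactor F s * ξ s * E.dual.heightZeta s = P.symm.Λ s := fun s hs => by
    have hs1 : s ∈ {s : ℂ | 1 < s.re} := hk1.trans_lt hs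
    rw [hξeq hs1]
    exact (height_mul_xi E.dual (P.symm.hasMellin hs) (hξeq hs1 ▸ hξ0 s hs1)).2
  obtain ⟨Z, hZ, hZeq, hZΛ, hZa⟩ := exists_continuation P hk1 hξ hξa hξ0 fun s hs => (hE s hs).2
  obtain ⟨Z', hZ', hZeq', hZΛ', -⟩ := exists_continuation P.symm hk1 hξ hξa hξ0 hE'
  rw [← hPkC, ← hPk]
  refine ⟨fun s hs => (hE s hs).1, ?_, ξ, Z, Z', ⟨hξ, hξeq⟩, ⟨hZ, hZeq⟩, ⟨hZ', hZeq'⟩,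
    hZa.differentiableOn, fun hr2 => ?_, fun s hξs hZs hξs' hZs' => ?_⟩
  · refine (hZa.differentiableOn.mono fun s hs => ?_).congr fun s hs => (hZeq hs).symm
    refine ⟨hk1.trans_lt hs, fun h => ?_⟩
    rw [Set.mem_singleton_iff.1 h] at hs
    simp at hs
  -- The bound `2 ≤ r` places `r` where `ξ` is finite and nonzero. In rank one the pole of `Λ` at
  -- `1` belongs to `ξ`.
  · have hk : (P.k : ℂ) ∈ {s : ℂ | 1 < s.re} := by
      change 1 < (P.k : ℂ).re
      rw [Complex.ofReal_re, hPk]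
      exact_mod_cast hr2
    have hg : P.g₀ ≠ 0 := by
      change ((classNumber F * regulator F : ℝ) : ℂ) ≠ 0
      exact_mod_cast mul_ne_zero (by exact_mod_cast classNumber_ne_zero F) (regulator_ne_zero F)
    obtain ⟨h1, h2⟩ := residue_of_eventually P (D := fun s => discrFactor F s * ξ s)
      ((analyticAt_discrFactor _).mul (hξa _ hk)).continuousAt
      (mul_ne_zero (discrFactor_ne_zero _) (hξ0 _ hk)) (hZ (Set.mem_univ _)).meromorphicAt hg
      (hZΛ _)
    refine ⟨h1, ?_⟩
    convert h2 using 2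
    change _ = (E.norm : ℂ) * ((classNumber F * regulator F : ℝ) : ℂ) / _
    rw [discrFactor]
    push_cast
    ring
  · have hrefl : Tendsto (fun u : ℂ => P.k - u) (𝓝[≠] s) (𝓝[≠] ((P.k : ℂ) - s)) := by
      refine tendsto_nhdsWithin_iff.2 ⟨(continuous_const.sub continuous_id).continuousAt.tendsto.mono_left
        nhdsWithin_le_nhds, ?_⟩
      filter_upwards [self_mem_nhdsWithin] with u hu h
      exact hu (sub_right_injective h)
    -- The product identities are only known on punctured neighbourhoods, since normal forms take
    -- the value `0` at poles. They are compared there and carried to `s` by continuity at `s` and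
    -- at `r - s`.
    have hev : (fun u => discrFactor F u * ξ u * Z u) =ᶠ[𝓝[≠] s] fun u =>
        P.ε * (discrFactor F (P.k - u) * ξ (P.k - u) * Z' (P.k - u)) := by
      filter_upwards [hZΛ s, hrefl.eventually (hZΛ' (P.k - s))] with u h1 h2
      rw [h1, h2, ← smul_eq_mul, ← P.functional_equation, sub_sub_cancel]
    have hc1 : ContinuousAt (fun u => discrFactor F u * ξ u * Z u) s :=
      (((analyticAt_discrFactor s).mul hξs).mul hZs).continuousAt
    have hc2 : ContinuousAt (fun u => discrFactor F u * ξ u * Z' u) (P.k - s) :=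
      (((analyticAt_discrFactor _).mul hξs').mul hZs').continuousAt
    have hc3 : Tendsto (fun u => P.ε * (discrFactor F (P.k - u) * ξ (P.k - u) * Z' (P.k - u)))
        (𝓝[≠] s) (𝓝 (P.ε * (discrFactor F (P.k - s) * ξ (P.k - s) * Z' (P.k - s)))) :=
      ((hc2.tendsto.mono_left nhdsWithin_le_nhds).comp hrefl).const_mul _
    have hfe := tendsto_nhds_unique ((hc1.tendsto.mono_left nhdsWithin_le_nhds).congr' hev) hc3
    have hN : (E.norm : ℂ) ≠ 0 := by exact_mod_cast (norm_pos E).ne'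
    have hNinv : (E.dual.norm : ℂ) ^ (-(1 / 2) : ℂ) = (E.norm : ℂ) ^ (1 / 2 : ℂ) := by
      -- Inversion commutes with the principal power because the norm is positive, so its argument
      -- is `0` and not `π`.
      rw [norm_dual, Complex.ofReal_inv, Complex.inv_cpow _ _ (by
        rw [Complex.arg_ofReal_of_nonneg (norm_pos E).le]
        exact Real.pi_ne_zero.symm), Complex.cpow_neg, inv_inv]
    have hNsplit : (E.norm : ℂ) ^ (-(1 / 2) : ℂ) * E.norm = (E.norm : ℂ) ^ (1 / 2 : ℂ) := by
      nth_rewrite 2 [← Complex.cpow_one (E.norm : ℂ)]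
      rw [← Complex.cpow_add _ _ hN]
      norm_num
    have hw : (torsionOrder F : ℂ) ≠ 0 := by exact_mod_cast torsionOrder_ne_zero F
    rw [hNinv, ← hNsplit]
    refine mul_left_cancel₀ hw ?_
    simp only [discrFactor] at hfe
    change _ = (E.norm : ℂ) * _ at hfe
    linear_combination (E.norm : ℂ) ^ (-(1 / 2) : ℂ) * hfe
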